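/- Setting. Let $\{\Omega(t)\}_{t\in\mathbb R}$ be bounded domains in $\mathbb R^3$ with smooth boundary, let $Q_\infty=\bigcup_{t}\Omega(t)\times\{t\}$, and let $\Phi(x,t)=(\phi(x,t),t)$ be a level-preserving $C^\infty$ diffeomorphism of $\overline{Q_\infty}$ onto $\overline{\widetilde\Omega\times\mathbb R}$, with $\widetilde\Omega\subset\mathbb R^3$ open and $\phi(\cdot,t)$ mapping $\Omega(t)$ onto $\widetilde\Omega$ for every $t$, such that $\det\big(\partial\phi^i/\partial x^j(x,t)\big)=J(t)^{-1}>0$ depends only on $t$. Write $y=\phi(x,t)$ and $x=\phi^{-1}(y,t)$, and let $$g_{ij}=\sum_k\frac{\partial x^k}{\partial y^i}\frac{\partial x^k}{\partial y^j},\qquad g^{ij}=\sum_k\frac{\partial y^i}{\partial x^k}\frac{\partial y^j}{\partial x^k},\qquad \Gamma^k_{ij}=\frac12\sum_\ell g^{k\ell}\Big(\frac{\partial g_{i\ell}}{\partial y^j}+\frac{\partial g_{j\ell}}{\partial y^i}-\frac{\partial g_{ij}}{\partial y^\ell}\Big),$$ all as functions of $(y,t)$. For vector fields on $\widetilde\Omega$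 put $N[\widetilde u,\widetilde v]^i=\sum_j\widetilde u^j\big(\frac{\partial\widetilde v^i}{\partial y^j}+\sum_k\Gamma^i_{jk}\widetilde v^k\big)$ and $\langle \widetilde a,\widetilde b\rangle_t=\int_{\widetilde\Omega}\sum_{i,j}g_{ij}(y,t)\widetilde a^i\widetilde b^j J(t)\,dy$. For a function $\widetilde\theta$ put, with indices $j+1,j+2$ taken cyclically in $\{1,2,3\}$, $$\big[\mathrm{Rot}(t)[\widetilde\theta,\widetilde w]\big]^i=\sum_{j,k,\ell}\frac{\partial y^i}{\partial x^j}\Big(\frac{\partial y^k}{\partial x^{j+1}}\frac{\partial^2x^{j+2}}{\partial y^k\partial y^\ell}-\frac{\partial y^k}{\partial x^{j+2}}\frac{\partial^2x^{j+1}}{\partial y^k\partial y^\ell}\Big)\widetilde\theta\,\widetilde w^\ell+\sum_{j,k,\ell}\frac{\partial y^i}{\partial x^j}\Big(\frac{\partial y^k}{\partial x^{j+1}}\frac{\partial x^{j+2}}{\partial y^\ell}-\frac{\partial y^k}{\partial x^{j+2}}\frac{\partial x^{j+1}}{\partial y^\ell}\Big)\Big(\frac{\partial\widetilde\theta}{\partial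 y^k}\widetilde w^\ell+\widetilde\theta\,\frac{\partial\widetilde w^\ell}{\partial y^k}\Big),$$ the transform to $\widetilde\Omega$ of $\mathrm{rot}(\theta w)$ on $\Omega(t)$. Let $d(y)=\mathrm{dist}(y,\partial\widetilde\Omega)$, and let $H^1_{0,\sigma}(\widetilde\Omega)$ be the $H^1$-closure of the smooth divergence-free vector fields with compact support in $\widetilde\Omega$. Statement. Let $T>0$, $\widetilde w\in C([0,T];H^2(\widetilde\Omega))$, $\varepsilon>0$ and $\rho_0>0$. Then there are $\rho\in(0,\rho_0)$ and a cut-off function $\widetilde\theta\in C^\infty(\overline{\widetilde\Omega})$ with values in $[0,1]$ such that $$\widetilde\theta(y)=1\ \text{ if } d(y)<\tfrac12e^{-2/\rho},\qquad \widetilde\theta(y)=0\ \text{ if } d(y)>2e^{-1/\rho},\qquad |\nabla\widetilde\theta(y)|\le\frac{2\sqrt3\,\rho}{d(y)}\ \text{ in }\widetilde\Omega,$$ and such that, for all $t\in[0,T]$ and all $\widetilde u\in H^1_{0,\sigma}(\widetilde\Omega)$, the integrand of $\langle N[\widetilde u,\widetilde u],\mathrm{Rot}(t)[\widetilde\theta,\widetilde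 w(t)]\rangle_t$ is integrable on $\widetilde\Omega$ and, if $\widetilde u\neq0$, $$\big\langle N[\widetilde u,\widetilde u],\mathrm{Rot}(t)[\widetilde\theta,\widetilde w(t)]\big\rangle_t<\varepsilon\,\|\nabla_y\widetilde u\|_{L^2(\widetilde\Omega)}^2 .$$ -/

import Mathlib

open Set MeasureTheory
open scoped ContDiff ENNReal

noncomputable section

namespace MovingDomain

/-- Three-dimensional Euclidean space. -/
abbrev E3 : Type := EuclideanSpace ℝ (Fin 3)

/-- The classical partial derivative `∂f/∂y^j`. -/
def pd (j : Fin 3) (f : E3 → ℝ) (y : E3) : ℝ :=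
  fderiv ℝ f y (EuclideanSpace.single j 1)

/-! ### Domains and the moving family -/

/-- The boundary of `U` is smooth and `U` lies locally on one side of it: near every boundary point
a smooth change of coordinates turns `U` into a half space. -/
def HasSmoothBoundary (U : Set E3) : Prop :=
  ∀ x ∈ frontier U, ∃ e : OpenPartialHomeomorph E3 E3,
    x ∈ e.source ∧ ContDiffOn ℝ ∞ e e.source ∧ ContDiffOn ℝ ∞ e.symm e.target ∧
      ∀ z ∈ e.source, z ∈ U ↔ 0 < e z 0

/-- A bounded domain (nonempty connected open set) with smooth boundary. -/
structure IsBoundedSmoothDomain (U : Set E3) : Prop where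
  isOpen : IsOpen U
  isConnected : IsConnected U
  isBounded : Bornology.IsBounded U
  smoothBoundary : HasSmoothBoundary U

/-- The noncylindrical domain `Q_∞ = ⋃ₜ Ω(t) × {t}`. -/
def spaceTime (Ω : ℝ → Set E3) : Set (E3 × ℝ) := {p | p.1 ∈ Ω p.2}

/-- A family `Ω(t)`, `t ∈ ℝ`, of bounded smooth domains together with a level-preserving smooth
diffeomorphism `Φ(x,t) = (φ(x,t),t)` of the closure of `Q_∞` onto the closure of `Ω̃ × ℝ`, with
inverse `(y,s) ↦ (ψ(y,s),s)`, carrying each `Ω(t)` onto `Ω̃`, whose spatial Jacobian determinant is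
positive and depends on time only, being equal to `J(t)⁻¹`. -/
structure Family where
  /-- the moving domain `Ω(t)` -/
  Ω : ℝ → Set E3
  /-- the reference domain `Ω̃` -/
  Ωref : Set E3
  /-- `y = φ(x,t)` -/
  φ : E3 → ℝ → E3
  /-- `x = φ⁻¹(y,t)` -/
  ψ : E3 → ℝ → E3
  /-- the inverse Jacobian determinant -/
  J : ℝ → ℝ
  domain : ∀ t, IsBoundedSmoothDomain (Ω t)
  isOpen_ref : IsOpen Ωref
  φ_smooth : ContDiffOn ℝ ∞ (fun p : E3 × ℝ => φ p.1 p.2) (closure (spaceTime Ω))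
  ψ_smooth : ContDiffOn ℝ ∞ (fun p : E3 × ℝ => ψ p.1 p.2) (closure (Ωref ×ˢ (univ : Set ℝ)))
  φ_mapsTo : ∀ x t, (x, t) ∈ closure (spaceTime Ω) →
    (φ x t, t) ∈ closure (Ωref ×ˢ (univ : Set ℝ))
  ψ_mapsTo : ∀ y t, (y, t) ∈ closure (Ωref ×ˢ (univ : Set ℝ)) →
    (ψ y t, t) ∈ closure (spaceTime Ω)
  ψ_φ : ∀ x t, (x, t) ∈ closure (spaceTime Ω) → ψ (φ x t) t = x
  φ_ψ : ∀ y t, (y, t) ∈ closure (Ωref ×ˢ (univ : Set ℝ)) → φ (ψ y t) t = y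
  φ_image : ∀ t, (fun x => φ x t) '' Ω t = Ωref
  J_pos : ∀ t, 0 < J t
  det_eq : ∀ t, ∀ x ∈ Ω t,
    Matrix.det (Matrix.of fun i j : Fin 3 => pd j (fun z => φ z t i) x) = (J t)⁻¹

namespace Family

variable (D : Family)

/-- `∂x^k/∂y^i (y,t)`. -/
def dx (t : ℝ) (k i : Fin 3) (y : E3) : ℝ := pd i (fun z => D.ψ z t k) y

/-- `∂²x^k/∂y^i∂y^j (y,t)`. -/
def ddx (t : ℝ) (k i j : Fin 3) (y : E3) : ℝ := pd i (fun z => D.dx t k j z) y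

/-- `∂y^i/∂x^k`, evaluated at `x = φ⁻¹(y,t)` and regarded as a function of `y`. -/
def dy (t : ℝ) (i k : Fin 3) (y : E3) : ℝ := pd k (fun x => D.φ x t i) (D.ψ y t)

/-- `g^{ij}(y,t)`. -/
def gUp (t : ℝ) (i j : Fin 3) (y : E3) : ℝ := ∑ k, D.dy t i k y * D.dy t j k y

/-- `g_{ij}(y,t)`. -/
def gLow (t : ℝ) (i j : Fin 3) (y : E3) : ℝ := ∑ k, D.dx t k i y * D.dx t k j y

/-- The Christoffel symbol `Γ^k_{ij}(y,t)` of the metric `g_{ij}(·,t)`. -/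
def Γ (t : ℝ) (k i j : Fin 3) (y : E3) : ℝ :=
  1 / 2 * ∑ l, D.gUp t k l y *
    (pd j (D.gLow t i l) y + pd i (D.gLow t j l) y - pd l (D.gLow t i j) y)

/-- The coefficient `R^{i,1}_{j,k,l}(y,t)`; addition in `Fin 3` is the cyclic shift of indices. -/
def R1 (t : ℝ) (i j k l : Fin 3) (y : E3) : ℝ :=
  D.dy t i j y * (D.dy t k (j + 1) y * D.ddx t (j + 2) k l y
    - D.dy t k (j + 2) y * D.ddx t (j + 1) k l y)

/-- The coefficient `R^{i,2}_{j,k,l}(y,t)`. -/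
def R2 (t : ℝ) (i j k l : Fin 3) (y : E3) : ℝ :=
  D.dy t i j y * (D.dy t k (j + 1) y * D.dx t (j + 2) l y
    - D.dy t k (j + 2) y * D.dx t (j + 1) l y)

end Family

/-! ### Sobolev spaces -/

/-- The scalar space `L²(U)`. -/
abbrev L2 (U : Set E3) : Type := Lp ℝ 2 (volume.restrict U)

/-- `g` is the weak partial derivative `∂f/∂y^j` in `U`. -/
def IsWeakPartial (U : Set E3) (j : Fin 3) (f g : L2 U) : Prop :=
  ∀ η : E3 → ℝ, ContDiff ℝ ∞ η → HasCompactSupport η → tsupport η ⊆ U →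
    ∫ y in U, f y * pd j η y = - ∫ y in U, g y * η y

theorem memLp_test {U : Set E3} {η : E3 → ℝ} (h : Continuous η) (hc : HasCompactSupport η) :
    MemLp η 2 (volume.restrict U) :=
  (h.memLp_of_hasCompactSupport hc).restrict U

theorem memLp_pd_test {U : Set E3} {η : E3 → ℝ} (j : Fin 3) (h : ContDiff ℝ ∞ η)
    (hc : HasCompactSupport η) : MemLp (pd j η) 2 (volume.restrict U) := by
  refine memLp_test ?_ ?_
  · exact (h.continuous_fderiv (by simp)).clm_apply continuous_const
  · exact (hc.fderiv ℝ).comp_left (g := fun L : E3 →L[ℝ] ℝ => L (EuclideanSpace.single j 1)) rfl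

theorem isWeakPartial_zero (U : Set E3) (j : Fin 3) : IsWeakPartial U j 0 0 := by
  intro η _ _ _
  have h0 := Lp.coeFn_zero ℝ 2 (volume.restrict U)
  have h1 : ∫ y in U, (0 : L2 U) y * pd j η y = 0 := by
    rw [integral_eq_zero_of_ae]
    filter_upwards [h0] with y hy
    rw [hy, Pi.zero_apply, zero_mul]
  have h2 : ∫ y in U, (0 : L2 U) y * η y = 0 := by
    rw [integral_eq_zero_of_ae]
    filter_upwards [h0] with y hy
    rw [hy, Pi.zero_apply, zero_mul]
  rw [h1, h2, neg_zero]

theorem integral_add_mul {U : Set E3} (f g : L2 U) {η : E3 → ℝ}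
    (h : MemLp η 2 (volume.restrict U)) :
    ∫ y in U, (f + g) y * η y = (∫ y in U, f y * η y) + ∫ y in U, g y * η y := by
  have hf : Integrable (fun y => f y * η y) (volume.restrict U) := (Lp.memLp f).integrable_mul h
  have hg : Integrable (fun y => g y * η y) (volume.restrict U) := (Lp.memLp g).integrable_mul h
  rw [← integral_add hf hg]
  refine integral_congr_ae ?_
  filter_upwards [Lp.coeFn_add f g] with y hy
  rw [hy, Pi.add_apply, add_mul]

theorem integral_smul_mul {U : Set E3} (c : ℝ) (f : L2 U) (η : E3 → ℝ) :
    ∫ y in U, (c • f) y * η y = c * ∫ y in U, f y * η y := by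
  rw [← integral_const_mul]
  refine integral_congr_ae ?_
  filter_upwards [Lp.coeFn_smul c f] with y hy
  rw [hy, Pi.smul_apply, smul_eq_mul, mul_assoc]

theorem IsWeakPartial.add {U : Set E3} {j : Fin 3} {f g f' g' : L2 U}
    (h : IsWeakPartial U j f g) (h' : IsWeakPartial U j f' g') :
    IsWeakPartial U j (f + f') (g + g') := by
  intro η h1 h2 h3
  rw [integral_add_mul _ _ (memLp_pd_test j h1 h2),
    integral_add_mul _ _ (memLp_test h1.continuous h2), h η h1 h2 h3, h' η h1 h2 h3, neg_add]

theorem IsWeakPartial.smul {U : Set E3} {j : Fin 3} {f g : L2 U} (c : ℝ)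
    (h : IsWeakPartial U j f g) : IsWeakPartial U j (c • f) (c • g) := by
  intro η h1 h2 h3
  rw [integral_smul_mul, integral_smul_mul, h η h1 h2 h3, mul_neg]

/-- The scalar Sobolev space `H¹(U)`: an element is `f ∈ L²(U)` together with its (unique) weak
partial derivatives in `L²(U)`; the norm is equivalent to the usual one. -/
def H1 (U : Set E3) : Submodule ℝ (L2 U × (Fin 3 → L2 U)) where
  carrier := {F | ∀ j, IsWeakPartial U j F.1 (F.2 j)}
  zero_mem' := fun j => isWeakPartial_zero U j
  add_mem' := fun h h' j => (h j).add (h' j)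
  smul_mem' := fun c _ h j => (h j).smul c

/-- The scalar Sobolev space `H²(U)`: an element is `f ∈ L²(U)` together with its (unique) weak
partial derivatives of first and second order in `L²(U)`; the norm is equivalent to the usual
one. -/
def H2 (U : Set E3) : Submodule ℝ (L2 U × (Fin 3 → L2 U) × (Fin 3 → Fin 3 → L2 U)) where
  carrier := {F | (∀ j, IsWeakPartial U j F.1 (F.2.1 j)) ∧
    ∀ j k, IsWeakPartial U k (F.2.1 j) (F.2.2 j k)}
  zero_mem' := ⟨fun j => isWeakPartial_zero U j, fun _ k => isWeakPartial_zero U k⟩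
  add_mem' := fun h h' => ⟨fun j => (h.1 j).add (h'.1 j), fun j k => (h.2 j k).add (h'.2 j k)⟩
  smul_mem' := fun c _ h => ⟨fun j => (h.1 j).smul c, fun j k => (h.2 j k).smul c⟩

/-- Vector fields of class `H¹`. -/
abbrev VH1 (U : Set E3) : Type := Fin 3 → H1 U

/-- Vector fields of class `H²`. -/
abbrev VH2 (U : Set E3) : Type := Fin 3 → H2 U

/-- The inclusion of `H²` into `H¹`. -/
def VH2.toVH1 {U : Set E3} (w : VH2 U) : VH1 U :=
  fun i => ⟨((w i).1.1, (w i).1.2.1), (w i).2.1⟩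

/-- The value `u^i(y)` of (a representative of) the `i`-th component. -/
def VH1.val {U : Set E3} (u : VH1 U) (i : Fin 3) (y : E3) : ℝ := (u i).1.1 y

/-- The weak derivative `∂u^i/∂y^j (y)`. -/
def VH1.wd {U : Set E3} (u : VH1 U) (i j : Fin 3) (y : E3) : ℝ := (u i).1.2 j y

/-- `‖∇_y u‖²` in `L²(U)`. -/
def VH1.gradNormSq {U : Set E3} (u : VH1 U) : ℝ := ∑ i, ∑ j, ‖(u i).1.2 j‖ ^ 2

/-- `C_{0,σ}^∞(U)`, viewed inside `H¹(U)`. -/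
def testSolenoidal (U : Set E3) : Set (VH1 U) :=
  {u | ∃ v : E3 → E3, ContDiff ℝ ∞ v ∧ HasCompactSupport v ∧ tsupport v ⊆ U ∧
    (∀ y, ∑ i, pd i (fun z => v z i) y = 0) ∧
    ∀ i, u.val i =ᵐ[volume.restrict U] fun y => v y i}

/-- `H¹_{0,σ}(U)`: the closure of `C_{0,σ}^∞(U)` in the `H¹`-norm. -/
def H10σ (U : Set E3) : Set (VH1 U) := closure (testSolenoidal U)

/-! ### The transformed operators -/

namespace Family

variable (D : Family)

/-- The covariant derivative `∇_j v^i`. -/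
def cov (t : ℝ) (v : VH1 D.Ωref) (j i : Fin 3) (y : E3) : ℝ :=
  v.wd i j y + ∑ k, D.Γ t i j k y * v.val k y

/-- `N[u,v]^i = ∑_j u^j ∇_j v^i`. -/
def N (t : ℝ) (u v : VH1 D.Ωref) (y : E3) (i : Fin 3) : ℝ :=
  ∑ j, u.val j y * D.cov t v j i y

/-- `Rot(t)[θ,w]`, the transform of `rot (θ w)`. -/
def Rot (t : ℝ) (θ : E3 → ℝ) (w : VH1 D.Ωref) (y : E3) (i : Fin 3) : ℝ :=
  (∑ j, ∑ k, ∑ l, D.R1 t i j k l y * (θ y * w.val l y)) +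
    ∑ j, ∑ k, ∑ l, D.R2 t i j k l y * (pd k θ y * w.val l y + θ y * w.wd l k y)

/-- The integrand of `⟨a,b⟩_t`. -/
def pairingDensity (t : ℝ) (a b : E3 → Fin 3 → ℝ) (y : E3) : ℝ :=
  (∑ i, ∑ j, D.gLow t i j y * a y i * b y j) * D.J t

/-- `⟨a,b⟩_t = ∫_Ω̃ ∑ g_{ij}(y,t) a^i b^j J(t) dy`. -/
def pairing (t : ℝ) (a b : E3 → Fin 3 → ℝ) : ℝ := ∫ y in D.Ωref, D.pairingDensity t a b y

end Family

/-- Smooth boundary cut-off function of Hopf–Temam type with parameter `ρ` for the set `U`, where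
`d(y)` is the distance to the boundary of `U`. -/
structure IsBoundaryCutoff (U : Set E3) (ρ : ℝ) (θ : E3 → ℝ) : Prop where
  smooth : ContDiff ℝ ∞ θ
  mem_Icc : ∀ y, θ y ∈ Icc (0 : ℝ) 1
  eq_one : ∀ y ∈ closure U,
    Metric.infDist y (frontier U) < 1 / 2 * Real.exp (-2 / ρ) → θ y = 1
  eq_zero : ∀ y ∈ closure U,
    2 * Real.exp (-1 / ρ) < Metric.infDist y (frontier U) → θ y = 0
  grad_le : ∀ y ∈ U,
    ‖fderiv ℝ θ y‖ ≤ 2 * Real.sqrt 3 * ρ / Metric.infDist y (frontier U)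

end MovingDomain

end

namespace MovingDomain

open Metric Filter Topology

/-! ### Mollification and the boundary cut-off function -/

/-! This is the Hopf–Leray cut-off argument, made quantitative and uniform in time. Write d for the
distance to the boundary of the reference domain. On [0,T] the geometric coefficients are bounded,
so the integrand is pointwise at most a constant times (|∇u| + |u|) · |u| · ((|θ| + |∇θ|)|w| +
|θ||∇w|). The cut-off lives where d ≤ 2e^{-1/ρ} ≤ 2ρ and has gradient at most 4ρ/d, so |u|(|θ| +
|∇θ|) ≤ 6ρ |u|/d. Hardy's inequality bounds |u|/d in L² by ∇u, and w is bounded because H² embeds in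
L^∞. The first term is therefore O(ρ) times the squared gradient norm.

The term with ∇w needs another argument, because ∇w is only controlled in L⁴. In (θ|u|)⁴ one factor
is traded for distance: (θ|u|)⁴ ≤ θ|u| · |u|³ ≤ 2ρ (|u|/d) |u|³. Hardy and the Sobolev embedding in
L⁶ then make θ|u| small in L⁴, of order ρ^{1/4}, and Hölder gives the term
(`lintegral_trilinear_le`). All constants depend on T, the family and a bound for w only
(`exists_lintegral_pairingDensity_le`), so ρ can be chosen last.

Two ingredients have to be obtained on the reference domain, whose boundary regularity is not
assumed but inherited. The diffeomorphism at time 0 has an invertible limiting derivative at each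
boundary point, so a boundary chart of Ω(0) pulls back to a C¹ defining function with nonzero
gradient (`nonempty_localDefining`). Such a function gives Hardy's inequality by an exact-derivative
identity (`LocalDefining.hardy`), and the interior cone property (`LocalDefining.exists_coneOn`).
Averaging over cones represents a Sobolev function by a potential of its derivatives; this yields H¹
⊂ L⁴ and W^{1,4} ⊂ L^∞, hence the bounds on w (`HasCone.exists_bound_of_norm_le`). -/

theorem exists_mollification {F : E3 → ℝ} (hF : Continuous F) {r : ℝ} (hr : 0 < r) :
    ∃ θ : E3 → ℝ, ContDiff ℝ ∞ θ ∧
      (∀ y a b, (∀ x ∈ ball y r, F x ∈ Icc a b) → θ y ∈ Icc a b) ∧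
      ∀ y C, 0 ≤ C → (∀ x ∈ ball y (2 * r), ∀ x' ∈ ball y (2 * r), |F x - F x'| ≤ C * ‖x - x'‖) →
        ‖fderiv ℝ θ y‖ ≤ C := by
  let κ : ContDiffBump (0 : E3) := ⟨r / 2, r, by positivity, by linarith⟩
  set k : E3 → ℝ := κ.normed volume with hk
  have hk0 : ∀ x, 0 ≤ k x := κ.nonneg_normed
  have hk1 : ∫ x, k x = 1 := κ.integral_normed
  have hkc : Continuous k := κ.continuous_normed
  have hks : HasCompactSupport k := κ.hasCompactSupport_normed
  have hksupp : ∀ x, k x ≠ 0 → ‖x‖ < r := by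
    intro x hx
    have : x ∈ Function.support k := hx
    rw [hk, κ.support_normed_eq] at this
    simpa using this
  have hint : ∀ y, Integrable fun x => k x * F (y - x) := fun y =>
    (hkc.mul (hF.comp (by fun_prop))).integrable_of_hasCompactSupport hks.mul_right
  have hball : ∀ y x s, r ≤ s → k x ≠ 0 → y - x ∈ ball y s := by
    intro y x s hs hx
    have := hksupp x hx
    rw [mem_ball, dist_eq_norm]
    simpa using this.trans_le hs
  have hki : Integrable k := hkc.integrable_of_hasCompactSupport hks
  refine ⟨fun y => ∫ x, k x * F (y - x), ?_, ?_, ?_⟩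
  · exact hks.contDiff_convolution_left (μ := volume) (ContinuousLinearMap.lsmul ℝ ℝ)
      (n := ⊤) κ.contDiff_normed hF.locallyIntegrable
  · intro y a b h
    constructor
    · calc a = ∫ x, k x * a := by rw [integral_mul_const, hk1, one_mul]
        _ ≤ _ := by
          refine integral_mono (hki.mul_const a) (hint y) fun x => ?_
          by_cases hx : k x = 0
          · simp [hx]
          · exact mul_le_mul_of_nonneg_left (h _ (hball y x r le_rfl hx)).1 (hk0 x)
    · calc ∫ x, k x * F (y - x)
        _ ≤ ∫ x, k x * b := by
          refine integral_mono (hint y) (hki.mul_const b) fun x => ?_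
          by_cases hx : k x = 0
          · simp [hx]
          · exact mul_le_mul_of_nonneg_left (h _ (hball y x r le_rfl hx)).2 (hk0 x)
        _ = b := by rw [integral_mul_const, hk1, one_mul]
  · intro y C hC h
    -- The kernel is supported in radius r and y' ranges over radius r around y, so the points
    -- compared lie within 2r of y; this is the reason for the doubled ball.
    refine norm_fderiv_le_of_lip' ℝ hC ?_
    filter_upwards [ball_mem_nhds y hr] with y' hy'
    have hy'' : dist y' y < r := hy'
    rw [← integral_sub (hint y') (hint y)]
    calc ‖∫ x, (k x * F (y' - x) - k x * F (y - x))‖ ≤ ∫ x, k x * (C * ‖y' - y‖) := by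
          refine norm_integral_le_of_norm_le (hki.mul_const _) (ae_of_all _ fun x => ?_)
          by_cases hx : k x = 0
          · simp [hx]
          · rw [← mul_sub, norm_mul, Real.norm_of_nonneg (hk0 x), Real.norm_eq_abs]
            refine mul_le_mul_of_nonneg_left ?_ (hk0 x)
            have h1 := h (y' - x) ?_ (y - x) (hball y x _ (by linarith) hx)
            · simpa using h1
            · have h2 := hball y' x r le_rfl hx
              have := dist_triangle (y' - x) y' y
              rw [mem_ball] at h2 ⊢
              linarith
      _ = C * ‖y' - y‖ := by rw [integral_mul_const, hk1, one_mul]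

theorem abs_log_sub_log_le {a b m : ℝ} (hm : 0 < m) (ha : m ≤ a) (hb : m ≤ b) :
    |Real.log a - Real.log b| ≤ |a - b| / m := by
  have key : ∀ a b : ℝ, m ≤ a → m ≤ b → Real.log a - Real.log b ≤ |a - b| / m := by
    intro a b ha hb
    have ha0 : 0 < a := hm.trans_le ha
    have hb0 : 0 < b := hm.trans_le hb
    rw [← Real.log_div ha0.ne' hb0.ne']
    calc Real.log (a / b) ≤ a / b - 1 := Real.log_le_sub_one_of_pos (by positivity)
      _ = (a - b) / b := by field_simp
      _ ≤ |a - b| / b := by gcongr; exact le_abs_self _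
      _ ≤ |a - b| / m := by gcongr
  rw [abs_le]
  constructor
  · have := key b a hb ha
    rw [abs_sub_comm] at this
    linarith
  · exact key a b ha hb

/-- The logarithmic profile, equal to `1` at distances below `e^{-2/ρ}` and to `0` above
`e^{-1/ρ}`. -/
noncomputable def logProfile (ρ s : ℝ) : ℝ :=
  max 0 (min 1 (-1 - ρ * Real.log (max s (Real.exp (-2 / ρ)))))

theorem logProfile_mem (ρ s : ℝ) : logProfile ρ s ∈ Icc (0 : ℝ) 1 :=
  ⟨le_max_left _ _, max_le zero_le_one (min_le_left _ _)⟩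

theorem logProfile_eq_one {ρ s : ℝ} (hρ : 0 < ρ) (hs : s ≤ Real.exp (-2 / ρ)) :
    logProfile ρ s = 1 := by
  rw [logProfile, max_eq_right hs, Real.log_exp, mul_div_cancel₀ _ hρ.ne']
  norm_num

theorem logProfile_eq_zero {ρ s : ℝ} (hρ : 0 < ρ) (hs : Real.exp (-1 / ρ) ≤ s) :
    logProfile ρ s = 0 := by
  have h1 : Real.exp (-2 / ρ) ≤ s := by
    refine le_trans (Real.exp_le_exp.2 ?_) hs
    gcongr
    norm_num
  have h2 : -1 / ρ ≤ Real.log s := by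
    rw [Real.le_log_iff_exp_le ((Real.exp_pos _).trans_le hs)]
    exact hs
  rw [div_le_iff₀ hρ] at h2
  rw [logProfile, max_eq_left h1]
  refine max_eq_left ((min_le_right _ _).trans ?_)
  linarith

/-- Clamping is 1-Lipschitz and the logarithm has Lipschitz constant 1/m on [m, ∞). With m
comparable to the distance d this gives slope ρ/d, the gain that makes the cut-off useful. -/
theorem abs_logProfile_sub_le {ρ s t m : ℝ} (hρ : 0 < ρ) (hm : 0 < m)
    (hs : m ≤ max s (Real.exp (-2 / ρ))) (ht : m ≤ max t (Real.exp (-2 / ρ))) :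
    |logProfile ρ s - logProfile ρ t| ≤ ρ / m * |s - t| := by
  unfold logProfile
  set e := Real.exp (-2 / ρ)
  calc _ ≤ |min 1 (-1 - ρ * Real.log (max s e)) - min 1 (-1 - ρ * Real.log (max t e))| :=
        by
        have := abs_max_sub_max_le_max 0 (min 1 (-1 - ρ * Real.log (max s e))) 0
          (min 1 (-1 - ρ * Real.log (max t e)))
        simpa using this
    _ ≤ |(-1 - ρ * Real.log (max s e)) - (-1 - ρ * Real.log (max t e))| := by
        have := abs_min_sub_min_le_max 1 (-1 - ρ * Real.log (max s e)) 1
          (-1 - ρ * Real.log (max t e))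
        simpa using this
    _ = ρ * |Real.log (max s e) - Real.log (max t e)| := by
        rw [abs_sub_comm, ← abs_of_pos hρ, ← abs_mul, abs_of_pos hρ]; ring_nf
    _ ≤ ρ * (|max s e - max t e| / m) := by
        gcongr; exact abs_log_sub_log_le hm hs ht
    _ ≤ ρ * (|s - t| / m) := by
        gcongr ρ * (?_ / m)
        have := abs_max_sub_max_le_max s e t e
        rwa [sub_self e, abs_zero, max_eq_left (abs_nonneg (s - t))] at this
    _ = _ := by ring

/-- The logarithmic profile of the distance already has the right shape; mollification smooths it,
and the factors 1/2, 2 and 2√3 leave room for the blurring. -/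
theorem exists_isBoundaryCutoff (U : Set E3) {ρ : ℝ} (hρ : 0 < ρ) :
    ∃ θ, IsBoundaryCutoff U ρ θ := by
  set m := Real.exp (-2 / ρ) with hm
  have hm0 : 0 < m := Real.exp_pos _
  have hm1 : m ≤ Real.exp (-1 / ρ) := by
    refine Real.exp_le_exp.2 ?_
    gcongr
    norm_num
  have hlip : ∀ x y, |infDist x (frontier U) - infDist y (frontier U)| ≤ ‖x - y‖ := by
    intro x y
    have := (lipschitz_infDist_pt (frontier U)).dist_le_mul x y
    rwa [NNReal.coe_one, one_mul, Real.dist_eq, dist_eq_norm] at this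
  have hcont : Continuous fun y => logProfile ρ (infDist y (frontier U)) := by
    unfold logProfile
    have h1 : Continuous fun y => Real.log (max (infDist y (frontier U)) (Real.exp (-2 / ρ))) := by
      refine Continuous.log ?_ fun y => ?_
      · exact (continuous_infDist_pt _).max continuous_const
      · exact ((Real.exp_pos _).trans_le (le_max_right _ _)).ne'
    fun_prop
  -- The radius must be small against the inner threshold m = e^{-2/ρ}: m/2 + m/8 stays below m, and
  -- 2e^{-1/ρ} - m/8 stays above e^{-1/ρ}. Closer to the boundary than 3m/4, the profile is constant
  -- on the ball of radius m/4, so the gradient vanishes there.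
  obtain ⟨θ, hθ, hIcc, hgrad⟩ := exists_mollification hcont (r := m / 8) (by positivity)
  refine ⟨θ, hθ, fun y => hIcc y 0 1 fun x _ => logProfile_mem _ _, fun y _ hy => ?_,
    fun y _ hy => ?_, fun y _ => ?_⟩
  · have := hIcc y 1 1 fun x hx => ?_
    · exact le_antisymm this.2 this.1
    · have h1 := (le_abs_self _).trans (hlip x y)
      rw [mem_ball, dist_eq_norm] at hx
      rw [logProfile_eq_one hρ]
      · simp
      · linarith
  · have := hIcc y 0 0 fun x hx => ?_
    · exact le_antisymm this.2 this.1
    · have h1 := (neg_le_abs _).trans (hlip x y)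
      rw [mem_ball, dist_eq_norm] at hx
      rw [logProfile_eq_zero hρ]
      · simp
      · linarith
  · set d := infDist y (frontier U)
    have hd0 : 0 ≤ d := infDist_nonneg
    by_cases hd : d < 3 / 4 * m
    · refine (hgrad y 0 le_rfl fun x hx x' hx' => ?_).trans (by positivity)
      have h1 := (le_abs_self _).trans (hlip x y)
      have h2 := (le_abs_self _).trans (hlip x' y)
      rw [mem_ball, dist_eq_norm] at hx hx'
      rw [logProfile_eq_one hρ, logProfile_eq_one hρ]
      · simp
      · linarith
      · linarith
    · push Not at hd
      have hd1 : 0 < d := lt_of_lt_of_le (by positivity) hd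
      -- If d ≤ 5m/4, the threshold m itself is at least 4d/5; otherwise moving by m/4 costs at most
      -- d/5.
      have hmax : ∀ x ∈ ball y (2 * (m / 8)), 4 / 5 * d ≤ max (infDist x (frontier U)) m := by
        intro x hx
        have h1 := (neg_le_abs _).trans (hlip x y)
        rw [mem_ball, dist_eq_norm] at hx
        rcases le_total d (5 / 4 * m) with h | h
        · exact le_max_of_le_right (by linarith)
        · exact le_max_of_le_left (by linarith)
      refine (hgrad y (ρ / (4 / 5 * d)) (by positivity) fun x hx x' hx' => ?_).trans ?_
      · refine (abs_logProfile_sub_le hρ (by positivity) (hmax x hx) (hmax x' hx')).trans ?_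
        gcongr
        exact hlip x x'
      · have h3 : (1 : ℝ) ≤ Real.sqrt 3 := by rw [Real.one_le_sqrt]; norm_num
        calc ρ / (4 / 5 * d) = (5 / 4) * ρ / d := by field_simp
          _ ≤ 2 * Real.sqrt 3 * ρ / d := by gcongr; linarith

/-! ### Weakly differentiable functions along segments -/

theorem integrable_translate_prod {G : E3 → ℝ} (hG : Integrable G) (hGm : StronglyMeasurable G)
    (z : E3) : Integrable (fun p : E3 × ℝ => G (p.1 + p.2 • z))
      ((volume : Measure E3).prod (volume.restrict (Ioc (0 : ℝ) 1))) := by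
  have hm : AEStronglyMeasurable (fun p : E3 × ℝ => G (p.1 + p.2 • z))
      ((volume : Measure E3).prod (volume.restrict (Ioc (0 : ℝ) 1))) := by
    refine (hGm.comp_measurable ?_).aestronglyMeasurable
    fun_prop
  rw [integrable_prod_iff' hm]
  refine ⟨ae_of_all _ fun s => hG.comp_add_right (s • z), ?_⟩
  have : (fun s : ℝ => ∫ x, ‖G (x + s • z)‖) = fun _ => ∫ x, ‖G x‖ := by
    funext s
    exact integral_add_right_eq_self (fun x => ‖G x‖) (s • z)
  simp only [this]
  exact integrable_const _

theorem hasDerivAt_translate {η : E3 → ℝ} (hη : ContDiff ℝ ∞ η) (x z : E3) (s : ℝ) :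
    HasDerivAt (fun s : ℝ => η (x - s • z)) (-(fderiv ℝ η (x - s • z) z)) s := by
  have h1 : HasDerivAt (fun s : ℝ => x - s • z) (-z) s := by
    simpa using ((hasDerivAt_id s).smul_const z).const_sub x
  have h2 := (hη.differentiable (by simp)).differentiableAt (x := x - s • z) |>.hasFDerivAt
  have h3 := h2.comp_hasDerivAt s h1
  rw [map_neg] at h3
  exact h3

/-- A function with a weak derivative in the direction `z` is absolutely continuous along
almost every segment of direction `z`. -/
theorem ae_sub_eq_integral_segment {U W : Set E3} (hW : IsOpen W) {F G : E3 → ℝ}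
    (hF : Integrable F) (hG : Integrable G)
    (hGm : StronglyMeasurable G) {z : E3}
    (hweak : ∀ η : E3 → ℝ, ContDiff ℝ ∞ η → HasCompactSupport η → tsupport η ⊆ U →
      ∫ x, F x * fderiv ℝ η x z = - ∫ x, G x * η x)
    (hz : ∀ x ∈ W, ∀ s ∈ Icc (0 : ℝ) 1, x + s • z ∈ U) :
    ∀ᵐ x, x ∈ W → F (x + z) - F x = ∫ s in Ioc (0 : ℝ) 1, G (x + s • z) := by
  set ν : Measure ℝ := volume.restrict (Ioc (0 : ℝ) 1) with hν
  have hGp := integrable_translate_prod hG hGm z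
  have hF1 : Integrable fun x => F (x + z) := hF.comp_add_right z
  have hI : Integrable fun x => ∫ s, G (x + s • z) ∂ν := hGp.integral_prod_left
  have hR : Integrable fun x => F (x + z) - F x - ∫ s, G (x + s • z) ∂ν := (hF1.sub hF).sub hI
  -- The defect of the claimed identity is annihilated by every test function on W: translations are
  -- moved onto the test function, for which the fundamental theorem of calculus is available.
  have key := hW.ae_eq_zero_of_integral_contDiff_smul_eq_zero
    (f := fun x => F (x + z) - F x - ∫ s, G (x + s • z) ∂ν) (μ := volume)
    (hR.locallyIntegrable.locallyIntegrableOn _) ?_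
  · filter_upwards [key] with x hx hxW
    have := hx hxW
    linarith
  intro η hη hc hs
  obtain ⟨M, hM⟩ := hη.continuous.bounded_above_of_compact_support hc
  have hdc : Continuous fun x => fderiv ℝ η x z :=
    (hη.continuous_fderiv (by simp)).clm_apply continuous_const
  have hds : HasCompactSupport fun x => fderiv ℝ η x z :=
    (hc.fderiv ℝ).comp_left (g := fun L : E3 →L[ℝ] ℝ => L z) rfl
  obtain ⟨M', hM'⟩ := hdc.bounded_above_of_compact_support hds
  have bdd : ∀ {f : E3 → ℝ}, Integrable f → Integrable fun x => η x * f x := fun {f} hf =>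
    hf.bdd_mul hη.continuous.aestronglyMeasurable (ae_of_all _ hM)
  have e1 : ∫ x, η x * F (x + z) = ∫ x, η (x - z) * F x := by
    have := integral_add_right_eq_self (μ := volume) (fun x => η (x - z) * F x) z
    simpa using this
  have hηz : Integrable fun x => η (x - z) * F x :=
    hF.bdd_mul (hη.continuous.comp (by fun_prop)).aestronglyMeasurable (ae_of_all _ fun x => hM _)
  have e2 : ∀ x, η (x - z) - η x = - ∫ s, fderiv ℝ η (x - s • z) z ∂ν := by
    intro x
    have hcont : Continuous fun s : ℝ => -(fderiv ℝ η (x - s • z) z) :=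
      (hdc.comp (f := fun s : ℝ => x - s • z) (by fun_prop)).neg
    have := intervalIntegral.integral_eq_sub_of_hasDerivAt (a := 0) (b := 1)
      (fun s _ => hasDerivAt_translate hη x z s) (hcont.intervalIntegrable _ _)
    rw [intervalIntegral.integral_of_le zero_le_one, integral_neg] at this
    simpa using this.symm
  -- The translate of η by s • z is itself an admissible test function, because the segments
  -- starting in W stay in U.
  have e3 : ∀ s ∈ Ioc (0 : ℝ) 1, ∫ x, F x * fderiv ℝ η (x - s • z) z
      = - ∫ x, η x * G (x + s • z) := by
    intro s hs'
    have h1 := hweak (fun x => η (x - s • z)) (hη.comp (by fun_prop))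
      (hc.comp_homeomorph (Homeomorph.subRight (s • z))) ?_
    · have h2 : ∀ x, fderiv ℝ (fun x => η (x - s • z)) x = fderiv ℝ η (x - s • z) := fun x => by
        simpa only [sub_eq_add_neg] using fderiv_comp_add_right (-(s • z))
      simp only [h2] at h1
      rw [h1]
      have := integral_add_right_eq_self (μ := volume) (fun x => G x * η (x - s • z)) (s • z)
      simp only [add_sub_cancel_right] at this
      rw [← this]
      simp only [mul_comm]
    · intro x hx
      have : x - s • z ∈ tsupport η := by
        have h3 : tsupport (η ∘ (Homeomorph.subRight (s • z))) =
            (Homeomorph.subRight (s • z)) ⁻¹' tsupport η := tsupport_comp_eq_preimage _ _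
        have h4 : x ∈ tsupport (η ∘ (Homeomorph.subRight (s • z))) := hx
        rw [h3] at h4
        exact h4
      have := hz _ (hs this) s ⟨hs'.1.le, hs'.2⟩
      simpa using this
  have hFD : Integrable (fun p : E3 × ℝ => F p.1 * fderiv ℝ η (p.1 - p.2 • z) z)
      ((volume : Measure E3).prod ν) := by
    have h1 : Integrable (fun p : E3 × ℝ => F p.1) ((volume : Measure E3).prod ν) :=
      hF.comp_fst ν
    refine h1.mul_bdd (c := M') ?_ (ae_of_all _ fun p => hM' _)
    exact (hdc.comp (f := fun p : E3 × ℝ => p.1 - p.2 • z) (by fun_prop)).aestronglyMeasurable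
  have hGη : Integrable (fun p : E3 × ℝ => η p.1 * G (p.1 + p.2 • z))
      ((volume : Measure E3).prod ν) := by
    refine hGp.bdd_mul ?_ (ae_of_all _ fun p => hM p.1)
    exact (hη.continuous.comp continuous_fst).aestronglyMeasurable
  have e4 : ∫ x, (η (x - z) * F x - η x * F x) = ∫ x, η x * ∫ s, G (x + s • z) ∂ν := by
    calc ∫ x, (η (x - z) * F x - η x * F x)
        = ∫ x, - ∫ s, F x * fderiv ℝ η (x - s • z) z ∂ν := by
          refine integral_congr_ae (ae_of_all _ fun x => ?_)
          simp only
          rw [integral_const_mul, ← sub_mul, e2]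
          ring
      _ = - ∫ s, (∫ x, F x * fderiv ℝ η (x - s • z) z) ∂ν := by
          rw [integral_neg, integral_integral_swap hFD]
      _ = - ∫ s, (- ∫ x, η x * G (x + s • z)) ∂ν := by
          rw [hν, setIntegral_congr_fun measurableSet_Ioc e3]
      _ = ∫ x, η x * ∫ s, G (x + s • z) ∂ν := by
          rw [integral_neg, neg_neg, ← integral_integral_swap hGη]
          simp only [integral_const_mul]
  simp only [smul_eq_mul, mul_sub]
  rw [integral_sub, integral_sub, e1, ← integral_sub hηz (bdd hF), e4, sub_self]
  · exact bdd hF1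
  · exact bdd hF
  · exact (bdd hF1).sub (bdd hF)
  · exact bdd hI

/-! ### Averages over cones -/

/-- From every point of `W ∩ U` a fixed cone of height one with base `ball z₀ r` stays in `U`. -/
def ConeOn (U W : Set E3) (z₀ : E3) (r : ℝ) : Prop :=
  ∀ x ∈ W ∩ U, ∀ z ∈ ball z₀ r, ∀ s ∈ Icc (0 : ℝ) 1, x + s • z ∈ U

/-- The uniform interior cone property, in local form. -/
def HasCone (U : Set E3) : Prop :=
  ∀ x ∈ closure U, ∃ W, IsOpen W ∧ x ∈ W ∧ ∃ z₀ r, 0 < r ∧ ConeOn U W z₀ r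

/-- The integral of `H` over the section of the cone at height `s`. -/
noncomputable def coneSection (B : Set E3) (H : E3 → ℝ≥0∞) (s : ℝ) (x : E3) : ℝ≥0∞ :=
  ∫⁻ z in B, H (x + s • z)

theorem measurable_coneSection (B : Set E3) {H : E3 → ℝ≥0∞} (hH : Measurable H) :
    Measurable fun p : ℝ × E3 => coneSection B H p.1 p.2 := by
  unfold coneSection
  refine Measurable.lintegral_prod_right' (f := fun q : (ℝ × E3) × E3 => H (q.1.2 + q.1.1 • q.2)) ?_
  exact hH.comp (by fun_prop)

/-- The dilation by s contributes the factor s^{-3} of dimension three, the only source of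
singularity at the vertex of the cone. -/
theorem lintegral_translate_smul {H : E3 → ℝ≥0∞} (hH : Measurable H) {s : ℝ}
    (hs : 0 < s) (x : E3) : ∫⁻ z, H (x + s • z) = ENNReal.ofReal (s⁻¹ ^ 3) * ∫⁻ z, H z := by
  have h1 : ∫⁻ z, H (x + s • z) = ∫⁻ z, H (x + z) ∂(Measure.map (s • ·) (volume : Measure E3)) := by
    rw [lintegral_map (f := fun z => H (x + z)) (hH.comp (by fun_prop)) (by fun_prop)]
  rw [h1, Measure.map_addHaar_smul _ hs.ne', lintegral_smul_measure,
    lintegral_add_left_eq_self H x]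
  simp [abs_of_pos hs]

theorem coneSection_rpow_le {B : Set E3} {H : E3 → ℝ≥0∞} (hH : Measurable H)
    {p : ℝ} (hp : 1 < p) (s : ℝ) (x : E3) :
    coneSection B H s x ^ p ≤ (∫⁻ z in B, H (x + s • z) ^ p) * volume B ^ (p - 1) := by
  have hpq := Real.HolderConjugate.conjExponent hp
  have hp0 : 0 < p := by linarith
  have h1 := ENNReal.lintegral_mul_le_Lp_mul_Lq (volume.restrict B) hpq
    (f := fun z => H (x + s • z)) (g := fun _ => 1) (hH.comp (by fun_prop)).aemeasurable
    aemeasurable_const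
  simp only [Pi.mul_apply, mul_one, ENNReal.one_rpow, lintegral_const, Measure.restrict_apply,
    MeasurableSet.univ, univ_inter, one_mul] at h1
  have h2 := ENNReal.rpow_le_rpow h1 hp0.le
  rw [ENNReal.mul_rpow_of_nonneg _ _ hp0.le, ← ENNReal.rpow_mul, ← ENNReal.rpow_mul,
    one_div_mul_cancel hp0.ne', ENNReal.rpow_one] at h2
  rwa [show 1 / p.conjExponent * p = p - 1 from by
    have := hpq.inv_add_inv_eq_one
    have h3 : p.conjExponent⁻¹ = 1 - p⁻¹ := by linarith
    rw [one_div, h3, sub_mul, inv_mul_cancel₀ hp0.ne', one_mul]] at h2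

/-- Enlarging the section to the whole space makes the bound uniform in x, at the price of the
factor s^{-3}. -/
theorem coneSection_rpow_le_lintegral {B : Set E3} {H : E3 → ℝ≥0∞} (hH : Measurable H)
    {p : ℝ} (hp : 1 < p) {s : ℝ} (hs : 0 < s) (x : E3) :
    coneSection B H s x ^ p ≤
      ENNReal.ofReal (s⁻¹ ^ 3) * (∫⁻ z, H z ^ p) * volume B ^ (p - 1) := by
  refine (coneSection_rpow_le hH hp s x).trans ?_
  gcongr
  rw [← lintegral_translate_smul (H := fun z => H z ^ p) (hH.pow_const p) hs x]
  exact setLIntegral_le_lintegral _ _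

/-- Integrating in x first, translation invariance removes s altogether. This complements the bound
uniform in x; combining the two gains integrability. -/
theorem lintegral_coneSection_rpow_le {B : Set E3} {H : E3 → ℝ≥0∞} (hH : Measurable H)
    {p : ℝ} (hp : 1 < p) (s : ℝ) :
    ∫⁻ x, coneSection B H s x ^ p ≤ volume B ^ p * ∫⁻ z, H z ^ p := by
  have hm : Measurable fun q : E3 × E3 => H (q.1 + s • q.2) ^ p :=
    (hH.comp (by fun_prop)).pow_const p
  calc ∫⁻ x, coneSection B H s x ^ p
      ≤ ∫⁻ x, (∫⁻ z in B, H (x + s • z) ^ p) * volume B ^ (p - 1) :=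
        lintegral_mono fun x => coneSection_rpow_le hH hp s x
    _ = (∫⁻ z in B, ∫⁻ x, H (x + s • z) ^ p) * volume B ^ (p - 1) := by
        rw [lintegral_mul_const _ (Measurable.lintegral_prod_right' hm),
          lintegral_lintegral_swap hm.aemeasurable]
    _ = (volume B * ∫⁻ z, H z ^ p) * volume B ^ (p - 1) := by
        congr 1
        have : ∀ z : E3, ∫⁻ x, H (x + s • z) ^ p = ∫⁻ x, H x ^ p := fun z =>
          lintegral_add_right_eq_self (fun x => H x ^ p) (s • z)
        simp only [this, lintegral_const, Measure.restrict_apply_univ]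
        rw [mul_comm]
    _ = _ := by
        rw [mul_right_comm]
        congr 1
        rcases eq_or_ne (volume B) 0 with h0 | h0
        · rw [h0, zero_mul, ENNReal.zero_rpow_of_pos (by linarith)]
        rcases eq_or_ne (volume B) ⊤ with ht | ht
        · rw [ht, ENNReal.top_rpow_of_pos (by linarith), ENNReal.top_rpow_of_pos (by linarith),
            ENNReal.top_mul_top]
        · nth_rw 1 [← ENNReal.rpow_one (volume B)]
          rw [← ENNReal.rpow_add _ _ h0 ht]
          congr 1
          ring

theorem clm_apply_eq_sum (L : E3 →L[ℝ] ℝ) (z : E3) :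
    L z = ∑ j, z j * L (EuclideanSpace.single j 1) := by
  conv_lhs => rw [← (EuclideanSpace.basisFun (Fin 3) ℝ).sum_repr z]
  simp

theorem abs_apply_le_norm (z : E3) (j : Fin 3) : |z j| ≤ ‖z‖ := by
  simpa using PiLp.norm_apply_le z j

/-- The size of a function and its weak derivatives, extended by zero. -/
noncomputable def h1Density (U : Set E3) (f : L2 U) (g : Fin 3 → L2 U) : E3 → ℝ≥0∞ :=
  U.indicator fun x => ‖f x‖ₑ + ∑ j, ‖g j x‖ₑ

theorem measurable_h1Density {U : Set E3} (hU : IsOpen U) (f : L2 U) (g : Fin 3 → L2 U) :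
    Measurable (h1Density U f g) := by
  refine Measurable.indicator ?_ hU.measurableSet
  refine (Lp.stronglyMeasurable f).enorm.add ?_
  exact Finset.measurable_fun_sum _ fun j _ => (Lp.stronglyMeasurable (g j)).enorm

theorem integrable_indicator_L2 {U : Set E3} (hU : IsOpen U) (hb : Bornology.IsBounded U)
    (f : L2 U) : Integrable (U.indicator f) := by
  have : IsFiniteMeasure (volume.restrict U) := ⟨by
    rw [Measure.restrict_apply_univ]; exact hb.measure_lt_top⟩
  rw [integrable_indicator_iff hU.measurableSet]
  exact (Lp.memLp f).integrable (by norm_num)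

theorem stronglyMeasurable_indicator_L2 {U : Set E3} (hU : IsOpen U) (f : L2 U) :
    StronglyMeasurable (U.indicator f) :=
  (Lp.stronglyMeasurable f).indicator hU.measurableSet

theorem IsWeakPartial.integral_fderiv {U : Set E3} (hU : IsOpen U) {f : L2 U} {g : Fin 3 → L2 U}
    (h : ∀ j, IsWeakPartial U j f (g j)) (z : E3) {η : E3 → ℝ} (hη : ContDiff ℝ ∞ η)
    (hc : HasCompactSupport η) (hs : tsupport η ⊆ U) :
    ∫ x, U.indicator f x * fderiv ℝ η x z =
      - ∫ x, (∑ j, z j * U.indicator (g j) x) * η x := by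
  have i1 : ∀ j, Integrable (fun x => f x * pd j η x) (volume.restrict U) := fun j =>
    (Lp.memLp f).integrable_mul (memLp_pd_test j hη hc)
  have i2 : ∀ j, Integrable (fun x => g j x * η x) (volume.restrict U) := fun j =>
    (Lp.memLp (g j)).integrable_mul (memLp_test hη.continuous hc)
  have e1 : ∀ x, U.indicator f x * fderiv ℝ η x z =
      U.indicator (fun x => ∑ j, z j * (f x * pd j η x)) x := by
    intro x
    by_cases hx : x ∈ U
    · simp only [indicator_of_mem hx]
      rw [clm_apply_eq_sum, Finset.mul_sum]
      refine Finset.sum_congr rfl fun j _ => ?_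
      rw [pd]
      ring
    · simp [indicator_of_notMem hx]
  have e2 : ∀ x, (∑ j, z j * U.indicator (g j) x) * η x =
      U.indicator (fun x => ∑ j, z j * (g j x * η x)) x := by
    intro x
    by_cases hx : x ∈ U
    · simp only [indicator_of_mem hx]
      rw [Finset.sum_mul]
      refine Finset.sum_congr rfl fun j _ => ?_
      ring
    · simp [indicator_of_notMem hx]
  simp only [e1, e2]
  rw [integral_indicator hU.measurableSet, integral_indicator hU.measurableSet,
    integral_finsetSum _ fun j _ => (i1 j).const_mul _,
    integral_finsetSum _ fun j _ => (i2 j).const_mul _, ← Finset.sum_neg_distrib]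
  refine Finset.sum_congr rfl fun j _ => ?_
  rw [integral_const_mul, integral_const_mul, h j η hη hc hs]
  ring

/-- The value at x is the value at the far end of the segment minus the integral of the directional
derivative, and all of the segment lies in U. -/
theorem enorm_le_segment {U W : Set E3} (hU : IsOpen U) (hb : Bornology.IsBounded U)
    (hW : IsOpen W) {z₀ : E3} {r : ℝ} (hcone : ConeOn U W z₀ r) {f : L2 U} {g : Fin 3 → L2 U}
    (h : ∀ j, IsWeakPartial U j f (g j)) {z : E3} (hz : z ∈ ball z₀ r) :
    ∀ᵐ x, x ∈ W ∩ U → ‖f x‖ₑ ≤ h1Density U f g (x + z) +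
      ENNReal.ofReal (‖z₀‖ + r) * ∫⁻ s in Ioc (0 : ℝ) 1, h1Density U f g (x + s • z) := by
  set G : E3 → ℝ := fun x => ∑ j, z j * U.indicator (g j) x with hG
  have hGi : Integrable G :=
    integrable_finsetSum _ fun j _ => (integrable_indicator_L2 hU hb (g j)).const_mul _
  have hGm : StronglyMeasurable G :=
    Finset.stronglyMeasurable_fun_sum _ fun j _ =>
      (stronglyMeasurable_indicator_L2 hU (g j)).const_mul _
  have hzn : ‖z‖ ≤ ‖z₀‖ + r := by
    have h1 : ‖z - z₀‖ < r := by rwa [mem_ball, dist_eq_norm] at hz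
    have h2 := norm_add_le (z - z₀) z₀
    rw [sub_add_cancel] at h2
    linarith
  have hGle : ∀ y, ‖G y‖ₑ ≤ ENNReal.ofReal (‖z₀‖ + r) * h1Density U f g y := by
    intro y
    by_cases hy : y ∈ U
    · simp only [hG, h1Density, indicator_of_mem hy]
      calc ‖∑ j, z j * g j y‖ₑ ≤ ∑ j, ‖z j * g j y‖ₑ := enorm_sum_le _ _
        _ ≤ ∑ j, ENNReal.ofReal (‖z₀‖ + r) * ‖g j y‖ₑ := by
            refine Finset.sum_le_sum fun j _ => ?_
            rw [enorm_mul]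
            gcongr
            rw [← ofReal_norm, Real.norm_eq_abs]
            exact ENNReal.ofReal_le_ofReal ((abs_apply_le_norm z j).trans hzn)
        _ ≤ _ := by
            rw [← Finset.mul_sum]
            gcongr
            exact le_add_self
    · simp [hG, indicator_of_notMem hy]
  have hFle : ∀ y, ‖U.indicator f y‖ₑ ≤ h1Density U f g y := by
    intro y
    by_cases hy : y ∈ U
    · simp only [h1Density, indicator_of_mem hy]
      exact le_self_add
    · simp [indicator_of_notMem hy]
  have key := ae_sub_eq_integral_segment (U := U) (hW.inter hU) (integrable_indicator_L2 hU hb f)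
    hGi hGm (z := z) (fun η h1 h2 h3 => IsWeakPartial.integral_fderiv hU h z h1 h2 h3)
    (fun x hx s hs => hcone x hx z hz s hs)
  filter_upwards [key] with x hx hxW
  have h1 := hx hxW
  have h2 : f x = U.indicator f (x + z) - ∫ s in Ioc (0 : ℝ) 1, G (x + s • z) := by
    rw [← h1, indicator_of_mem hxW.2]
    ring
  rw [h2]
  refine (enorm_sub_le).trans ?_
  gcongr
  · exact hFle _
  · refine (enorm_integral_le_lintegral_enorm _).trans ?_
    rw [← lintegral_const_mul]
    · exact lintegral_mono fun s => hGle _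
    · exact (measurable_h1Density hU f g).comp (by fun_prop)

/-- Averaging the segment estimate over all directions z in the base of the cone replaces line
integrals, which L^p norms do not control, by integrals over solid sections. -/
theorem volume_mul_enorm_le {U W : Set E3} (hU : IsOpen U) (hb : Bornology.IsBounded U)
    (hW : IsOpen W) {z₀ : E3} {r : ℝ} (hcone : ConeOn U W z₀ r) {f : L2 U} {g : Fin 3 → L2 U}
    (h : ∀ j, IsWeakPartial U j f (g j)) :
    ∀ᵐ x, x ∈ W ∩ U → volume (ball z₀ r) * ‖f x‖ₑ ≤
      coneSection (ball z₀ r) (h1Density U f g) 1 x + ENNReal.ofReal (‖z₀‖ + r) *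
        ∫⁻ s in Ioc (0 : ℝ) 1, coneSection (ball z₀ r) (h1Density U f g) s x := by
  set H := h1Density U f g with hH
  have hHm : Measurable H := measurable_h1Density hU f g
  have hfm : Measurable fun x => ‖f x‖ₑ := (Lp.stronglyMeasurable f).enorm
  have hSm : Measurable fun p : E3 × E3 => ∫⁻ s in Ioc (0 : ℝ) 1, H (p.2 + s • p.1) :=
    Measurable.lintegral_prod_right' (f := fun q : (E3 × E3) × ℝ => H (q.1.2 + q.2 • q.1.1))
      (hHm.comp (by fun_prop))
  have hmeas : MeasurableSet {p : E3 × E3 | p.1 ∈ ball z₀ r → p.2 ∈ W ∩ U → ‖f p.2‖ₑ ≤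
      H (p.2 + p.1) + ENNReal.ofReal (‖z₀‖ + r) * ∫⁻ s in Ioc (0 : ℝ) 1, H (p.2 + s • p.1)} := by
    refine MeasurableSet.imp (measurable_fst measurableSet_ball)
      (MeasurableSet.imp (measurable_snd (hW.inter hU).measurableSet) ?_)
    refine measurableSet_le (hfm.comp measurable_snd) ?_
    exact (hHm.comp (measurable_snd.add measurable_fst)).add (hSm.const_mul _)
  have h1 : ∀ᵐ z : E3, ∀ᵐ x : E3, z ∈ ball z₀ r → x ∈ W ∩ U → ‖f x‖ₑ ≤
      H (x + z) + ENNReal.ofReal (‖z₀‖ + r) * ∫⁻ s in Ioc (0 : ℝ) 1, H (x + s • z) := by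
    refine ae_of_all _ fun z => ?_
    by_cases hz : z ∈ ball z₀ r
    · filter_upwards [enorm_le_segment hU hb hW hcone h hz] with x hx _ using hx
    · exact ae_of_all _ fun x hz' => absurd hz' hz
  -- The exceptional null set depends on z; Fubini for null sets turns it into a null set of x off
  -- which the estimate holds for almost every z.
  rw [Measure.ae_ae_comm (p := fun z x : E3 => z ∈ ball z₀ r → x ∈ W ∩ U → ‖f x‖ₑ ≤
      H (x + z) + ENNReal.ofReal (‖z₀‖ + r) * ∫⁻ s in Ioc (0 : ℝ) 1, H (x + s • z)) hmeas] at h1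
  filter_upwards [h1] with x hx hxW
  calc volume (ball z₀ r) * ‖f x‖ₑ = ∫⁻ _z in ball z₀ r, ‖f x‖ₑ := by
        rw [lintegral_const, Measure.restrict_apply_univ, mul_comm]
    _ ≤ ∫⁻ z in ball z₀ r, (H (x + z) +
          ENNReal.ofReal (‖z₀‖ + r) * ∫⁻ s in Ioc (0 : ℝ) 1, H (x + s • z)) := by
        refine lintegral_mono_ae ?_
        rw [ae_restrict_iff' measurableSet_ball]
        filter_upwards [hx] with z hz hzB using hz hzB hxW
    _ = _ := by
        have hm1 : Measurable fun z => H (x + z) := hHm.comp (by fun_prop)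
        have hm2 : Measurable fun z => ∫⁻ s in Ioc (0 : ℝ) 1, H (x + s • z) :=
          hSm.comp (measurable_id.prodMk measurable_const)
        rw [lintegral_add_left hm1, lintegral_const_mul _ hm2, lintegral_lintegral_swap]
        · simp [coneSection]
        · exact (hHm.comp (by fun_prop)).aemeasurable

/-! ### Sobolev inequalities on domains with the cone property -/

theorem lintegral_rpow_Ioc_lt_top {a : ℝ} (ha : -1 < a) :
    ∫⁻ s in Ioc (0 : ℝ) 1, ENNReal.ofReal (s ^ a) < ⊤ := by
  have h := (intervalIntegral.intervalIntegrable_rpow' (a := 0) (b := 1) ha)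
  rw [intervalIntegrable_iff_integrableOn_Ioc_of_le zero_le_one] at h
  have := h.2
  rw [hasFiniteIntegral_iff_enorm] at this
  refine lt_of_le_of_lt (lintegral_mono fun s => ?_) this
  exact Real.ofReal_le_enorm _

/-- Split the fourth power into two squares: one is bounded uniformly in x with s^{-3}, the other is
integrated in x without loss. -/
theorem lintegral_coneSection_four_le {B : Set E3} {H : E3 → ℝ≥0∞} (hH : Measurable H)
    {s : ℝ} (hs : 0 < s) :
    ∫⁻ x, coneSection B H s x ^ (4 : ℝ) ≤
      ENNReal.ofReal (s⁻¹ ^ 3) * (volume B ^ (3 : ℝ) * (∫⁻ z, H z ^ (2 : ℝ)) ^ (2 : ℝ)) := by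
  have hm : Measurable fun x => coneSection B H s x :=
    (measurable_coneSection B hH).comp (measurable_const.prodMk measurable_id)
  set N := ∫⁻ z, H z ^ (2 : ℝ) with hN
  set V := volume B with hV
  have h4 : ∀ a : ℝ≥0∞, a ^ (4 : ℝ) = a ^ (2 : ℝ) * a ^ (2 : ℝ) := fun a => by
    rw [show (4 : ℝ) = 2 + 2 by norm_num, ENNReal.rpow_add_of_nonneg _ _ (by norm_num) (by norm_num)]
  calc ∫⁻ x, coneSection B H s x ^ (4 : ℝ)
      ≤ ∫⁻ x, (ENNReal.ofReal (s⁻¹ ^ 3) * N * V ^ ((2 : ℝ) - 1)) * coneSection B H s x ^ (2 : ℝ) := by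
        refine lintegral_mono fun x => ?_
        rw [h4]
        gcongr
        exact coneSection_rpow_le_lintegral hH one_lt_two hs x
    _ ≤ (ENNReal.ofReal (s⁻¹ ^ 3) * N * V ^ ((2 : ℝ) - 1)) * (V ^ (2 : ℝ) * N) := by
        rw [lintegral_const_mul _ (hm.pow_const _)]
        gcongr
        exact lintegral_coneSection_rpow_le hH one_lt_two s
    _ = _ := by
        have e1 : V ^ (3 : ℝ) = V ^ ((2 : ℝ) - 1) * V ^ (2 : ℝ) := by
          rw [← ENNReal.rpow_add_of_nonneg _ _ (by norm_num) (by norm_num)]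
          norm_num
        have e2 : N ^ (2 : ℝ) = N * N := by
          rw [ENNReal.rpow_two, sq]
        rw [e1, e2]
        ring

theorem ofReal_rpow_mul_rpow {s : ℝ} (hs : 0 < s) (a b : ℝ) :
    ENNReal.ofReal (s ^ a) * ENNReal.ofReal (s ^ b) = ENNReal.ofReal (s ^ (a + b)) := by
  rw [← ENNReal.ofReal_mul (by positivity), ← Real.rpow_add hs]

/-- Weighted Hölder inequality on the unit interval. -/
theorem lintegral_Ioc_rpow_four_le {a : ℝ → ℝ≥0∞} (ha : Measurable a) :
    (∫⁻ s in Ioc (0 : ℝ) 1, a s) ^ (4 : ℝ) ≤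
      (∫⁻ s in Ioc (0 : ℝ) 1, ENNReal.ofReal (s ^ (-5 / 6 : ℝ))) ^ (3 : ℝ) *
        ∫⁻ s in Ioc (0 : ℝ) 1, ENNReal.ofReal (s ^ (5 / 2 : ℝ)) * a s ^ (4 : ℝ) := by
  have hpq : (4 / 3 : ℝ).HolderConjugate 4 := by
    rw [Real.holderConjugate_iff]; norm_num
  -- The weight s^{-5/8} has integrable power 4/3, namely s^{-5/6}, while s^{5/8} to the fourth is
  -- s^{5/2}, which turns the later s^{-3} into the integrable s^{-1/2}. Exponents strictly between
  -- 1/2 and 3/4 would do.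
  have hm1 : Measurable fun s : ℝ => ENNReal.ofReal (s ^ (-5 / 8 : ℝ)) := by fun_prop
  have hm2 : Measurable fun s : ℝ => ENNReal.ofReal (s ^ (5 / 8 : ℝ)) * a s := by fun_prop
  have h1 := ENNReal.lintegral_mul_le_Lp_mul_Lq (volume.restrict (Ioc (0 : ℝ) 1)) hpq
    hm1.aemeasurable hm2.aemeasurable
  have e0 : ∫⁻ s in Ioc (0 : ℝ) 1, a s = ∫⁻ s in Ioc (0 : ℝ) 1,
      ((fun s : ℝ => ENNReal.ofReal (s ^ (-5 / 8 : ℝ))) *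
        fun s => ENNReal.ofReal (s ^ (5 / 8 : ℝ)) * a s) s := by
    refine setLIntegral_congr_fun measurableSet_Ioc fun s hs => ?_
    simp only [Pi.mul_apply]
    rw [← mul_assoc, ofReal_rpow_mul_rpow hs.1]
    norm_num
  have e1 : ∫⁻ s in Ioc (0 : ℝ) 1, ENNReal.ofReal (s ^ (-5 / 8 : ℝ)) ^ (4 / 3 : ℝ) =
      ∫⁻ s in Ioc (0 : ℝ) 1, ENNReal.ofReal (s ^ (-5 / 6 : ℝ)) := by
    refine setLIntegral_congr_fun measurableSet_Ioc fun s hs => ?_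
    rw [ENNReal.ofReal_rpow_of_nonneg (Real.rpow_nonneg hs.1.le _) (by norm_num),
      ← Real.rpow_mul hs.1.le]
    norm_num
  have e2 : ∫⁻ s in Ioc (0 : ℝ) 1, (ENNReal.ofReal (s ^ (5 / 8 : ℝ)) * a s) ^ (4 : ℝ) =
      ∫⁻ s in Ioc (0 : ℝ) 1, ENNReal.ofReal (s ^ (5 / 2 : ℝ)) * a s ^ (4 : ℝ) := by
    refine setLIntegral_congr_fun measurableSet_Ioc fun s hs => ?_
    rw [ENNReal.mul_rpow_of_nonneg _ _ (by norm_num),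
      ENNReal.ofReal_rpow_of_nonneg (Real.rpow_nonneg hs.1.le _) (by norm_num),
      ← Real.rpow_mul hs.1.le]
    norm_num
  rw [e1, e2] at h1
  rw [e0]
  refine (ENNReal.rpow_le_rpow h1 (by norm_num)).trans ?_
  rw [ENNReal.mul_rpow_of_nonneg _ _ (by norm_num), ← ENNReal.rpow_mul, ← ENNReal.rpow_mul]
  norm_num

/-- Averages over cones map `L²` to `L⁴`. -/
theorem lintegral_cone_four_le {B : Set E3} (hB : volume B ≠ ⊤) :
    ∃ C : ℝ≥0∞, C ≠ ⊤ ∧ ∀ H : E3 → ℝ≥0∞, Measurable H →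
      ∫⁻ x, (∫⁻ s in Ioc (0 : ℝ) 1, coneSection B H s x) ^ (4 : ℝ) ≤
        C * (∫⁻ z, H z ^ (2 : ℝ)) ^ (2 : ℝ) := by
  set K := ∫⁻ s in Ioc (0 : ℝ) 1, ENNReal.ofReal (s ^ (-5 / 6 : ℝ)) with hK
  have hKt : K ≠ ⊤ := (lintegral_rpow_Ioc_lt_top (by norm_num)).ne
  set K' := ∫⁻ s in Ioc (0 : ℝ) 1, ENNReal.ofReal (s ^ (-1 / 2 : ℝ)) with hK'
  have hKt' : K' ≠ ⊤ := (lintegral_rpow_Ioc_lt_top (by norm_num)).ne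
  refine ⟨K ^ (3 : ℝ) * (K' * volume B ^ (3 : ℝ)), by finiteness, fun H hH => ?_⟩
  set N := ∫⁻ z, H z ^ (2 : ℝ) with hN
  have hm : Measurable fun p : ℝ × E3 => coneSection B H p.1 p.2 := measurable_coneSection B hH
  have hm' : Measurable fun p : E3 × ℝ =>
      ENNReal.ofReal (p.2 ^ (5 / 2 : ℝ)) * coneSection B H p.2 p.1 ^ (4 : ℝ) :=
    (show Measurable fun p : E3 × ℝ => ENNReal.ofReal (p.2 ^ (5 / 2 : ℝ)) by fun_prop).mul
      ((hm.comp measurable_swap).pow_const _)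
  calc ∫⁻ x, (∫⁻ s in Ioc (0 : ℝ) 1, coneSection B H s x) ^ (4 : ℝ)
      ≤ ∫⁻ x, K ^ (3 : ℝ) * ∫⁻ s in Ioc (0 : ℝ) 1,
          ENNReal.ofReal (s ^ (5 / 2 : ℝ)) * coneSection B H s x ^ (4 : ℝ) :=
        lintegral_mono fun x => lintegral_Ioc_rpow_four_le
          (hm.comp (measurable_id.prodMk measurable_const))
    _ = K ^ (3 : ℝ) * ∫⁻ s in Ioc (0 : ℝ) 1, ∫⁻ x,
          ENNReal.ofReal (s ^ (5 / 2 : ℝ)) * coneSection B H s x ^ (4 : ℝ) := by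
        rw [lintegral_const_mul _ (Measurable.lintegral_prod_right' hm'),
          lintegral_lintegral_swap hm'.aemeasurable]
    _ ≤ K ^ (3 : ℝ) * ∫⁻ s in Ioc (0 : ℝ) 1,
          ENNReal.ofReal (s ^ (-1 / 2 : ℝ)) * (volume B ^ (3 : ℝ) * N ^ (2 : ℝ)) := by
        refine mul_le_mul' le_rfl (setLIntegral_mono' measurableSet_Ioc fun s hs => ?_)
        have hms : Measurable fun x => coneSection B H s x :=
          hm.comp (measurable_const.prodMk measurable_id)
        rw [lintegral_const_mul _ (hms.pow_const _)]
        calc _ ≤ ENNReal.ofReal (s ^ (5 / 2 : ℝ)) * (ENNReal.ofReal (s⁻¹ ^ 3) *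
              (volume B ^ (3 : ℝ) * N ^ (2 : ℝ))) := by
              gcongr
              exact lintegral_coneSection_four_le hH hs.1
          _ = _ := by
              rw [← mul_assoc]
              congr 1
              have : s⁻¹ ^ 3 = s ^ (-3 : ℝ) := by
                rw [Real.rpow_neg hs.1.le, inv_pow]
                norm_cast
              rw [this, ofReal_rpow_mul_rpow hs.1]
              norm_num
    _ = _ := by
        rw [lintegral_mul_const _ (by fun_prop)]
        ring

/-- The section at height one and the integral over heights are each bounded in L⁴ by the L² norm of
the density; dividing by the volume of the base finishes the local estimate. -/
theorem ConeOn.lintegral_four_le {U W : Set E3} (hU : IsOpen U) (hb : Bornology.IsBounded U)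
    (hW : IsOpen W) {z₀ : E3} {r : ℝ} (hr : 0 < r) (hcone : ConeOn U W z₀ r) :
    ∃ C : ℝ≥0∞, C ≠ ⊤ ∧ ∀ (f : L2 U) (g : Fin 3 → L2 U), (∀ j, IsWeakPartial U j f (g j)) →
      ∫⁻ x in W ∩ U, ‖f x‖ₑ ^ (4 : ℝ) ≤ C * (∫⁻ z, h1Density U f g z ^ (2 : ℝ)) ^ (2 : ℝ) := by
  set B := ball z₀ r with hB
  set V := volume B with hV
  have hV0 : V ≠ 0 := (measure_ball_pos volume z₀ hr).ne'
  have hVt : V ≠ ⊤ := measure_ball_lt_top.ne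
  obtain ⟨C, hC, hCH⟩ := lintegral_cone_four_le hVt
  set K := ENNReal.ofReal (‖z₀‖ + r)
  have hK : K ≠ ⊤ := ENNReal.ofReal_ne_top
  refine ⟨(V ^ (4 : ℝ))⁻¹ * ((2 : ℝ≥0∞) ^ ((4 : ℝ) - 1) * (V ^ (3 : ℝ) + K ^ (4 : ℝ) * C)), ?_,
    fun f g h => ?_⟩
  · have : V ^ (4 : ℝ) ≠ 0 := by simp [hV0]
    finiteness
  set H := h1Density U f g with hH
  have hHm : Measurable H := measurable_h1Density hU f g
  have hm : Measurable fun p : ℝ × E3 => coneSection B H p.1 p.2 := measurable_coneSection B hHm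
  have hm1 : Measurable fun x => coneSection B H 1 x := hm.comp (measurable_const.prodMk measurable_id)
  have hm2 : Measurable fun x => ∫⁻ s in Ioc (0 : ℝ) 1, coneSection B H s x :=
    Measurable.lintegral_prod_right' (f := fun p : E3 × ℝ => coneSection B H p.2 p.1)
      (hm.comp measurable_swap)
  set N := ∫⁻ z, H z ^ (2 : ℝ) with hN
  have hV4 : V ^ (4 : ℝ) ≠ 0 := by simp [hV0]
  have hV4t : V ^ (4 : ℝ) ≠ ⊤ := by finiteness
  have key : V ^ (4 : ℝ) * ∫⁻ x in W ∩ U, ‖f x‖ₑ ^ (4 : ℝ) ≤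
      (2 : ℝ≥0∞) ^ ((4 : ℝ) - 1) * (V ^ (3 : ℝ) + K ^ (4 : ℝ) * C) * N ^ (2 : ℝ) := by
    rw [← lintegral_const_mul _ ((Lp.stronglyMeasurable f).enorm.pow_const _)]
    calc ∫⁻ x in W ∩ U, V ^ (4 : ℝ) * ‖f x‖ₑ ^ (4 : ℝ)
        ≤ ∫⁻ x in W ∩ U, (2 : ℝ≥0∞) ^ ((4 : ℝ) - 1) * (coneSection B H 1 x ^ (4 : ℝ) +
            K ^ (4 : ℝ) * (∫⁻ s in Ioc (0 : ℝ) 1, coneSection B H s x) ^ (4 : ℝ)) := by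
          refine lintegral_mono_ae ?_
          rw [ae_restrict_iff' (hW.inter hU).measurableSet]
          filter_upwards [volume_mul_enorm_le hU hb hW hcone h] with x hx hxW
          rw [← ENNReal.mul_rpow_of_nonneg _ _ (by norm_num),
            ← ENNReal.mul_rpow_of_nonneg _ _ (by norm_num)]
          refine (ENNReal.rpow_le_rpow (hx hxW) (by norm_num)).trans ?_
          exact ENNReal.rpow_add_le_mul_rpow_add_rpow _ _ (by norm_num)
      _ ≤ ∫⁻ x, (2 : ℝ≥0∞) ^ ((4 : ℝ) - 1) * (coneSection B H 1 x ^ (4 : ℝ) +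
            K ^ (4 : ℝ) * (∫⁻ s in Ioc (0 : ℝ) 1, coneSection B H s x) ^ (4 : ℝ)) :=
          setLIntegral_le_lintegral _ _
      _ ≤ (2 : ℝ≥0∞) ^ ((4 : ℝ) - 1) * (V ^ (3 : ℝ) * N ^ (2 : ℝ) +
            K ^ (4 : ℝ) * (C * N ^ (2 : ℝ))) := by
          rw [lintegral_const_mul _ (by fun_prop), lintegral_add_left (by fun_prop),
            lintegral_const_mul _ (by fun_prop)]
          gcongr
          · refine (lintegral_coneSection_four_le (B := B) hHm one_pos).trans_eq ?_
            simp [hN, hV]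
          · exact hCH H hHm
      _ = _ := by ring
  calc ∫⁻ x in W ∩ U, ‖f x‖ₑ ^ (4 : ℝ)
      = (V ^ (4 : ℝ))⁻¹ * (V ^ (4 : ℝ) * ∫⁻ x in W ∩ U, ‖f x‖ₑ ^ (4 : ℝ)) := by
        rw [← mul_assoc, ENNReal.inv_mul_cancel hV4 hV4t, one_mul]
    _ ≤ (V ^ (4 : ℝ))⁻¹ * ((2 : ℝ≥0∞) ^ ((4 : ℝ) - 1) * (V ^ (3 : ℝ) + K ^ (4 : ℝ) * C) *
          N ^ (2 : ℝ)) := by gcongr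
    _ = _ := by ring

/-- Hölder with exponent 4 on each section leaves the singularity s^{-3/4}, integrable because 4
exceeds the dimension 3. The bound no longer depends on x. -/
theorem ConeOn.enorm_le {U W : Set E3} (hU : IsOpen U) (hb : Bornology.IsBounded U)
    (hW : IsOpen W) {z₀ : E3} {r : ℝ} (hr : 0 < r) (hcone : ConeOn U W z₀ r) :
    ∃ C : ℝ≥0∞, C ≠ ⊤ ∧ ∀ (f : L2 U) (g : Fin 3 → L2 U), (∀ j, IsWeakPartial U j f (g j)) →
      ∀ᵐ x, x ∈ W ∩ U → ‖f x‖ₑ ≤ C * (∫⁻ z, h1Density U f g z ^ (4 : ℝ)) ^ (1 / 4 : ℝ) := by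
  set B := ball z₀ r with hB
  set V := volume B with hV
  have hV0 : V ≠ 0 := (measure_ball_pos volume z₀ hr).ne'
  have hVt : V ≠ ⊤ := measure_ball_lt_top.ne
  set K := ENNReal.ofReal (‖z₀‖ + r)
  have hK : K ≠ ⊤ := ENNReal.ofReal_ne_top
  set L := ∫⁻ s in Ioc (0 : ℝ) 1, ENNReal.ofReal (s ^ (-3 / 4 : ℝ)) with hL
  have hLt : L ≠ ⊤ := (lintegral_rpow_Ioc_lt_top (by norm_num)).ne
  refine ⟨V⁻¹ * (V ^ (3 / 4 : ℝ) * (1 + K * L)), by finiteness, fun f g h => ?_⟩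
  set H := h1Density U f g with hH
  have hHm : Measurable H := measurable_h1Density hU f g
  set N := (∫⁻ z, H z ^ (4 : ℝ)) ^ (1 / 4 : ℝ) with hN
  have hsec : ∀ s : ℝ, 0 < s → ∀ x, coneSection B H s x ≤
      ENNReal.ofReal (s ^ (-3 / 4 : ℝ)) * (N * V ^ (3 / 4 : ℝ)) := by
    intro s hs x
    have h1 := coneSection_rpow_le_lintegral (B := B) hHm (p := 4) (by norm_num) hs x
    have h2 := ENNReal.rpow_le_rpow h1 (z := 1 / 4) (by norm_num)
    rw [← ENNReal.rpow_mul, ENNReal.mul_rpow_of_nonneg _ _ (by norm_num),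
      ENNReal.mul_rpow_of_nonneg _ _ (by norm_num), ← ENNReal.rpow_mul,
      ENNReal.ofReal_rpow_of_nonneg (by positivity) (by norm_num)] at h2
    have e1 : (s⁻¹ ^ 3) ^ (1 / 4 : ℝ) = s ^ (-3 / 4 : ℝ) := by
      rw [← Real.rpow_natCast, ← Real.rpow_mul (by positivity), Real.inv_rpow hs.le,
        ← Real.rpow_neg hs.le]
      norm_num
    rw [e1] at h2
    norm_num at h2
    rw [← mul_assoc]
    convert h2 using 3
    · norm_num
    · norm_num [hN]
  filter_upwards [volume_mul_enorm_le hU hb hW hcone h] with x hx hxW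
  have h1 := hx hxW
  have h2 : ∫⁻ s in Ioc (0 : ℝ) 1, coneSection B H s x ≤ L * (N * V ^ (3 / 4 : ℝ)) := by
    rw [← lintegral_mul_const _ (by fun_prop)]
    exact setLIntegral_mono' measurableSet_Ioc fun s hs => hsec s hs.1 x
  have h3 := hsec 1 one_pos x
  simp only [Real.one_rpow, ENNReal.ofReal_one, one_mul] at h3
  calc ‖f x‖ₑ = V⁻¹ * (V * ‖f x‖ₑ) := by
        rw [← mul_assoc, ENNReal.inv_mul_cancel hV0 hVt, one_mul]
    _ ≤ V⁻¹ * (N * V ^ (3 / 4 : ℝ) + K * (L * (N * V ^ (3 / 4 : ℝ)))) := by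
        gcongr
        exact h1.trans (by gcongr)
    _ = _ := by ring

/-- The embedding of `H¹(U)` into `L⁴(U)`. -/
theorem HasCone.lintegral_four_le {U : Set E3} (hU : IsOpen U) (hb : Bornology.IsBounded U)
    (hc : HasCone U) :
    ∃ C : ℝ≥0∞, C ≠ ⊤ ∧ ∀ (f : L2 U) (g : Fin 3 → L2 U), (∀ j, IsWeakPartial U j f (g j)) →
      ∫⁻ x in U, ‖f x‖ₑ ^ (4 : ℝ) ≤ C * (∫⁻ z, h1Density U f g z ^ (2 : ℝ)) ^ (2 : ℝ) := by
  have key : ∃ C : ℝ≥0∞, C ≠ ⊤ ∧ ∀ (f : L2 U) (g : Fin 3 → L2 U),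
      (∀ j, IsWeakPartial U j f (g j)) → ∫⁻ x in closure U ∩ U, ‖f x‖ₑ ^ (4 : ℝ) ≤
        C * (∫⁻ z, h1Density U f g z ^ (2 : ℝ)) ^ (2 : ℝ) := by
    -- Sets admitting such a constant are stable under subsets and finite unions, so by compactness
    -- of the closure the local estimate suffices.
    refine hb.isCompact_closure.induction_on (p := fun S => ∃ C : ℝ≥0∞, C ≠ ⊤ ∧
      ∀ (f : L2 U) (g : Fin 3 → L2 U), (∀ j, IsWeakPartial U j f (g j)) →
      ∫⁻ x in S ∩ U, ‖f x‖ₑ ^ (4 : ℝ) ≤ C * (∫⁻ z, h1Density U f g z ^ (2 : ℝ)) ^ (2 : ℝ))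
      ⟨0, by simp, by simp⟩ ?_ ?_ ?_
    · rintro s t hst ⟨C, hC, h⟩
      exact ⟨C, hC, fun f g hfg => (lintegral_mono_set (inter_subset_inter_left U hst)).trans
        (h f g hfg)⟩
    · rintro s t ⟨C, hC, h⟩ ⟨C', hC', h'⟩
      refine ⟨C + C', by finiteness, fun f g hfg => ?_⟩
      rw [union_inter_distrib_right, add_mul]
      exact (lintegral_union_le _ _ _).trans (add_le_add (h f g hfg) (h' f g hfg))
    · intro x hx
      obtain ⟨W, hW, hxW, z₀, r, hr, hcone⟩ := hc x hx
      exact ⟨W, mem_nhdsWithin_of_mem_nhds (hW.mem_nhds hxW),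
        hcone.lintegral_four_le hU hb hW hr⟩
  rwa [inter_eq_right.2 subset_closure] at key

/-- The embedding of `W^{1,4}(U)` into `L^∞(U)`. -/
theorem HasCone.enorm_le {U : Set E3} (hU : IsOpen U) (hb : Bornology.IsBounded U)
    (hc : HasCone U) :
    ∃ C : ℝ≥0∞, C ≠ ⊤ ∧ ∀ (f : L2 U) (g : Fin 3 → L2 U), (∀ j, IsWeakPartial U j f (g j)) →
      ∀ᵐ x, x ∈ U → ‖f x‖ₑ ≤ C * (∫⁻ z, h1Density U f g z ^ (4 : ℝ)) ^ (1 / 4 : ℝ) := by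
  have key : ∃ C : ℝ≥0∞, C ≠ ⊤ ∧ ∀ (f : L2 U) (g : Fin 3 → L2 U),
      (∀ j, IsWeakPartial U j f (g j)) → ∀ᵐ x, x ∈ closure U ∩ U → ‖f x‖ₑ ≤
        C * (∫⁻ z, h1Density U f g z ^ (4 : ℝ)) ^ (1 / 4 : ℝ) := by
    refine hb.isCompact_closure.induction_on (p := fun S => ∃ C : ℝ≥0∞, C ≠ ⊤ ∧
      ∀ (f : L2 U) (g : Fin 3 → L2 U), (∀ j, IsWeakPartial U j f (g j)) →
      ∀ᵐ x, x ∈ S ∩ U → ‖f x‖ₑ ≤ C * (∫⁻ z, h1Density U f g z ^ (4 : ℝ)) ^ (1 / 4 : ℝ))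
      ⟨0, by simp, by simp⟩ ?_ ?_ ?_
    · rintro s t hst ⟨C, hC, h⟩
      refine ⟨C, hC, fun f g hfg => ?_⟩
      filter_upwards [h f g hfg] with x hx hxs using hx ⟨hst hxs.1, hxs.2⟩
    · rintro s t ⟨C, hC, h⟩ ⟨C', hC', h'⟩
      refine ⟨C + C', by finiteness, fun f g hfg => ?_⟩
      filter_upwards [h f g hfg, h' f g hfg] with x hx hx' hxs
      rw [add_mul]
      rcases hxs.1 with h1 | h1
      · exact (hx ⟨h1, hxs.2⟩).trans le_self_add
      · exact (hx' ⟨h1, hxs.2⟩).trans le_add_self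
    · intro x hx
      obtain ⟨W, hW, hxW, z₀, r, hr, hcone⟩ := hc x hx
      exact ⟨W, mem_nhdsWithin_of_mem_nhds (hW.mem_nhds hxW), hcone.enorm_le hU hb hW hr⟩
  rwa [inter_eq_right.2 subset_closure] at key

/-! ### Local defining functions of the boundary -/

/-- A local defining function of `U` near the boundary point `y₀`, strictly increasing in the
direction `z₀`. -/
structure LocalDefining (U : Set E3) (y₀ : E3) where
  R : ℝ
  R_pos : 0 < R
  h : E3 → ℝ
  z₀ : E3
  c : ℝ
  c_pos : 0 < c
  C : ℝ
  C_nonneg : 0 ≤ C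
  continuousOn : ContinuousOn h (closure U ∩ ball y₀ R)
  contDiffAt : ∀ y ∈ U ∩ ball y₀ R, ContDiffAt ℝ 1 h y
  pos : ∀ y ∈ U ∩ ball y₀ R, 0 < h y
  eq_zero : ∀ y ∈ frontier U ∩ ball y₀ R, h y = 0
  fderiv_le : ∀ y ∈ U ∩ ball y₀ R, ‖fderiv ℝ h y‖ ≤ C
  le_fderiv : ∀ y ∈ U ∩ ball y₀ R, c ≤ fderiv ℝ h y z₀

theorem exists_first_exit {U : Set E3} (hU : IsOpen U) {x v : E3} (hx : x ∈ U) (hv : x + v ∉ U) :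
    ∃ s ∈ Ioc (0 : ℝ) 1, x + s • v ∈ frontier U ∧ ∀ s' ∈ Ico 0 s, x + s' • v ∈ U := by
  set S : Set ℝ := Icc 0 1 ∩ (fun s : ℝ => x + s • v) ⁻¹' Uᶜ with hS
  have hSc : IsCompact S := isCompact_Icc.inter_right (hU.isClosed_compl.preimage (by fun_prop))
  have hSn : S.Nonempty := ⟨1, by simp, by simpa using hv⟩
  obtain ⟨s, hs, hleast⟩ := hSc.exists_isLeast hSn
  have hs0 : 0 < s := by
    refine lt_of_le_of_ne hs.1.1 fun h0 => ?_
    have := hs.2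
    rw [← h0] at this
    simp [hx] at this
  have hin : ∀ s' ∈ Ico 0 s, x + s' • v ∈ U := by
    intro s' hs'
    by_contra hcon
    exact absurd (hleast ⟨⟨hs'.1, hs'.2.le.trans hs.1.2⟩, hcon⟩) (not_le.2 hs'.2)
  refine ⟨s, ⟨hs0, hs.1.2⟩, ?_, hin⟩
  rw [hU.frontier_eq]
  refine ⟨?_, hs.2⟩
  have h1 : s ∈ closure (Ico 0 s) := by
    rw [closure_Ico hs0.ne]; exact ⟨hs0.le, le_rfl⟩
  have h2 : ContinuousWithinAt (fun s : ℝ => x + s • v) (Ico 0 s) s := by fun_prop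
  exact h2.mem_closure h1 hin

/-- Along the segment, h + a·s is nondecreasing up to the first exit, where h vanishes. With a
proportional to the length this bounds h by the distance; with a = 0 it forbids leaving U. -/
theorem LocalDefining.le_of_exit {U : Set E3} (hU : IsOpen U) {y₀ : E3} (P : LocalDefining U y₀)
    {x v : E3} (hx : x ∈ U) (hv : x + v ∉ U) (hball : ∀ s ∈ Icc (0 : ℝ) 1, x + s • v ∈ ball y₀ P.R)
    {a : ℝ} (ha : 0 ≤ a) (hder : ∀ y ∈ U ∩ ball y₀ P.R, -a ≤ fderiv ℝ P.h y v) : P.h x ≤ a := by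
  obtain ⟨s, hs, hfr, hin⟩ := exists_first_exit hU hx hv
  have hb : ∀ s' ∈ Icc 0 s, x + s' • v ∈ ball y₀ P.R := fun s' hs' =>
    hball s' ⟨hs'.1, hs'.2.trans hs.2⟩
  have hd : ∀ s' ∈ Ico 0 s, HasDerivAt (fun s : ℝ => P.h (x + s • v) + a * s)
      (fderiv ℝ P.h (x + s' • v) v + a) s' := by
    intro s' hs'
    have h1 : HasDerivAt (fun s : ℝ => x + s • v) v s' := by
      simpa using ((hasDerivAt_id s').smul_const v).const_add x
    have h2 := ((P.contDiffAt _ ⟨hin s' hs', hb s' ⟨hs'.1, hs'.2.le⟩⟩).differentiableAt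
      one_ne_zero).hasFDerivAt
    have h3 : HasDerivAt (fun s : ℝ => a * s) a s' := by simpa using (hasDerivAt_id s').const_mul a
    exact (h2.comp_hasDerivAt s' h1).add h3
  have hmono : MonotoneOn (fun s : ℝ => P.h (x + s • v) + a * s) (Icc 0 s) := by
    refine monotoneOn_of_deriv_nonneg (convex_Icc 0 s) ?_ ?_ ?_
    · refine ContinuousOn.add ?_ (by fun_prop)
      refine P.continuousOn.comp (by fun_prop) fun s' hs' => ⟨?_, hb s' hs'⟩
      rcases eq_or_lt_of_le hs'.2 with h | h
      · rw [h]; exact frontier_subset_closure hfr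
      · exact subset_closure (hin s' ⟨hs'.1, h⟩)
    · intro s' hs'
      rw [interior_Icc] at hs'
      exact (hd s' ⟨hs'.1.le, hs'.2⟩).differentiableAt.differentiableWithinAt
    · intro s' hs'
      rw [interior_Icc] at hs'
      have hs'' : s' ∈ Ico 0 s := ⟨hs'.1.le, hs'.2⟩
      rw [(hd s' hs'').deriv]
      have := hder _ ⟨hin s' hs'', hb s' ⟨hs''.1, hs''.2.le⟩⟩
      linarith
  have h1 := hmono (left_mem_Icc.2 hs.1.le) (right_mem_Icc.2 hs.1.le) hs.1.le
  simp only [zero_smul, add_zero, mul_zero] at h1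
  rw [P.eq_zero _ ⟨hfr, hb s (right_mem_Icc.2 hs.1.le)⟩, zero_add] at h1
  exact h1.trans (mul_le_of_le_one_right ha hs.2)

/-- Apply the exit estimate to the segment towards a nearest boundary point. As y₀ is on the
boundary, that point is nearer than R/2, and the segment stays in the ball of radius R. -/
theorem LocalDefining.le_infDist {U : Set E3} (hU : IsOpen U) {y₀ : E3} (hy₀ : y₀ ∈ frontier U)
    (P : LocalDefining U y₀) {y : E3} (hy : y ∈ U ∩ ball y₀ (P.R / 2)) :
    P.h y ≤ P.C * infDist y (frontier U) := by
  obtain ⟨y', hy', hd⟩ := isClosed_frontier.exists_infDist_eq_dist ⟨y₀, hy₀⟩ y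
  have hy'U : y' ∉ U := by
    rw [hU.frontier_eq] at hy'
    exact hy'.2
  have h1 : dist y y' < P.R / 2 := by
    rw [← hd]
    exact (infDist_le_dist_of_mem hy₀).trans_lt hy.2
  rw [hd]
  refine P.le_of_exit hU hy.1 (v := y' - y) (by simpa using hy'U) ?_
    (mul_nonneg P.C_nonneg dist_nonneg) ?_
  · intro s hs
    have h2 : dist (y + s • (y' - y)) y ≤ dist y y' := by
      rw [dist_eq_norm, add_sub_cancel_left, norm_smul, dist_comm y, dist_eq_norm,
        Real.norm_of_nonneg hs.1]
      exact mul_le_of_le_one_left (norm_nonneg _) hs.2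
    have h3 := dist_triangle (y + s • (y' - y)) y y₀
    have h4 : dist y y₀ < P.R / 2 := hy.2
    rw [mem_ball]
    linarith
  · intro z hz
    have h2 := (fderiv ℝ P.h z).le_opNorm (y' - y)
    have h3 : ‖fderiv ℝ P.h z‖ * ‖y' - y‖ ≤ P.C * dist y y' := by
      rw [dist_comm, dist_eq_norm]
      exact mul_le_mul_of_nonneg_right (P.fderiv_le z hz) (norm_nonneg _)
    have h4 := neg_abs_le (fderiv ℝ P.h z (y' - y))
    rw [Real.norm_eq_abs] at h2
    linarith

/-- The gradient is bounded, so h is nondecreasing along every direction close enough to z₀. Leaving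
U would force h ≤ 0 at the starting point. -/
theorem LocalDefining.exists_coneOn {U : Set E3} (hU : IsOpen U) {y₀ : E3}
    (P : LocalDefining U y₀) : ∃ z₀ r, 0 < r ∧ ConeOn U (ball y₀ (P.R / 2)) z₀ r := by
  have hR := P.R_pos
  have hc := P.c_pos
  have hC := P.C_nonneg
  set r : ℝ := P.c / (P.C + 1) with hr
  have hr0 : 0 < r := by positivity
  have hrC : P.C * r ≤ P.c := by
    rw [hr, mul_div_assoc', div_le_iff₀ (by positivity)]
    nlinarith
  -- Rescales the cone so that its directions have length at most R/2 and cannot leave the ball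
  -- where h is controlled.
  set l : ℝ := P.R / 2 / (‖P.z₀‖ + r) with hl
  have hl0 : 0 < l := by positivity
  refine ⟨l • P.z₀, l * r, by positivity, fun x hx z hz s hs => ?_⟩
  by_contra hcon
  have hzd : ‖z - l • P.z₀‖ < l * r := by rwa [mem_ball, dist_eq_norm] at hz
  have hzn : ‖z‖ ≤ P.R / 2 := by
    have h1 := norm_add_le (z - l • P.z₀) (l • P.z₀)
    rw [sub_add_cancel, norm_smul, Real.norm_of_nonneg hl0.le] at h1
    have h2 : l * (‖P.z₀‖ + r) = P.R / 2 := by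
      rw [hl, div_mul_cancel₀]
      positivity
    linarith [mul_add l ‖P.z₀‖ r]
  have key := P.le_of_exit hU hx.2 (v := s • z) hcon (a := 0) ?_ le_rfl ?_
  · exact absurd key (not_le.2 (P.pos x ⟨hx.2, ball_subset_ball (by linarith) hx.1⟩))
  · intro s' hs'
    have h1 : ‖s' • s • z‖ ≤ ‖z‖ := by
      rw [norm_smul, norm_smul, Real.norm_of_nonneg hs'.1, Real.norm_of_nonneg hs.1]
      calc s' * (s * ‖z‖) ≤ 1 * (1 * ‖z‖) := by
            gcongr
            · exact mul_nonneg hs.1 (norm_nonneg _)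
            · exact hs'.2
            · exact hs.2
        _ = ‖z‖ := by ring
    have h2 : dist x y₀ < P.R / 2 := hx.1
    have h3 := dist_triangle (x + s' • s • z) x y₀
    have h4 : dist (x + s' • s • z) x = ‖s' • s • z‖ := by rw [dist_eq_norm, add_sub_cancel_left]
    rw [mem_ball]
    linarith
  · intro y hy
    rw [map_smul, smul_eq_mul, neg_zero]
    refine mul_nonneg hs.1 ?_
    have h1 : fderiv ℝ P.h y z = fderiv ℝ P.h y (z - l • P.z₀) + l * fderiv ℝ P.h y P.z₀ := by
      rw [map_sub, map_smul, smul_eq_mul]; ring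
    have h2 := (fderiv ℝ P.h y).le_opNorm (z - l • P.z₀)
    have h3 : ‖fderiv ℝ P.h y‖ * ‖z - l • P.z₀‖ ≤ P.C * (l * r) :=
      mul_le_mul (P.fderiv_le y hy) hzd.le (norm_nonneg _) hC
    have h4 := neg_abs_le (fderiv ℝ P.h y (z - l • P.z₀))
    have h5 : l * P.c ≤ l * fderiv ℝ P.h y P.z₀ :=
      mul_le_mul_of_nonneg_left (P.le_fderiv y hy) hl0.le
    have h6 : l * (P.C * r) ≤ l * P.c := mul_le_mul_of_nonneg_left hrC hl0.le
    rw [Real.norm_eq_abs] at h2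
    rw [h1]
    linarith [mul_left_comm l P.C r]

theorem hasCone_of_localDefining {U : Set E3} (hU : IsOpen U)
    (hP : ∀ y ∈ frontier U, Nonempty (LocalDefining U y)) : HasCone U := by
  intro x hx
  by_cases hxU : x ∈ U
  · obtain ⟨ε, hε, hball⟩ := Metric.isOpen_iff.1 hU x hxU
    refine ⟨ball x (ε / 2), isOpen_ball, mem_ball_self (by positivity), 0, ε / 2, by positivity,
      fun y hy z hz s hs => hball ?_⟩
    have h1 : dist y x < ε / 2 := hy.1
    have h2 : ‖z‖ < ε / 2 := by simpa using hz
    have h3 : ‖s • z‖ ≤ ‖z‖ := by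
      rw [norm_smul, Real.norm_of_nonneg hs.1]
      exact mul_le_of_le_one_left (norm_nonneg _) hs.2
    have h4 := dist_triangle (y + s • z) y x
    have h5 : dist (y + s • z) y = ‖s • z‖ := by rw [dist_eq_norm, add_sub_cancel_left]
    rw [mem_ball]
    linarith
  · have hfr : x ∈ frontier U := by
      rw [hU.frontier_eq]; exact ⟨hx, hxU⟩
    obtain ⟨P⟩ := hP x hfr
    obtain ⟨z₀, r, hr, hcone⟩ := P.exists_coneOn hU
    exact ⟨ball x (P.R / 2), isOpen_ball, mem_ball_self (by linarith [P.R_pos]), z₀, r, hr, hcone⟩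

/-! ### Poincaré, Sobolev and Hardy inequalities for test functions -/

theorem lintegral_enorm_sq_eq {E : Type*} [NormedAddCommGroup E] {f : E3 → E}
    (hf : Continuous f) (hc : HasCompactSupport f) :
    ∫⁻ y, ‖f y‖ₑ ^ (2 : ℝ) = ENNReal.ofReal (∫ y, ‖f y‖ ^ 2) := by
  have hi : Integrable fun y => ‖f y‖ ^ 2 := by
    refine Continuous.integrable_of_hasCompactSupport (by fun_prop) ?_
    exact hc.comp_left (g := fun x => ‖x‖ ^ 2) (by simp)
  rw [ofReal_integral_eq_lintegral_ofReal hi (ae_of_all _ fun y => by positivity)]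
  refine lintegral_congr fun y => ?_
  rw [ENNReal.rpow_two, ENNReal.ofReal_pow (norm_nonneg _), ofReal_norm]

theorem integral_fderiv_apply_eq_zero {q : E3 → ℝ} (hq : ContDiff ℝ 1 q) (hc : HasCompactSupport q)
    (z : E3) : ∫ y, fderiv ℝ q y z = 0 := by
  have hdc : Continuous fun y => fderiv ℝ q y z :=
    (hq.continuous_fderiv one_ne_zero).clm_apply continuous_const
  have hds : HasCompactSupport fun y => fderiv ℝ q y z :=
    (hc.fderiv ℝ).comp_left (g := fun L : E3 →L[ℝ] ℝ => L z) rfl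
  have := integral_mul_fderiv_eq_neg_fderiv_mul_of_integrable (μ := (volume : Measure E3))
    (f := fun _ => (1 : ℝ)) (g := q) (v := z) (by simp)
    (by simpa using hdc.integrable_of_hasCompactSupport hds)
    (by simpa using hq.continuous.integrable_of_hasCompactSupport hc)
    (fun x _ => differentiableAt_const _) (fun x _ => (hq.differentiable one_ne_zero) x)
  simpa using this

theorem contDiff_of_contDiffAt_tsupport {f : E3 → ℝ} (h : ∀ y ∈ tsupport f, ContDiffAt ℝ 1 f y) :
    ContDiff ℝ 1 f := by
  rw [contDiff_iff_contDiffAt]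
  intro y
  by_cases hy : y ∈ tsupport f
  · exact h y hy
  · exact (contDiffAt_const (c := (0 : ℝ))).congr_of_eventuallyEq
      (notMem_tsupport_iff_eventuallyEq.1 hy)

theorem fderiv_sq_div_apply {v h : E3 → ℝ} {y : E3} (hv : DifferentiableAt ℝ v y)
    (hh : DifferentiableAt ℝ h y) (hne : h y ≠ 0) (z : E3) :
    fderiv ℝ (fun y => v y ^ 2 / h y) y z =
      2 * (v y / h y) * fderiv ℝ v y z - (v y / h y) ^ 2 * fderiv ℝ h y z := by
  have h1 := hv.hasFDerivAt.hasLineDerivAt z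
  have h2 := hh.hasFDerivAt.hasLineDerivAt z
  have h3 := ((hv.pow 2).fun_mul (hh.inv hne)).hasFDerivAt.hasLineDerivAt z
  have h4 : HasDerivAt (fun t : ℝ => v (y + t • z) ^ 2 / h (y + t • z)) _ 0 :=
    (HasDerivAt.fun_pow h1 2).fun_div h2 (by simpa using hne)
  have h5 := h4.unique h3
  simp only [zero_smul, add_zero] at h5
  simp only [div_eq_mul_inv] at h5 ⊢
  refine h5.symm.trans ?_
  field_simp
  push_cast
  ring

/-- The derivative of v²/h in the direction z₀ integrates to zero, and it contains -(v/h)² times a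
factor at least c. The cross term is absorbed by completing a square. -/
theorem LocalDefining.hardy {U : Set E3} {y₀ : E3} (P : LocalDefining U y₀) {v : E3 → ℝ}
    (hv : ContDiff ℝ 1 v) (hc : HasCompactSupport v) (hs : tsupport v ⊆ U ∩ ball y₀ P.R) :
    ∫⁻ y, ‖v y / P.h y‖ₑ ^ (2 : ℝ) ≤
      ENNReal.ofReal (4 / P.c ^ 2) * ∫⁻ y, ‖fderiv ℝ v y P.z₀‖ₑ ^ (2 : ℝ) := by
  have hc0 := P.c_pos
  have hne : ∀ y ∈ tsupport v, P.h y ≠ 0 := fun y hy => (P.pos y (hs hy)).ne'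
  have hzero : ∀ y, y ∉ tsupport v → v =ᶠ[𝓝 y] 0 := fun y hy => notMem_tsupport_iff_eventuallyEq.1 hy
  set t : E3 → ℝ := fun y => v y / P.h y with ht
  set q : E3 → ℝ := fun y => v y ^ 2 / P.h y with hq
  have hts : tsupport t ⊆ tsupport v := by
    refine closure_mono fun y hy => ?_
    contrapose! hy
    simp [ht, Function.notMem_support.1 hy]
  have hqs : tsupport q ⊆ tsupport v := by
    refine closure_mono fun y hy => ?_
    contrapose! hy
    simp [hq, Function.notMem_support.1 hy]
  have htd : ContDiff ℝ 1 t := contDiff_of_contDiffAt_tsupport fun y hy =>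
    hv.contDiffAt.div (P.contDiffAt y (hs (hts hy))) (hne y (hts hy))
  have hqd : ContDiff ℝ 1 q := contDiff_of_contDiffAt_tsupport fun y hy =>
    (hv.pow 2).contDiffAt.div (P.contDiffAt y (hs (hqs hy))) (hne y (hqs hy))
  have htc : HasCompactSupport t := hc.mono' ((subset_tsupport t).trans hts)
  have hqc : HasCompactSupport q := hc.mono' ((subset_tsupport q).trans hqs)
  have hdc : Continuous fun y => fderiv ℝ v y P.z₀ :=
    (hv.continuous_fderiv one_ne_zero).clm_apply continuous_const
  have hds : HasCompactSupport fun y => fderiv ℝ v y P.z₀ :=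
    (hc.fderiv ℝ).comp_left (g := fun L : E3 →L[ℝ] ℝ => L P.z₀) rfl
  have hqdc : Continuous fun y => fderiv ℝ q y P.z₀ :=
    (hqd.continuous_fderiv one_ne_zero).clm_apply continuous_const
  have hqds : HasCompactSupport fun y => fderiv ℝ q y P.z₀ :=
    (hqc.fderiv ℝ).comp_left (g := fun L : E3 →L[ℝ] ℝ => L P.z₀) rfl
  have i1 : Integrable fun y => ‖t y‖ ^ 2 :=
    Continuous.integrable_of_hasCompactSupport (by have := htd.continuous; fun_prop)
      (htc.comp_left (g := fun x => ‖x‖ ^ 2) (by simp))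
  have i2 : Integrable fun y => ‖fderiv ℝ v y P.z₀‖ ^ 2 :=
    Continuous.integrable_of_hasCompactSupport (by fun_prop)
      (hds.comp_left (g := fun x => ‖x‖ ^ 2) (by simp))
  have i3 : Integrable fun y => fderiv ℝ q y P.z₀ := hqdc.integrable_of_hasCompactSupport hqds
  -- With t = v/h and a the derivative of v along z₀, the difference of the two sides is at least (t
  -- - 2a/c)².
  have hpt : ∀ y, ‖t y‖ ^ 2 ≤
      4 / P.c ^ 2 * ‖fderiv ℝ v y P.z₀‖ ^ 2 - 2 / P.c * fderiv ℝ q y P.z₀ := by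
    intro y
    by_cases hy : y ∈ tsupport v
    · have hh := (P.contDiffAt y (hs hy)).differentiableAt one_ne_zero
      have h2 : fderiv ℝ q y P.z₀ = 2 * t y * fderiv ℝ v y P.z₀ - t y ^ 2 * fderiv ℝ P.h y P.z₀ :=
        fderiv_sq_div_apply (hv.differentiable one_ne_zero y) hh (hne y hy) _
      have h3 := P.le_fderiv y (hs hy)
      set a := fderiv ℝ v y P.z₀
      set b := fderiv ℝ P.h y P.z₀
      rw [h2, Real.norm_eq_abs, Real.norm_eq_abs, sq_abs, sq_abs]
      have h4 : 0 ≤ (t y - 2 / P.c * a) ^ 2 := sq_nonneg _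
      have h5 : 2 * t y ^ 2 ≤ 2 / P.c * (t y ^ 2 * b) := by
        calc 2 * t y ^ 2 = 2 / P.c * (t y ^ 2 * P.c) := by field_simp
          _ ≤ _ := by gcongr
      have h6 : (2 / P.c * a) ^ 2 = 4 / P.c ^ 2 * a ^ 2 := by ring
      nlinarith
    · have h0 := hzero y hy
      have h1 : fderiv ℝ v y = 0 := by rw [h0.fderiv_eq]; simp
      have h2 : q =ᶠ[𝓝 y] 0 := by
        filter_upwards [h0] with x hx
        simp [hq, hx]
      have h3 : fderiv ℝ q y = 0 := by rw [h2.fderiv_eq]; simp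
      simp [ht, h0.self_of_nhds, h1, h3]
  rw [lintegral_enorm_sq_eq htd.continuous htc, lintegral_enorm_sq_eq hdc hds,
    ← ENNReal.ofReal_mul (by positivity)]
  refine ENNReal.ofReal_le_ofReal ?_
  calc ∫ y, ‖t y‖ ^ 2 ≤ ∫ y, (4 / P.c ^ 2 * ‖fderiv ℝ v y P.z₀‖ ^ 2 - 2 / P.c * fderiv ℝ q y P.z₀) :=
        integral_mono i1 ((i2.const_mul _).sub (i3.const_mul _)) hpt
    _ = _ := by
        rw [integral_sub (i2.const_mul _) (i3.const_mul _), integral_const_mul, integral_const_mul,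
          integral_fderiv_apply_eq_zero hqd hqc, mul_zero, sub_zero]

theorem exists_poincare {U : Set E3} (hb : Bornology.IsBounded U) :
    ∃ C : ℝ≥0∞, C ≠ ⊤ ∧ ∀ u : E3 → ℝ, ContDiff ℝ 1 u → tsupport u ⊆ U →
      ∫⁻ y, ‖u y‖ₑ ^ (2 : ℝ) ≤ C * ∫⁻ y, ‖fderiv ℝ u y‖ₑ ^ (2 : ℝ) := by
  refine ⟨(eLpNormLESNormFDerivOfLeConst ℝ volume U 2 2 : ℝ≥0∞) ^ (2 : ℝ), by finiteness,
    fun u hu hs => ?_⟩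
  have h1 := eLpNorm_le_eLpNorm_fderiv (volume : Measure E3) (p := 2) hu
    ((subset_tsupport u).trans hs) (by norm_num) (by simp; norm_num) hb
  have h2 := ENNReal.rpow_le_rpow h1 (z := 2) (by norm_num)
  rw [ENNReal.mul_rpow_of_nonneg _ _ (by norm_num)] at h2
  have e : ∀ {F : Type} [NormedAddCommGroup F] (f : E3 → F),
      eLpNorm f ((2 : NNReal) : ℝ≥0∞) volume ^ (2 : ℝ) = ∫⁻ y, ‖f y‖ₑ ^ (2 : ℝ) := fun f =>
    eLpNorm_nnreal_pow_eq_lintegral (f := f) (μ := volume) (p := 2) (by norm_num)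
  rwa [e, e] at h2

theorem exists_sobolev_six : ∃ C : ℝ≥0∞, C ≠ ⊤ ∧ ∀ u : E3 → ℝ, ContDiff ℝ 1 u →
    HasCompactSupport u → ∫⁻ y, ‖u y‖ₑ ^ (6 : ℝ) ≤
      C * (∫⁻ y, ‖fderiv ℝ u y‖ₑ ^ (2 : ℝ)) ^ (3 : ℝ) := by
  refine ⟨(SNormLESNormFDerivOfEqConst ℝ (volume : Measure E3) (2 : NNReal) : ℝ≥0∞) ^ (6 : ℝ),
    by finiteness, fun u hu hc => ?_⟩
  have h1 := eLpNorm_le_eLpNorm_fderiv_of_eq (volume : Measure E3) (p := 2) (p' := 6) hu hc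
    (by norm_num) (by simp) (by simp; norm_num)
  have h2 := ENNReal.rpow_le_rpow h1 (z := 6) (by norm_num)
  rw [ENNReal.mul_rpow_of_nonneg _ _ (by norm_num)] at h2
  have e6 := eLpNorm_nnreal_pow_eq_lintegral (f := u) (μ := volume) (p := 6) (by norm_num)
  have e2 := eLpNorm_nnreal_pow_eq_lintegral (f := fderiv ℝ u) (μ := volume) (p := 2) (by norm_num)
  simp only [NNReal.coe_ofNat] at e6 e2
  rw [e6, show (6 : ℝ) = 2 * 3 by norm_num, ENNReal.rpow_mul (eLpNorm _ _ _), e2] at h2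
  convert h2 using 3
  all_goals norm_num

theorem infDist_frontier_pos {U : Set E3} (hU : IsOpen U) (hfr : (frontier U).Nonempty) {y : E3}
    (hy : y ∈ U) : 0 < infDist y (frontier U) := by
  rw [← isClosed_frontier.notMem_iff_infDist_pos hfr]
  rw [hU.frontier_eq]
  exact fun h => h.2 hy

theorem exists_bump_fderiv_bound (y₀ : E3) {r : ℝ} (hr : 0 < r) :
    ∃ χ : E3 → ℝ, ContDiff ℝ 1 χ ∧ tsupport χ ⊆ ball y₀ r ∧ (∀ y ∈ ball y₀ (r / 4), χ y = 1) ∧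
      (∀ y, ‖χ y‖ ≤ 1) ∧ ∃ M : ℝ, 0 ≤ M ∧ ∀ y, ‖fderiv ℝ χ y‖ ≤ M := by
  let κ : ContDiffBump y₀ := ⟨r / 4, r / 2, by positivity, by linarith⟩
  have hκ : ContDiff ℝ 1 κ := κ.contDiff
  obtain ⟨M, hM⟩ := (hκ.continuous_fderiv one_ne_zero).bounded_above_of_compact_support
    (κ.hasCompactSupport.fderiv ℝ)
  refine ⟨κ, hκ, ?_, fun y hy => κ.one_of_mem_closedBall (ball_subset_closedBall hy),
    fun y => ?_, M, (norm_nonneg _).trans (hM y₀), hM⟩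
  · rw [κ.tsupport_eq]
    exact closedBall_subset_ball (by show r / 2 < r; linarith)
  · rw [Real.norm_of_nonneg κ.nonneg]
    exact κ.le_one

/-- Hardy's inequality. -/
theorem exists_hardy {U : Set E3} (hU : IsOpen U) (hb : Bornology.IsBounded U)
    (hfr : (frontier U).Nonempty) (hP : ∀ y ∈ frontier U, Nonempty (LocalDefining U y)) :
    ∃ C : ℝ≥0∞, C ≠ ⊤ ∧ ∀ u : E3 → ℝ, ContDiff ℝ 1 u → HasCompactSupport u → tsupport u ⊆ U →
      ∫⁻ y in U, ‖u y / infDist y (frontier U)‖ₑ ^ (2 : ℝ) ≤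
        C * ∫⁻ y, ‖fderiv ℝ u y‖ₑ ^ (2 : ℝ) := by
  obtain ⟨K, hK, hpoinc⟩ := exists_poincare hb
  set d : E3 → ℝ := fun y => infDist y (frontier U) with hd
  have hd0 : ∀ y ∈ U, 0 < d y := fun y hy => infDist_frontier_pos hU hfr hy
  have key : ∃ C : ℝ≥0∞, C ≠ ⊤ ∧ ∀ u : E3 → ℝ, ContDiff ℝ 1 u → HasCompactSupport u →
      tsupport u ⊆ U → ∫⁻ y in closure U ∩ U, ‖u y / d y‖ₑ ^ (2 : ℝ) ≤
        C * ∫⁻ y, ‖fderiv ℝ u y‖ₑ ^ (2 : ℝ) := by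
    refine hb.isCompact_closure.induction_on (p := fun S => ∃ C : ℝ≥0∞, C ≠ ⊤ ∧
      ∀ u : E3 → ℝ, ContDiff ℝ 1 u → HasCompactSupport u → tsupport u ⊆ U →
      ∫⁻ y in S ∩ U, ‖u y / d y‖ₑ ^ (2 : ℝ) ≤ C * ∫⁻ y, ‖fderiv ℝ u y‖ₑ ^ (2 : ℝ))
      ⟨0, by simp, by simp⟩ ?_ ?_ ?_
    · rintro s t hst ⟨C, hC, h⟩
      exact ⟨C, hC, fun u h1 h2 h3 => (lintegral_mono_set (inter_subset_inter_left U hst)).trans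
        (h u h1 h2 h3)⟩
    · rintro s t ⟨C, hC, h⟩ ⟨C', hC', h'⟩
      refine ⟨C + C', by finiteness, fun u h1 h2 h3 => ?_⟩
      rw [union_inter_distrib_right, add_mul]
      exact (lintegral_union_le _ _ _).trans (add_le_add (h u h1 h2 h3) (h' u h1 h2 h3))
    · intro x hx
      -- Near an interior point the distance is bounded below and Poincaré suffices. Near a boundary
      -- point the function is localized and the local Hardy inequality applies, with h at most a
      -- multiple of the distance.
      by_cases hxU : x ∈ U
      · have hdx := hd0 x hxU
        refine ⟨{y | d x / 2 < d y}, mem_nhdsWithin_of_mem_nhds ?_,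
          ENNReal.ofReal (2 / d x) ^ (2 : ℝ) * K, by finiteness, fun u h1 h2 h3 => ?_⟩
        · exact (isOpen_lt continuous_const (continuous_infDist_pt _)).mem_nhds
            (show d x / 2 < d x by linarith)
        · have hm : MeasurableSet ({y | d x / 2 < d y} ∩ U) :=
            ((isOpen_lt continuous_const (continuous_infDist_pt _)).inter hU).measurableSet
          calc _ ≤ ∫⁻ y in {y | d x / 2 < d y} ∩ U,
                ENNReal.ofReal (2 / d x) ^ (2 : ℝ) * ‖u y‖ₑ ^ (2 : ℝ) := by
                refine setLIntegral_mono' hm fun y hy => ?_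
                rw [← ENNReal.mul_rpow_of_nonneg _ _ (by norm_num)]
                gcongr
                rw [← ofReal_norm, ← ofReal_norm, ← ENNReal.ofReal_mul (by positivity), norm_div,
                  Real.norm_of_nonneg (hd0 y hy.2).le]
                refine ENNReal.ofReal_le_ofReal ?_
                have h4 : d x / 2 < d y := hy.1
                calc ‖u y‖ / d y ≤ ‖u y‖ / (d x / 2) := by gcongr
                  _ = _ := by field_simp
            _ ≤ ∫⁻ y, ENNReal.ofReal (2 / d x) ^ (2 : ℝ) * ‖u y‖ₑ ^ (2 : ℝ) :=
                setLIntegral_le_lintegral _ _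
            _ ≤ _ := by
                rw [lintegral_const_mul' _ _ (by finiteness), mul_assoc]
                gcongr
                exact hpoinc u h1 h3
      · have hxf : x ∈ frontier U := by rw [hU.frontier_eq]; exact ⟨hx, hxU⟩
        obtain ⟨P⟩ := hP x hxf
        have hR := P.R_pos
        -- Differentiating the localized function also produces a multiple of u itself, absorbed by
        -- Poincaré.
        obtain ⟨χ, hχ, hχs, hχ1, hχle, M, hM0, hM⟩ := exists_bump_fderiv_bound x
          (show 0 < P.R / 2 by positivity)
        set A := ENNReal.ofReal (4 / P.c ^ 2) with hA
        set Z := ENNReal.ofReal ‖P.z₀‖ with hZ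
        refine ⟨ball x (P.R / 2 / 4), mem_nhdsWithin_of_mem_nhds (ball_mem_nhds _ (by positivity)),
          ENNReal.ofReal P.C ^ (2 : ℝ) * (A * (Z ^ (2 : ℝ) * ((2 : ℝ≥0∞) ^ ((2 : ℝ) - 1) *
            (1 + ENNReal.ofReal M ^ (2 : ℝ) * K)))), by finiteness, fun u h1 h2 h3 => ?_⟩
        set v : E3 → ℝ := fun y => χ y * u y with hv
        have hvd : ContDiff ℝ 1 v := hχ.mul h1
        have hvc : HasCompactSupport v := h2.mul_left
        have hvs : tsupport v ⊆ U ∩ ball x P.R := fun y hy =>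
          ⟨h3 (tsupport_mul_subset_right hy),
            ball_subset_ball (by linarith) (hχs (tsupport_mul_subset_left hy))⟩
        have hhardy := P.hardy hvd hvc hvs
        have hfd : ∀ y, ‖fderiv ℝ v y P.z₀‖ₑ ≤
            Z * (‖fderiv ℝ u y‖ₑ + ENNReal.ofReal M * ‖u y‖ₑ) := by
          intro y
          rw [← ofReal_norm, ← ofReal_norm, ← ofReal_norm, ← ENNReal.ofReal_mul hM0,
            ← ENNReal.ofReal_add (norm_nonneg _) (by positivity),
            ← ENNReal.ofReal_mul (norm_nonneg _)]
          refine ENNReal.ofReal_le_ofReal ?_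
          refine ((fderiv ℝ v y).le_opNorm _).trans ?_
          rw [mul_comm]
          gcongr
          have h4 := ((hχ.differentiable one_ne_zero y).hasFDerivAt.mul
            (h1.differentiable one_ne_zero y).hasFDerivAt).fderiv
          have h5 : fderiv ℝ v y = χ y • fderiv ℝ u y + u y • fderiv ℝ χ y := h4
          rw [h5]
          refine (norm_add_le _ _).trans ?_
          rw [norm_smul, norm_smul]
          have h6 := mul_le_of_le_one_left (norm_nonneg (fderiv ℝ u y)) (hχle y)
          have h7 := mul_le_mul_of_nonneg_left (hM y) (norm_nonneg (u y))
          linarith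
        calc ∫⁻ y in ball x (P.R / 2 / 4) ∩ U, ‖u y / d y‖ₑ ^ (2 : ℝ)
            ≤ ∫⁻ y in ball x (P.R / 2 / 4) ∩ U,
                ENNReal.ofReal P.C ^ (2 : ℝ) * ‖v y / P.h y‖ₑ ^ (2 : ℝ) := by
              refine setLIntegral_mono' (isOpen_ball.inter hU).measurableSet fun y hy => ?_
              have hyb : y ∈ U ∩ ball x (P.R / 2) := ⟨hy.2, ball_subset_ball (by linarith) hy.1⟩
              have hh := P.le_infDist hU hxf hyb
              have hh0 := P.pos y ⟨hy.2, ball_subset_ball (by linarith) hy.1⟩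
              rw [← ENNReal.mul_rpow_of_nonneg _ _ (by norm_num)]
              gcongr
              rw [← ofReal_norm, ← ofReal_norm, ← ENNReal.ofReal_mul P.C_nonneg, norm_div,
                norm_div, Real.norm_of_nonneg (hd0 y hy.2).le, Real.norm_of_nonneg hh0.le]
              refine ENNReal.ofReal_le_ofReal ?_
              have h4 : v y = u y := by simp [hv, hχ1 y hy.1]
              rw [h4, mul_div_assoc', div_le_div_iff₀ (hd0 y hy.2) hh0]
              have := mul_le_mul_of_nonneg_left hh (norm_nonneg (u y))
              linarith
          _ ≤ ∫⁻ y, ENNReal.ofReal P.C ^ (2 : ℝ) * ‖v y / P.h y‖ₑ ^ (2 : ℝ) :=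
              setLIntegral_le_lintegral _ _
          _ ≤ ENNReal.ofReal P.C ^ (2 : ℝ) *
                (A * ∫⁻ y, ‖fderiv ℝ v y P.z₀‖ₑ ^ (2 : ℝ)) := by
              rw [lintegral_const_mul' _ _ (by finiteness)]
              gcongr
          _ ≤ ENNReal.ofReal P.C ^ (2 : ℝ) * (A * ∫⁻ y, Z ^ (2 : ℝ) *
                ((2 : ℝ≥0∞) ^ ((2 : ℝ) - 1) * (‖fderiv ℝ u y‖ₑ ^ (2 : ℝ) +
                  ENNReal.ofReal M ^ (2 : ℝ) * ‖u y‖ₑ ^ (2 : ℝ)))) := by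
              gcongr with y
              refine (ENNReal.rpow_le_rpow (hfd y) (by norm_num)).trans ?_
              rw [ENNReal.mul_rpow_of_nonneg _ _ (by norm_num),
                ← ENNReal.mul_rpow_of_nonneg _ ‖u y‖ₑ (by norm_num)]
              gcongr
              exact ENNReal.rpow_add_le_mul_rpow_add_rpow _ _ (by norm_num)
          _ ≤ _ := by
              have hm : Measurable fun y => ‖fderiv ℝ u y‖ₑ ^ (2 : ℝ) :=
                (h1.continuous_fderiv one_ne_zero).measurable.enorm.pow_const _
              rw [lintegral_const_mul' _ _ (by finiteness), lintegral_const_mul' _ _ (by finiteness),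
                lintegral_add_left hm, lintegral_const_mul' _ _ (by finiteness)]
              have := hpoinc u h1 h3
              simp only [mul_assoc, add_mul, one_mul]
              gcongr
  rwa [inter_eq_right.2 subset_closure] at key

theorem tendsto_clm_comp {α E F G : Type*} [NormedAddCommGroup E] [NormedSpace ℝ E]
    [NormedAddCommGroup F] [NormedSpace ℝ F] [NormedAddCommGroup G] [NormedSpace ℝ G]
    {l : Filter α} {A : α → F →L[ℝ] G} {B : α → E →L[ℝ] F} {A₀ : F →L[ℝ] G} {B₀ : E →L[ℝ] F}
    (hA : Tendsto A l (𝓝 A₀)) (hB : Tendsto B l (𝓝 B₀)) :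
    Tendsto (fun a => (A a).comp (B a)) l (𝓝 (A₀.comp B₀)) := by
  have : Continuous fun p : (F →L[ℝ] G) × (E →L[ℝ] F) => p.1.comp p.2 :=
    continuous_fst.clm_comp continuous_snd
  exact (this.tendsto (A₀, B₀)).comp (hA.prodMk_nhds hB)

/-! ### Slicewise derivatives up to the boundary -/

section Slices

variable {F : Type*} [NormedAddCommGroup F] [NormedSpace ℝ F]

/-- The slicewise derivative of a function which is smooth up to the boundary extends smoothly up
to the boundary. -/
theorem exists_slice_fderiv {Q : Set (E3 × ℝ)} (hQ : ∀ t, IsOpen {x | (x, t) ∈ Q})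
    {f : E3 × ℝ → F} {p : E3 × ℝ} (hp : p ∈ closure Q) {n : ℕ}
    (hf : ContDiffWithinAt ℝ (n + 1) f (closure Q) p) :
    ∃ g : E3 × ℝ → E3 →L[ℝ] F, ContDiffWithinAt ℝ n g (closure Q) p ∧
      ∃ V, IsOpen V ∧ p ∈ V ∧
        ∀ q ∈ V ∩ Q, HasFDerivAt (fun z => f (z, q.2)) (g q) q.1 := by
  -- Smoothness within the closure supplies a derivative field of class C^n near p. Its spatial part
  -- is the genuine slice derivative where the slice is open, so uniqueness of derivatives on the
  -- closure is not needed.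
  obtain ⟨u, hu, -, -, f', hf', hc⟩ :=
    (contDiffWithinAt_succ_iff_hasFDerivWithinAt' (by simp)).1 hf
  rw [insert_eq_of_mem hp] at hu
  obtain ⟨V, hV, hpV, hVu⟩ := mem_nhdsWithin.1 hu
  refine ⟨fun q => (f' q).comp (ContinuousLinearMap.inl ℝ E3 ℝ),
    hc.clm_comp contDiffWithinAt_const, V, hV, hpV, fun q hq => ?_⟩
  have h1 := hf' q (hVu ⟨hq.1, subset_closure hq.2⟩)
  have h2 : HasFDerivAt (fun z : E3 => (z, q.2)) (ContinuousLinearMap.inl ℝ E3 ℝ) q.1 :=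
    hasFDerivAt_prodMk_left q.1 q.2
  have h3 := HasFDerivWithinAt.comp q.1 (t := closure Q) (s := {x | (x, q.2) ∈ Q}) h1
    h2.hasFDerivWithinAt (fun x hx => subset_closure hx)
  exact h3.hasFDerivAt ((hQ q.2).mem_nhds hq.2)

/-- Extend the slice derivative up to the boundary, then extend the derivative of that extension.
Both are continuous within the closure at p, hence bounded near p. -/
theorem exists_slice_bound_nhds {Q : Set (E3 × ℝ)} (hQ : ∀ t, IsOpen {x | (x, t) ∈ Q})
    {f : E3 × ℝ → F} {p : E3 × ℝ} (hp : p ∈ closure Q)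
    (hf : ContDiffWithinAt ℝ 2 f (closure Q) p) :
    ∃ V, IsOpen V ∧ p ∈ V ∧ ∃ C : ℝ, ∀ q ∈ V ∩ Q, ‖fderiv ℝ (fun z => f (z, q.2)) q.1‖ ≤ C ∧
      ‖fderiv ℝ (fun z => fderiv ℝ (fun z => f (z, q.2)) z) q.1‖ ≤ C := by
  obtain ⟨g, hg, V, hV, hpV, hgV⟩ := exists_slice_fderiv (n := 1) hQ hp (by norm_num; exact hf)
  obtain ⟨g', hg', V', hV', hpV', hgV'⟩ := exists_slice_fderiv (n := 0) hQ hp (f := g)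
    (by simpa using hg)
  have b1 : ∀ᶠ q in 𝓝[closure Q] p, ‖g q‖ < ‖g p‖ + 1 :=
    hg.continuousWithinAt.norm.eventually_lt_const (lt_add_one _)
  have b2 : ∀ᶠ q in 𝓝[closure Q] p, ‖g' q‖ < ‖g' p‖ + 1 :=
    hg'.continuousWithinAt.norm.eventually_lt_const (lt_add_one _)
  obtain ⟨W, hW, hpW, hWb⟩ := mem_nhdsWithin.1 (b1.and b2)
  refine ⟨V ∩ V' ∩ W, (hV.inter hV').inter hW, ⟨⟨hpV, hpV'⟩, hpW⟩,
    max (‖g p‖ + 1) (‖g' p‖ + 1), fun q hq => ?_⟩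
  obtain ⟨hb1, hb2⟩ := hWb ⟨hq.1.2, subset_closure hq.2⟩
  have hqV : q ∈ V ∩ Q := ⟨hq.1.1.1, hq.2⟩
  have hev : (fun z => fderiv ℝ (fun z => f (z, q.2)) z) =ᶠ[𝓝 q.1] fun z => g (z, q.2) := by
    have o1 : IsOpen {z : E3 | (z, q.2) ∈ V ∩ Q} :=
      (hV.preimage (by fun_prop : Continuous fun z : E3 => (z, q.2))).inter (hQ q.2)
    filter_upwards [o1.mem_nhds hqV] with z hz
    exact (hgV (z, q.2) hz).fderiv
  refine ⟨?_, ?_⟩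
  · rw [(hgV q hqV).fderiv]
    exact hb1.le.trans (le_max_left _ _)
  · rw [hev.fderiv_eq, (hgV' q ⟨hq.1.1.2, hq.2⟩).fderiv]
    exact hb2.le.trans (le_max_right _ _)

theorem exists_slice_bound {Q : Set (E3 × ℝ)} (hQ : ∀ t, IsOpen {x | (x, t) ∈ Q})
    {f : E3 × ℝ → F} (hf : ContDiffOn ℝ ∞ f (closure Q)) {K : Set (E3 × ℝ)} (hK : IsCompact K)
    (hKQ : K ⊆ closure Q) :
    ∃ C : ℝ, ∀ q ∈ K ∩ Q, ‖fderiv ℝ (fun z => f (z, q.2)) q.1‖ ≤ C ∧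
      ‖fderiv ℝ (fun z => fderiv ℝ (fun z => f (z, q.2)) z) q.1‖ ≤ C := by
  refine hK.induction_on (p := fun S => ∃ C : ℝ, ∀ q ∈ S ∩ Q,
    ‖fderiv ℝ (fun z => f (z, q.2)) q.1‖ ≤ C ∧
      ‖fderiv ℝ (fun z => fderiv ℝ (fun z => f (z, q.2)) z) q.1‖ ≤ C) ⟨0, by simp⟩ ?_ ?_ ?_
  · rintro s t hst ⟨C, hC⟩
    exact ⟨C, fun q hq => hC q ⟨hst hq.1, hq.2⟩⟩
  · rintro s t ⟨C, hC⟩ ⟨C', hC'⟩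
    refine ⟨max C C', fun q hq => ?_⟩
    rcases hq.1 with h | h
    · have := hC q ⟨h, hq.2⟩
      exact ⟨this.1.trans (le_max_left _ _), this.2.trans (le_max_left _ _)⟩
    · have := hC' q ⟨h, hq.2⟩
      exact ⟨this.1.trans (le_max_right _ _), this.2.trans (le_max_right _ _)⟩
  · intro p hp
    obtain ⟨V, hV, hpV, C, hC⟩ := exists_slice_bound_nhds hQ (hKQ hp)
      ((hf p (hKQ hp)).of_le (by norm_cast))
    exact ⟨V, mem_nhdsWithin_of_mem_nhds (hV.mem_nhds hpV), C, hC⟩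

end Slices

/-! ### Topology of the family and its slices -/

namespace Family

variable (D : Family)

theorem spaceTime_slice_isOpen (t : ℝ) : IsOpen {x | (x, t) ∈ spaceTime D.Ω} := (D.domain t).isOpen

theorem ref_slice_isOpen (t : ℝ) : IsOpen {x | (x, t) ∈ D.Ωref ×ˢ (univ : Set ℝ)} := by
  simpa using D.isOpen_ref

theorem closure_ref_prod : closure (D.Ωref ×ˢ (univ : Set ℝ)) = closure D.Ωref ×ˢ univ := by
  rw [closure_prod_eq, closure_univ]

theorem mem_closure_spaceTime {x : E3} {t : ℝ} (hx : x ∈ closure (D.Ω t)) :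
    (x, t) ∈ closure (spaceTime D.Ω) := by
  have : ContinuousWithinAt (fun x : E3 => (x, t)) (D.Ω t) x := by fun_prop
  exact this.mem_closure hx fun z hz => hz

theorem φ_mem {x : E3} {t : ℝ} (hx : x ∈ D.Ω t) : D.φ x t ∈ D.Ωref := by
  rw [← D.φ_image t]
  exact mem_image_of_mem _ hx

theorem ψ_φ_mem {x : E3} {t : ℝ} (hx : x ∈ D.Ω t) : D.ψ (D.φ x t) t = x :=
  D.ψ_φ x t (D.mem_closure_spaceTime (subset_closure hx))

theorem ψ_mem {y : E3} (t : ℝ) (hy : y ∈ D.Ωref) : D.ψ y t ∈ D.Ω t := by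
  rw [← D.φ_image t] at hy
  obtain ⟨x, hx, rfl⟩ := hy
  rwa [D.ψ_φ_mem hx]

theorem φ_ψ_closure {y : E3} (t : ℝ) (hy : y ∈ closure D.Ωref) : D.φ (D.ψ y t) t = y :=
  D.φ_ψ y t (by rw [closure_ref_prod]; exact ⟨hy, mem_univ _⟩)

theorem ψ_continuousOn (t : ℝ) : ContinuousOn (fun y => D.ψ y t) (closure D.Ωref) := by
  refine D.ψ_smooth.continuousOn.comp (f := fun y : E3 => (y, t)) (by fun_prop) fun y hy => ?_
  rw [closure_ref_prod]
  exact ⟨hy, mem_univ _⟩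

theorem φ_continuousOn (t : ℝ) : ContinuousOn (fun x => D.φ x t) (closure (D.Ω t)) :=
  D.φ_smooth.continuousOn.comp (f := fun y : E3 => (y, t)) (by fun_prop)
    fun _ hy => D.mem_closure_spaceTime hy

theorem ψ_contDiffOn (t : ℝ) : ContDiffOn ℝ ∞ (fun y => D.ψ y t) D.Ωref := by
  refine D.ψ_smooth.comp (f := fun y : E3 => (y, t)) (by fun_prop) fun y hy => ?_
  rw [closure_ref_prod]
  exact ⟨subset_closure hy, mem_univ _⟩

theorem φ_contDiffOn (t : ℝ) : ContDiffOn ℝ ∞ (fun x => D.φ x t) (D.Ω t) :=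
  D.φ_smooth.comp (f := fun y : E3 => (y, t)) (by fun_prop)
    fun _ hy => D.mem_closure_spaceTime (subset_closure hy)

theorem ψ_contDiffAt {y : E3} (t : ℝ) (hy : y ∈ D.Ωref) : ContDiffAt ℝ ∞ (fun y => D.ψ y t) y :=
  (D.ψ_contDiffOn t).contDiffAt (D.isOpen_ref.mem_nhds hy)

theorem φ_contDiffAt {x : E3} {t : ℝ} (hx : x ∈ D.Ω t) : ContDiffAt ℝ ∞ (fun x => D.φ x t) x :=
  (D.φ_contDiffOn t).contDiffAt ((D.domain t).isOpen.mem_nhds hx)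

theorem ψ_differentiableAt {y : E3} (t : ℝ) (hy : y ∈ D.Ωref) :
    DifferentiableAt ℝ (fun y => D.ψ y t) y := (D.ψ_contDiffAt t hy).differentiableAt (by simp)

theorem φ_differentiableAt {x : E3} {t : ℝ} (hx : x ∈ D.Ω t) :
    DifferentiableAt ℝ (fun x => D.φ x t) x := (D.φ_contDiffAt hx).differentiableAt (by simp)

theorem ref_nonempty : D.Ωref.Nonempty := by
  rw [← D.φ_image 0]
  exact (D.domain 0).isConnected.nonempty.image _

theorem isBounded_ref : Bornology.IsBounded D.Ωref := by
  have hc : IsCompact (closure (D.Ω 0)) := (D.domain 0).isBounded.isCompact_closure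
  refine (hc.image_of_continuousOn (D.φ_continuousOn 0)).isBounded.subset ?_
  rw [← D.φ_image 0]
  exact image_mono subset_closure

theorem frontier_ref_nonempty : (frontier D.Ωref).Nonempty := by
  rw [nonempty_iff_ne_empty, Ne, ← isClopen_iff_frontier_eq_empty]
  intro h
  rcases isClopen_iff.1 h with h | h
  · exact D.ref_nonempty.ne_empty h
  · have := D.isBounded_ref
    rw [h] at this
    exact NormedSpace.unbounded_univ ℝ E3 this

theorem ψ_mem_closure {y : E3} (t : ℝ) (hy : y ∈ closure D.Ωref) : D.ψ y t ∈ closure (D.Ω t) :=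
  ((D.ψ_continuousOn t).continuousWithinAt hy |>.mono subset_closure).mem_closure hy
    fun _ hz => D.ψ_mem t hz

theorem ψ_mem_frontier {y : E3} (t : ℝ) (hy : y ∈ frontier D.Ωref) : D.ψ y t ∈ frontier (D.Ω t) := by
  rw [D.isOpen_ref.frontier_eq] at hy
  rw [(D.domain t).isOpen.frontier_eq]
  refine ⟨D.ψ_mem_closure t hy.1, fun h => hy.2 ?_⟩
  have := D.φ_mem h
  rwa [D.φ_ψ_closure t hy.1] at this

theorem fderiv_φ_comp_fderiv_ψ {y : E3} (t : ℝ) (hy : y ∈ D.Ωref) :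
    (fderiv ℝ (fun x => D.φ x t) (D.ψ y t)).comp (fderiv ℝ (fun y => D.ψ y t) y) =
      ContinuousLinearMap.id ℝ E3 := by
  have h1 := (D.φ_differentiableAt (D.ψ_mem t hy)).hasFDerivAt.comp y
    (D.ψ_differentiableAt t hy).hasFDerivAt
  have h2 : HasFDerivAt (fun y => D.φ (D.ψ y t) t) (ContinuousLinearMap.id ℝ E3) y := by
    refine (hasFDerivAt_id y).congr_of_eventuallyEq ?_
    filter_upwards [D.isOpen_ref.mem_nhds hy] with z hz
    exact D.φ_ψ_closure t (subset_closure hz)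
  exact h1.unique h2

/-! ### The boundary of the reference domain -/

theorem exists_fderiv_ψ_limit {y₀ : E3} (t : ℝ) (hy₀ : y₀ ∈ closure D.Ωref) :
    ∃ L : E3 →L[ℝ] E3, Tendsto (fun y => fderiv ℝ (fun y => D.ψ y t) y) (𝓝[D.Ωref] y₀) (𝓝 L) := by
  have hp : (y₀, t) ∈ closure (D.Ωref ×ˢ (univ : Set ℝ)) := by
    rw [closure_ref_prod]; exact ⟨hy₀, mem_univ _⟩
  obtain ⟨g, hg, V, hV, hpV, hgV⟩ := exists_slice_fderiv (n := 0) D.ref_slice_isOpen hp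
    ((D.ψ_smooth _ hp).of_le (by simp))
  refine ⟨g (y₀, t), ?_⟩
  have h1 : Tendsto (fun y : E3 => (y, t)) (𝓝[D.Ωref] y₀)
      (𝓝[closure (D.Ωref ×ˢ (univ : Set ℝ))] (y₀, t)) := by
    refine tendsto_nhdsWithin_iff.2 ⟨?_, ?_⟩
    · exact (Continuous.tendsto (by fun_prop) _).mono_left nhdsWithin_le_nhds
    · filter_upwards [self_mem_nhdsWithin] with y hy
      exact subset_closure ⟨hy, mem_univ _⟩
  refine (hg.continuousWithinAt.tendsto.comp h1).congr' ?_
  have h2 : ∀ᶠ y : E3 in 𝓝[D.Ωref] y₀, (y, t) ∈ V :=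
    mem_nhdsWithin_of_mem_nhds ((hV.preimage (by fun_prop)).mem_nhds hpV)
  filter_upwards [h2, self_mem_nhdsWithin] with y hyV hy
  exact (hgV (y, t) ⟨hyV, hy, mem_univ _⟩).fderiv.symm

theorem exists_fderiv_φ_limit {x₀ : E3} {t : ℝ} (hx₀ : x₀ ∈ closure (D.Ω t)) :
    ∃ L : E3 →L[ℝ] E3, Tendsto (fun x => fderiv ℝ (fun x => D.φ x t) x) (𝓝[D.Ω t] x₀) (𝓝 L) := by
  have hp := D.mem_closure_spaceTime hx₀
  obtain ⟨g, hg, V, hV, hpV, hgV⟩ := exists_slice_fderiv (n := 0) D.spaceTime_slice_isOpen hp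
    ((D.φ_smooth _ hp).of_le (by simp))
  refine ⟨g (x₀, t), ?_⟩
  have h1 : Tendsto (fun y : E3 => (y, t)) (𝓝[D.Ω t] x₀) (𝓝[closure (spaceTime D.Ω)] (x₀, t)) := by
    refine tendsto_nhdsWithin_iff.2 ⟨?_, ?_⟩
    · exact (Continuous.tendsto (by fun_prop) _).mono_left nhdsWithin_le_nhds
    · filter_upwards [self_mem_nhdsWithin] with y hy
      exact subset_closure hy
  refine (hg.continuousWithinAt.tendsto.comp h1).congr' ?_
  have h2 : ∀ᶠ y : E3 in 𝓝[D.Ω t] x₀, (y, t) ∈ V :=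
    mem_nhdsWithin_of_mem_nhds ((hV.preimage (by fun_prop)).mem_nhds hpV)
  filter_upwards [h2, self_mem_nhdsWithin] with y hyV hy
  exact (hgV (y, t) ⟨hyV, hy⟩).fderiv.symm

/-- The derivatives of φ and ψ have boundary limits, and the chain rule identity persists in the
limit, giving the limit for ψ a left inverse. -/
theorem exists_fderiv_ψ_limit_injective {y₀ : E3} (t : ℝ) (hy₀ : y₀ ∈ closure D.Ωref) :
    ∃ L : E3 →L[ℝ] E3, Function.Injective L ∧
      Tendsto (fun y => fderiv ℝ (fun y => D.ψ y t) y) (𝓝[D.Ωref] y₀) (𝓝 L) := by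
  obtain ⟨L, hL⟩ := D.exists_fderiv_ψ_limit t hy₀
  obtain ⟨L', hL'⟩ := D.exists_fderiv_φ_limit (D.ψ_mem_closure t hy₀)
  have h1 : Tendsto (fun y => D.ψ y t) (𝓝[D.Ωref] y₀) (𝓝[D.Ω t] (D.ψ y₀ t)) := by
    refine tendsto_nhdsWithin_iff.2 ⟨?_, ?_⟩
    · exact ((D.ψ_continuousOn t).continuousWithinAt hy₀).mono subset_closure
    · filter_upwards [self_mem_nhdsWithin] with y hy using D.ψ_mem t hy
  have h2 : Tendsto (fun y => (fderiv ℝ (fun x => D.φ x t) (D.ψ y t)).comp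
      (fderiv ℝ (fun y => D.ψ y t) y)) (𝓝[D.Ωref] y₀) (𝓝 (L'.comp L)) :=
    tendsto_clm_comp (hL'.comp h1) hL
  have : (𝓝[D.Ωref] y₀).NeBot := mem_closure_iff_nhdsWithin_neBot.1 hy₀
  have h3 : L'.comp L = ContinuousLinearMap.id ℝ E3 := by
    refine tendsto_nhds_unique h2 (tendsto_const_nhds.congr' ?_)
    filter_upwards [self_mem_nhdsWithin] with y hy
    exact (D.fderiv_φ_comp_fderiv_ψ t hy).symm
  refine ⟨L, fun a b hab => ?_, hL⟩
  have ha := congrArg (fun M : E3 →L[ℝ] E3 => M a) h3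
  have hb' := congrArg (fun M : E3 →L[ℝ] E3 => M b) h3
  simp only [ContinuousLinearMap.comp_apply, ContinuousLinearMap.id_apply] at ha hb'
  rw [← ha, ← hb', hab]

end Family

theorem chart_fderiv_surjective {e : OpenPartialHomeomorph E3 E3} {x : E3} (hx : x ∈ e.source)
    (he : ContDiffOn ℝ ∞ e e.source) (he' : ContDiffOn ℝ ∞ e.symm e.target) :
    Function.Surjective (fderiv ℝ e x) := by
  have h1 := ((he.contDiffAt (e.open_source.mem_nhds hx)).differentiableAt (by simp)).hasFDerivAt
  have hex : e x ∈ e.target := e.map_source hx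
  have h2 := ((he'.contDiffAt (e.open_target.mem_nhds hex)).differentiableAt (by simp)).hasFDerivAt
  rw [← e.left_inv hx] at h1
  have h3 := h1.comp (e x) h2
  have h4 : HasFDerivAt (e ∘ e.symm) (ContinuousLinearMap.id ℝ E3) (e x) := by
    refine (hasFDerivAt_id _).congr_of_eventuallyEq ?_
    filter_upwards [e.open_target.mem_nhds hex] with z hz
    exact e.right_inv hz
  have h5 := h3.unique h4
  rw [e.left_inv hx] at h5
  intro v
  exact ⟨fderiv ℝ e.symm (e x) v, congrArg (fun M : E3 →L[ℝ] E3 => M v) h5⟩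

namespace Family

variable (D : Family)

/-- The defining function is the first coordinate of a boundary chart of Ω(0) composed with ψ at
time 0. Its gradient has a limit at y₀ that is nonzero because both factors are invertible. -/
theorem nonempty_localDefining {y₀ : E3} (hy₀ : y₀ ∈ frontier D.Ωref) :
    Nonempty (LocalDefining D.Ωref y₀) := by
  have hy₀c : y₀ ∈ closure D.Ωref := frontier_subset_closure hy₀
  have hx₀ := D.ψ_mem_frontier 0 hy₀
  set ψ : E3 → E3 := fun y => D.ψ y 0 with hψ
  obtain ⟨e, hxe, he, he', hside⟩ := (D.domain 0).smoothBoundary _ hx₀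
  obtain ⟨L, hLinj, hL⟩ := D.exists_fderiv_ψ_limit_injective 0 hy₀c
  have hLsurj : Function.Surjective L := (LinearMap.injective_iff_surjective (f := L.toLinearMap)).1 hLinj
  set π : E3 →L[ℝ] ℝ := EuclideanSpace.proj (0 : Fin 3) with hπ
  set Λ : E3 →L[ℝ] ℝ := π.comp ((fderiv ℝ e (ψ y₀)).comp L) with hΛ
  -- The limiting slope is normalized to 2 so that the slope exceeds c = 1 nearby.
  obtain ⟨z₀, hz₀⟩ : ∃ z₀, Λ z₀ = 2 := by
    obtain ⟨v, hv⟩ := chart_fderiv_surjective hxe he he' (EuclideanSpace.single 0 2)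
    obtain ⟨z, hz⟩ := hLsurj v
    refine ⟨z, ?_⟩
    simp only [hΛ, ContinuousLinearMap.comp_apply]
    rw [hz, hv]
    simp [hπ]
  set h : E3 → ℝ := fun y => e (ψ y) 0 with hh
  have hcont : ContinuousWithinAt ψ (closure D.Ωref) y₀ := (D.ψ_continuousOn 0).continuousWithinAt hy₀c
  have hsrc : ∀ᶠ y in 𝓝[closure D.Ωref] y₀, ψ y ∈ e.source :=
    hcont.eventually (e.open_source.mem_nhds hxe)
  have hder : ∀ y ∈ D.Ωref, ψ y ∈ e.source → HasFDerivAt h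
      (π.comp ((fderiv ℝ e (ψ y)).comp (fderiv ℝ ψ y))) y := by
    intro y hy hys
    have h1 := ((he.contDiffAt (e.open_source.mem_nhds hys)).differentiableAt (by simp)).hasFDerivAt
    exact π.hasFDerivAt.comp y (h1.comp y (D.ψ_differentiableAt 0 hy).hasFDerivAt)
  have hlim : Tendsto (fderiv ℝ h) (𝓝[D.Ωref] y₀) (𝓝 Λ) := by
    have h1 : Tendsto (fun y => fderiv ℝ e (ψ y)) (𝓝[D.Ωref] y₀) (𝓝 (fderiv ℝ e (ψ y₀))) := by
      have h2 : ContinuousAt (fderiv ℝ e) (ψ y₀) :=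
        (he.continuousOn_fderiv_of_isOpen e.open_source (by simp)).continuousAt
          (e.open_source.mem_nhds hxe)
      exact h2.tendsto.comp (hcont.mono subset_closure)
    have h3 : Tendsto (fun y => π.comp ((fderiv ℝ e (ψ y)).comp (fderiv ℝ ψ y)))
        (𝓝[D.Ωref] y₀) (𝓝 Λ) :=
      tendsto_clm_comp tendsto_const_nhds (tendsto_clm_comp h1 hL)
    refine h3.congr' ?_
    filter_upwards [self_mem_nhdsWithin, nhdsWithin_mono _ subset_closure hsrc] with y hy hys
    exact (hder y hy hys).fderiv.symm
  have hb1 : ∀ᶠ y in 𝓝[D.Ωref] y₀, ‖fderiv ℝ h y‖ < ‖Λ‖ + 1 :=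
    hlim.norm.eventually_lt_const (lt_add_one _)
  have hb2 : ∀ᶠ y in 𝓝[D.Ωref] y₀, 1 < fderiv ℝ h y z₀ := by
    have : Tendsto (fun y => fderiv ℝ h y z₀) (𝓝[D.Ωref] y₀) (𝓝 (Λ z₀)) :=
      ((ContinuousLinearMap.apply ℝ ℝ z₀).continuous.tendsto Λ).comp hlim
    rw [hz₀] at this
    exact this.eventually_const_lt one_lt_two
  obtain ⟨R₁, hR₁, hsub₁⟩ := Metric.mem_nhdsWithin_iff.1 hsrc
  obtain ⟨R₂, hR₂, hsub₂⟩ := Metric.mem_nhdsWithin_iff.1 (hb1.and hb2)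
  have hS : ∀ y ∈ closure D.Ωref ∩ ball y₀ (min R₁ R₂), ψ y ∈ e.source := fun y hy =>
    hsub₁ ⟨ball_subset_ball (min_le_left _ _) hy.2, hy.1⟩
  have hB : ∀ y ∈ D.Ωref ∩ ball y₀ (min R₁ R₂), ‖fderiv ℝ h y‖ < ‖Λ‖ + 1 ∧ 1 < fderiv ℝ h y z₀ :=
    fun y hy => hsub₂ ⟨ball_subset_ball (min_le_right _ _) hy.2, hy.1⟩
  have hcl : ∀ y ∈ D.Ωref ∩ ball y₀ (min R₁ R₂), ψ y ∈ e.source := fun y hy =>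
    hS y ⟨subset_closure hy.1, hy.2⟩
  have hhc : ContinuousOn h (closure D.Ωref ∩ ball y₀ (min R₁ R₂)) := by
    have : ContinuousOn (fun y => e (ψ y)) (closure D.Ωref ∩ ball y₀ (min R₁ R₂)) :=
      e.continuousOn.comp ((D.ψ_continuousOn 0).mono inter_subset_left) hS
    exact π.continuous.comp_continuousOn this
  have hpos : ∀ y ∈ D.Ωref ∩ ball y₀ (min R₁ R₂), 0 < h y := fun y hy =>
    (hside _ (hcl y hy)).1 (D.ψ_mem 0 hy.1)
  refine ⟨⟨min R₁ R₂, lt_min hR₁ hR₂, h, z₀, 1, one_pos, ‖Λ‖ + 1, by positivity, hhc, ?_, hpos, ?_,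
    fun y hy => (hB y hy).1.le, fun y hy => (hB y hy).2.le⟩⟩
  · intro y hy
    have h1 : ContDiffAt ℝ ∞ (fun y => e (ψ y)) y :=
      (he.contDiffAt (e.open_source.mem_nhds (hcl y hy))).comp y (D.ψ_contDiffAt 0 hy.1)
    exact (π.contDiff.contDiffAt.comp y h1).of_le (by simp)
  · intro y hy
    have hyc : y ∈ closure D.Ωref ∩ ball y₀ (min R₁ R₂) := ⟨frontier_subset_closure hy.1, hy.2⟩
    refine le_antisymm ?_ ?_
    · have h1 := D.ψ_mem_frontier 0 hy.1
      rw [(D.domain 0).isOpen.frontier_eq] at h1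
      by_contra hcon
      exact h1.2 ((hside _ (hS y hyc)).2 (not_le.1 hcon))
    · have h1 : y ∈ closure (D.Ωref ∩ ball y₀ (min R₁ R₂)) := by
        rw [inter_comm]
        exact isOpen_ball.inter_closure ⟨hyc.2, hyc.1⟩
      have h2 : ContinuousWithinAt h (D.Ωref ∩ ball y₀ (min R₁ R₂)) y :=
        (hhc y hyc).mono (inter_subset_inter_left _ subset_closure)
      have h3 := h2.mem_closure h1 (t := Ici 0) fun z hz => (hpos z hz).le
      rwa [isClosed_Ici.closure_eq] at h3

theorem hasCone_ref : HasCone D.Ωref :=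
  hasCone_of_localDefining D.isOpen_ref fun _ hy => D.nonempty_localDefining hy

end Family

/-! ### Bounds for the coefficients -/

theorem measurable_pd (j : Fin 3) (f : E3 → ℝ) : Measurable (pd j f) :=
  measurable_fderiv_apply_const ℝ f _

theorem pd_component {f : E3 → E3} {y : E3} (hf : DifferentiableAt ℝ f y) (i k : Fin 3) :
    pd i (fun z => f z k) y = fderiv ℝ f y (EuclideanSpace.single i 1) k := by
  have h := ((EuclideanSpace.proj k : E3 →L[ℝ] ℝ).hasFDerivAt.comp y hf.hasFDerivAt).fderiv
  have h' : fderiv ℝ (fun z => f z k) y = (EuclideanSpace.proj k : E3 →L[ℝ] ℝ).comp (fderiv ℝ f y) := h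
  rw [pd, h']
  rfl

theorem abs_pd_component_le {f : E3 → E3} {y : E3} (hf : DifferentiableAt ℝ f y) (i k : Fin 3) :
    |pd i (fun z => f z k) y| ≤ ‖fderiv ℝ f y‖ := by
  rw [pd_component hf]
  refine (abs_apply_le_norm _ _).trans ?_
  refine ((fderiv ℝ f y).le_opNorm _).trans ?_
  simp

theorem abs_sum_fin_three_le {f : Fin 3 → ℝ} {C : ℝ} (h : ∀ i, |f i| ≤ C) : |∑ i, f i| ≤ 3 * C := by
  refine (Finset.abs_sum_le_sum_abs _ _).trans ?_
  refine (Finset.sum_le_sum fun i _ => h i).trans ?_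
  simp

theorem abs_mul_le_mul {a b A B : ℝ} (ha : |a| ≤ A) (hb : |b| ≤ B) : |a * b| ≤ A * B := by
  rw [abs_mul]
  exact mul_le_mul ha hb (abs_nonneg _) ((abs_nonneg _).trans ha)

namespace Family

variable (D : Family)

theorem dx_eventuallyEq {y : E3} (t : ℝ) (hy : y ∈ D.Ωref) (k i : Fin 3) :
    D.dx t k i =ᶠ[𝓝 y] fun z => fderiv ℝ (fun y => D.ψ y t) z (EuclideanSpace.single i 1) k := by
  filter_upwards [D.isOpen_ref.mem_nhds hy] with z hz
  exact pd_component (D.ψ_differentiableAt t hz) i k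

theorem fderiv_ψ_differentiableAt {y : E3} (t : ℝ) (hy : y ∈ D.Ωref) :
    DifferentiableAt ℝ (fderiv ℝ fun y => D.ψ y t) y :=
  ((D.ψ_contDiffAt t hy).fderiv_right (m := 1) (by norm_cast)).differentiableAt one_ne_zero

theorem hasFDerivAt_dx {y : E3} (t : ℝ) (hy : y ∈ D.Ωref) (k i : Fin 3) :
    HasFDerivAt (D.dx t k i) (((EuclideanSpace.proj k : E3 →L[ℝ] ℝ).comp
      (ContinuousLinearMap.apply ℝ E3 (EuclideanSpace.single i (1 : ℝ)))).comp
        (fderiv ℝ (fderiv ℝ fun y => D.ψ y t) y)) y := by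
  refine HasFDerivAt.congr_of_eventuallyEq ?_ (D.dx_eventuallyEq t hy k i)
  exact (((EuclideanSpace.proj k : E3 →L[ℝ] ℝ).comp
    (ContinuousLinearMap.apply ℝ E3 (EuclideanSpace.single i (1 : ℝ)))).hasFDerivAt).comp y
      (D.fderiv_ψ_differentiableAt t hy).hasFDerivAt

theorem abs_ddx_le {y : E3} (t : ℝ) (hy : y ∈ D.Ωref) (k i j : Fin 3) :
    |D.ddx t k i j y| ≤ ‖fderiv ℝ (fderiv ℝ fun y => D.ψ y t) y‖ := by
  have h : D.ddx t k i j y = fderiv ℝ (fderiv ℝ fun y => D.ψ y t) y (EuclideanSpace.single i 1)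
      (EuclideanSpace.single j 1) k := by
    rw [ddx, pd, show (fun z => D.dx t k j z) = D.dx t k j from rfl,
      (D.hasFDerivAt_dx t hy k j).fderiv]
    rfl
  rw [h]
  refine (abs_apply_le_norm _ _).trans ?_
  refine (ContinuousLinearMap.le_opNorm _ _).trans ?_
  refine (mul_le_mul_of_nonneg_right (ContinuousLinearMap.le_opNorm _ _) (norm_nonneg _)).trans ?_
  simp

theorem pd_gLow {y : E3} (t : ℝ) (hy : y ∈ D.Ωref) (l i j : Fin 3) :
    pd l (D.gLow t i j) y =
      ∑ k, (D.ddx t k l i y * D.dx t k j y + D.dx t k i y * D.ddx t k l j y) := by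
  have hd : ∀ k i, DifferentiableAt ℝ (D.dx t k i) y := fun k i =>
    (D.hasFDerivAt_dx t hy k i).differentiableAt
  have h1 : HasFDerivAt (D.gLow t i j) (∑ k, (D.dx t k i y • fderiv ℝ (D.dx t k j) y +
      D.dx t k j y • fderiv ℝ (D.dx t k i) y)) y :=
    HasFDerivAt.fun_sum fun k _ => (hd k i).hasFDerivAt.mul (hd k j).hasFDerivAt
  rw [pd, h1.fderiv]
  simp only [_root_.sum_apply, _root_.add_apply, _root_.smul_apply, smul_eq_mul]
  refine Finset.sum_congr rfl fun k _ => ?_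
  simp only [ddx, pd]
  ring

theorem dy_mul_dx {y : E3} (t : ℝ) (hy : y ∈ D.Ωref) :
    (Matrix.of fun i k => D.dy t i k y) * (Matrix.of fun k j => D.dx t k j y) = 1 := by
  ext i j
  have h := congrArg (fun M : E3 →L[ℝ] E3 => M (EuclideanSpace.single j 1) i)
    (D.fderiv_φ_comp_fderiv_ψ t hy)
  simp only [ContinuousLinearMap.comp_apply, ContinuousLinearMap.id_apply] at h
  have h2 := clm_apply_eq_sum ((EuclideanSpace.proj i : E3 →L[ℝ] ℝ).comp
    (fderiv ℝ (fun x => D.φ x t) (D.ψ y t)))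
    (fderiv ℝ (fun y => D.ψ y t) y (EuclideanSpace.single j 1))
  replace h2 := h2.symm.trans h
  rw [Matrix.mul_apply]
  simp only [Matrix.of_apply]
  have h3 : ∀ k, D.dy t i k y * D.dx t k j y =
      (fderiv ℝ (fun y => D.ψ y t) y (EuclideanSpace.single j 1)) k *
        (fderiv ℝ (fun x => D.φ x t) (D.ψ y t) (EuclideanSpace.single k 1)) i := by
    intro k
    rw [dy, dx, pd_component (D.φ_differentiableAt (D.ψ_mem t hy)),
      pd_component (D.ψ_differentiableAt t hy), mul_comm]
  simp only [h3, Matrix.one_apply]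
  refine h2.trans ?_
  simp

/-- No continuity of J in time is assumed; this identity, used at a single point of the reference
domain, is what bounds J on [0,T]. -/
theorem J_eq_det {y : E3} (t : ℝ) (hy : y ∈ D.Ωref) :
    D.J t = Matrix.det (Matrix.of fun k j => D.dx t k j y) := by
  have h1 := congrArg Matrix.det (D.dy_mul_dx t hy)
  rw [Matrix.det_mul, Matrix.det_one] at h1
  have h2 : Matrix.det (Matrix.of fun i k => D.dy t i k y) = (D.J t)⁻¹ :=
    D.det_eq t _ (D.ψ_mem t hy)
  rw [h2, inv_mul_eq_one₀ (D.J_pos t).ne'] at h1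
  exact h1

/-- The closed reference cylinder over [0,T] is compact, and so is its image in the closed moving
domain, which is where the derivatives of φ are evaluated. -/
theorem exists_derivative_bound (T : ℝ) : ∃ K : ℝ, 0 ≤ K ∧ ∀ t ∈ Icc (0 : ℝ) T, ∀ y ∈ D.Ωref,
    (∀ k i, |D.dx t k i y| ≤ K) ∧ (∀ k i j, |D.ddx t k i j y| ≤ K) ∧ ∀ i k, |D.dy t i k y| ≤ K := by
  have hKc : IsCompact (closure D.Ωref ×ˢ Icc (0 : ℝ) T) :=
    D.isBounded_ref.isCompact_closure.prod isCompact_Icc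
  have hKs : closure D.Ωref ×ˢ Icc (0 : ℝ) T ⊆ closure (D.Ωref ×ˢ (univ : Set ℝ)) := by
    rw [closure_ref_prod]
    exact prod_mono le_rfl (subset_univ _)
  obtain ⟨C, hC⟩ := exists_slice_bound D.ref_slice_isOpen D.ψ_smooth hKc hKs
  have hΨ : ContinuousOn (fun p : E3 × ℝ => (D.ψ p.1 p.2, p.2)) (closure D.Ωref ×ˢ Icc (0 : ℝ) T) :=
    (D.ψ_smooth.continuousOn.mono hKs).prodMk continuousOn_snd
  have hLs : (fun p : E3 × ℝ => (D.ψ p.1 p.2, p.2)) '' (closure D.Ωref ×ˢ Icc (0 : ℝ) T) ⊆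
      closure (spaceTime D.Ω) := by
    rintro _ ⟨p, hp, rfl⟩
    exact D.ψ_mapsTo p.1 p.2 (hKs hp)
  obtain ⟨C', hC'⟩ := exists_slice_bound D.spaceTime_slice_isOpen D.φ_smooth
    (hKc.image_of_continuousOn hΨ) hLs
  refine ⟨max 0 (max C C'), le_max_left _ _, fun t ht y hy => ?_⟩
  have h1 := hC (y, t) ⟨⟨subset_closure hy, ht⟩, hy, mem_univ _⟩
  have h2 := hC' (D.ψ y t, t) ⟨⟨(y, t), ⟨subset_closure hy, ht⟩, rfl⟩, D.ψ_mem t hy⟩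
  have hCm : C ≤ max 0 (max C C') := (le_max_left _ _).trans (le_max_right _ _)
  have hCm' : C' ≤ max 0 (max C C') := (le_max_right _ _).trans (le_max_right _ _)
  refine ⟨fun k i => ?_, fun k i j => ?_, fun i k => ?_⟩
  · exact (abs_pd_component_le (D.ψ_differentiableAt t hy) i k).trans (h1.1.trans hCm)
  · exact (D.abs_ddx_le t hy k i j).trans (h1.2.trans hCm)
  · exact (abs_pd_component_le (D.φ_differentiableAt (D.ψ_mem t hy)) k i).trans (h2.1.trans hCm')

theorem exists_coeff_bound (T : ℝ) : ∃ M : ℝ, 0 ≤ M ∧ ∀ t ∈ Icc (0 : ℝ) T,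
    |D.J t| ≤ M ∧ ∀ y ∈ D.Ωref, (∀ i j, |D.gLow t i j y| ≤ M) ∧ (∀ k i j, |D.Γ t k i j y| ≤ M) ∧
      (∀ i j k l, |D.R1 t i j k l y| ≤ M) ∧ ∀ i j k l, |D.R2 t i j k l y| ≤ M := by
  obtain ⟨K, hK, hb⟩ := D.exists_derivative_bound T
  -- The four thresholds serve, in order, the metric, the Christoffel symbols, the coefficients of
  -- the rotation, and J as a 3×3 determinant (3! products of three entries).
  obtain ⟨M, m1, m2, m3, m4⟩ : ∃ M : ℝ, 3 * (K * K) ≤ M ∧ 1 / 2 * (3 * ((3 * (K * K)) *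
      (3 * (K * K + K * K) + 3 * (K * K + K * K) + 3 * (K * K + K * K)))) ≤ M ∧
      K * (K * K + K * K) ≤ M ∧ 6 * K ^ 3 ≤ M :=
    ⟨max _ (max _ (max _ _)), le_max_left _ _, le_max_of_le_right (le_max_left _ _),
      le_max_of_le_right (le_max_of_le_right (le_max_left _ _)),
      le_max_of_le_right (le_max_of_le_right (le_max_right _ _))⟩
  have hM0 : 0 ≤ M := le_trans (by positivity) m1
  refine ⟨M, hM0, fun t ht => ⟨?_, fun y hy => ?_⟩⟩
  · obtain ⟨y, hy⟩ := D.ref_nonempty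
    refine le_trans ?_ m4
    rw [D.J_eq_det t hy]
    have := Matrix.det_le (abv := AbsoluteValue.abs) (A := Matrix.of fun k j => D.dx t k j y)
      (x := K) fun i j => (hb t ht y hy).1 i j
    refine this.trans_eq ?_
    simp [Nat.factorial]
  · obtain ⟨h1, h2, h3⟩ := hb t ht y hy
    have hup : ∀ i j, |D.gUp t i j y| ≤ 3 * (K * K) := fun i j =>
      abs_sum_fin_three_le fun k => abs_mul_le_mul (h3 i k) (h3 j k)
    have hpd : ∀ l i j, |pd l (D.gLow t i j) y| ≤ 3 * (K * K + K * K) := fun l i j => by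
      rw [D.pd_gLow t hy]
      exact abs_sum_fin_three_le fun k => (abs_add_le _ _).trans
        (add_le_add (abs_mul_le_mul (h2 k l i) (h1 k j)) (abs_mul_le_mul (h1 k i) (h2 k l j)))
    refine ⟨fun i j => ?_, fun k i j => ?_, fun i j k l => ?_, fun i j k l => ?_⟩
    · exact (abs_sum_fin_three_le fun k => abs_mul_le_mul (h1 k i) (h1 k j)).trans m1
    · refine le_trans ?_ m2
      refine abs_mul_le_mul (by norm_num [abs_of_pos]) (abs_sum_fin_three_le fun l =>
        abs_mul_le_mul (hup k l) ?_)
      refine (abs_sub _ _).trans ?_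
      exact add_le_add ((abs_add_le _ _).trans (add_le_add (hpd _ _ _) (hpd _ _ _))) (hpd _ _ _)
    · refine le_trans (abs_mul_le_mul (h3 i j) ?_) m3
      exact (abs_sub _ _).trans
        (add_le_add (abs_mul_le_mul (h3 _ _) (h2 _ _ _)) (abs_mul_le_mul (h3 _ _) (h2 _ _ _)))
    · refine le_trans (abs_mul_le_mul (h3 i j) ?_) m3
      exact (abs_sub _ _).trans
        (add_le_add (abs_mul_le_mul (h3 _ _) (h1 _ _)) (abs_mul_le_mul (h3 _ _) (h1 _ _)))

/-! ### Measurability of the coefficients -/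

theorem measurable_dx (t : ℝ) (k i : Fin 3) : Measurable (D.dx t k i) := measurable_pd _ _

theorem measurable_ddx (t : ℝ) (k i j : Fin 3) : Measurable (D.ddx t k i j) := measurable_pd _ _

theorem aemeasurable_dy (t : ℝ) (i k : Fin 3) :
    AEMeasurable (D.dy t i k) (volume.restrict D.Ωref) :=
  (measurable_pd k fun x => D.φ x t i).comp_aemeasurable
    (((D.ψ_continuousOn t).mono subset_closure).aemeasurable D.isOpen_ref.measurableSet)

theorem measurable_gLow (t : ℝ) (i j : Fin 3) : Measurable (D.gLow t i j) :=
  Finset.measurable_fun_sum _ fun k _ => (D.measurable_dx t k i).mul (D.measurable_dx t k j)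

theorem aemeasurable_gUp (t : ℝ) (i j : Fin 3) :
    AEMeasurable (D.gUp t i j) (volume.restrict D.Ωref) :=
  Finset.aemeasurable_fun_sum _ fun k _ => (D.aemeasurable_dy t i k).mul (D.aemeasurable_dy t j k)

theorem aemeasurable_Γ (t : ℝ) (k i j : Fin 3) :
    AEMeasurable (D.Γ t k i j) (volume.restrict D.Ωref) :=
  (Finset.aemeasurable_fun_sum _ fun l _ => (D.aemeasurable_gUp t k l).mul
    (((measurable_pd j (D.gLow t i l)).add (measurable_pd i (D.gLow t j l))).sub
      (measurable_pd l (D.gLow t i j))).aemeasurable).const_mul _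

theorem aemeasurable_R1 (t : ℝ) (i j k l : Fin 3) :
    AEMeasurable (D.R1 t i j k l) (volume.restrict D.Ωref) :=
  (D.aemeasurable_dy t i j).mul
    (((D.aemeasurable_dy t k (j + 1)).mul (D.measurable_ddx t (j + 2) k l).aemeasurable).sub
      ((D.aemeasurable_dy t k (j + 2)).mul (D.measurable_ddx t (j + 1) k l).aemeasurable))

theorem aemeasurable_R2 (t : ℝ) (i j k l : Fin 3) :
    AEMeasurable (D.R2 t i j k l) (volume.restrict D.Ωref) :=
  (D.aemeasurable_dy t i j).mul
    (((D.aemeasurable_dy t k (j + 1)).mul (D.measurable_dx t (j + 2) l).aemeasurable).sub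
      ((D.aemeasurable_dy t k (j + 2)).mul (D.measurable_dx t (j + 1) l).aemeasurable))

end Family

/-! ### Inequalities for solenoidal fields vanishing on the boundary -/

/-- Uniqueness of weak derivatives. It links the derivative component stored in an element of H¹
with the classical derivative of a test field. -/
theorem IsWeakPartial.ae_eq_pd {U : Set E3} (hU : IsOpen U) (hb : Bornology.IsBounded U)
    {j : Fin 3} {f g : L2 U} (h : IsWeakPartial U j f g) {v : E3 → ℝ} (hv : ContDiff ℝ ∞ v)
    (hc : HasCompactSupport v) (hfv : f =ᵐ[volume.restrict U] v) :
    g =ᵐ[volume.restrict U] pd j v := by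
  have : IsFiniteMeasure (volume.restrict U) := ⟨by
    rw [Measure.restrict_apply_univ]; exact hb.measure_lt_top⟩
  have hi : Integrable (fun y => g y - pd j v y) (volume.restrict U) :=
    ((Lp.memLp g).integrable (by norm_num)).sub ((memLp_pd_test j hv hc).integrable (by norm_num))
  have hli : LocallyIntegrableOn (fun y => g y - pd j v y) U volume :=
    IntegrableOn.locallyIntegrableOn hi
  have key := hU.ae_eq_zero_of_integral_contDiff_smul_eq_zero hli ?_
  · refine (ae_restrict_iff' hU.measurableSet).2 ?_
    filter_upwards [key] with y hy hyU
    exact sub_eq_zero.1 (hy hyU)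
  intro η hη hηc hηs
  have hout : ∀ y, y ∉ U → η y = 0 := fun y hy => image_eq_zero_of_notMem_tsupport fun h => hy (hηs h)
  have hout' : ∀ y, y ∉ U → pd j η y = 0 := fun y hy => by
    rw [pd, (notMem_tsupport_iff_eventuallyEq.1 fun h => hy (hηs h)).fderiv_eq]
    simp
  have hη2 : MemLp η 2 (volume.restrict U) := memLp_test hη.continuous hηc
  have i1 : Integrable (fun y => g y * η y) (volume.restrict U) := (Lp.memLp g).integrable_mul hη2
  have i2 : Integrable (fun y => pd j v y * η y) (volume.restrict U) :=
    (memLp_pd_test j hv hc).integrable_mul hη2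
  have i3 : Integrable (fun y => v y * pd j η y) (volume.restrict U) :=
    (memLp_test hv.continuous hc).integrable_mul (memLp_pd_test j hη hηc)
  rw [← setIntegral_eq_integral_of_forall_compl_eq_zero (s := U) fun y hy => by simp [hout y hy]]
  have e1 : ∫ y in U, f y * pd j η y = ∫ y in U, v y * pd j η y := by
    refine integral_congr_ae ?_
    filter_upwards [hfv] with y hy
    rw [hy]
  have e2 : ∫ y in U, (v y * pd j η y + pd j v y * η y) = 0 := by
    rw [setIntegral_eq_integral_of_forall_compl_eq_zero (s := U) fun y hy => by
      simp [hout y hy, hout' y hy]]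
    have h1 : ∀ y, v y * pd j η y + pd j v y * η y =
        fderiv ℝ (fun y => v y * η y) y (EuclideanSpace.single j 1) := by
      intro y
      have h2 := ((hv.differentiable (by simp) y).hasFDerivAt.mul
        (hη.differentiable (by simp) y).hasFDerivAt).fderiv
      have h3 : fderiv ℝ (fun y => v y * η y) y = v y • fderiv ℝ η y + η y • fderiv ℝ v y := h2
      rw [h3]
      simp [pd, mul_comm]
    simp only [h1]
    exact integral_fderiv_apply_eq_zero ((hv.mul hη).of_le (by simp)) hc.mul_right _
  rw [integral_add i3 i2] at e2
  have h0 := h η hη hηc hηs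
  have e3 : ∫ y in U, η y • (g y - pd j v y) =
      (∫ y in U, g y * η y) - ∫ y in U, pd j v y * η y := by
    rw [← integral_sub i1 i2]
    refine integral_congr_ae (ae_of_all _ fun y => ?_)
    simp only [smul_eq_mul]
    ring
  rw [e3]
  linarith

theorem enorm_Lp_sq {U : Set E3} (f : L2 U) :
    ENNReal.ofReal (‖f‖ ^ 2) = ∫⁻ y in U, ‖f y‖ₑ ^ (2 : ℝ) := by
  have h := eLpNorm_nnreal_pow_eq_lintegral (f := f) (μ := volume.restrict U) (p := 2) (by norm_num)
  simp only [NNReal.coe_ofNat] at h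
  rw [← h, ENNReal.ofReal_pow (norm_nonneg _), ENNReal.rpow_two, ofReal_norm,
    Lp.enorm_def]
  rfl

theorem enorm_clm_le_sum (L : E3 →L[ℝ] ℝ) :
    ‖L‖ₑ ≤ ∑ j, ‖L (EuclideanSpace.single j 1)‖ₑ := by
  simp only [← ofReal_norm]
  rw [← ENNReal.ofReal_sum_of_nonneg fun j _ => norm_nonneg _]
  refine ENNReal.ofReal_le_ofReal ?_
  refine L.opNorm_le_bound (Finset.sum_nonneg fun j _ => norm_nonneg _) fun z => ?_
  rw [clm_apply_eq_sum, Finset.sum_mul]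
  refine (norm_sum_le _ _).trans (Finset.sum_le_sum fun j _ => ?_)
  rw [norm_mul, mul_comm]
  exact mul_le_mul_of_nonneg_left (abs_apply_le_norm z j) (norm_nonneg _)

theorem sum_rpow_le (f : Fin 3 → ℝ≥0∞) {p : ℝ} (hp : 1 ≤ p) :
    (∑ j, f j) ^ p ≤ (3 : ℝ≥0∞) ^ (p - 1) * ∑ j, f j ^ p := by
  have := ENNReal.rpow_sum_le_const_mul_sum_rpow (Finset.univ : Finset (Fin 3)) f hp
  simpa using this

theorem VH1.gradNormSq_nonneg {U : Set E3} (u : VH1 U) : 0 ≤ u.gradNormSq :=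
  Finset.sum_nonneg fun _ _ => Finset.sum_nonneg fun _ _ => by positivity

theorem VH1.continuous_gradNormSq {U : Set E3} : Continuous (VH1.gradNormSq (U := U)) := by
  unfold VH1.gradNormSq
  refine continuous_finsetSum _ fun i _ => continuous_finsetSum _ fun j _ => ?_
  have h1 : Continuous fun u : VH1 U => (u i).1.2 j :=
    (continuous_apply j).comp (continuous_snd.comp (continuous_subtype_val.comp (continuous_apply i)))
  exact h1.norm.pow 2

theorem VH1.lintegral_wd_le {U : Set E3} (u : VH1 U) (i j : Fin 3) :
    ∫⁻ y in U, ‖u.wd i j y‖ₑ ^ (2 : ℝ) ≤ ENNReal.ofReal u.gradNormSq := by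
  have h := enorm_Lp_sq ((u i).1.2 j)
  rw [show (fun y => ‖u.wd i j y‖ₑ ^ (2 : ℝ)) = fun y => ‖((u i).1.2 j) y‖ₑ ^ (2 : ℝ) from rfl, ← h]
  refine ENNReal.ofReal_le_ofReal ?_
  refine le_trans ?_ (Finset.single_le_sum (f := fun i => ∑ j, ‖(u i).1.2 j‖ ^ 2)
    (fun i _ => Finset.sum_nonneg fun j _ => by positivity) (Finset.mem_univ i))
  exact Finset.single_le_sum (f := fun j => ‖(u i).1.2 j‖ ^ 2) (fun j _ => by positivity)
    (Finset.mem_univ j)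

/-- The components of a test field and the `L²`-norms of their gradients. -/
theorem testSolenoidal_component {U : Set E3} (hU : IsOpen U) (hb : Bornology.IsBounded U)
    {u : VH1 U} (hu : u ∈ testSolenoidal U) (i : Fin 3) :
    ∃ v : E3 → ℝ, ContDiff ℝ 1 v ∧ HasCompactSupport v ∧ tsupport v ⊆ U ∧
      u.val i =ᵐ[volume.restrict U] v ∧
      ∫⁻ y, ‖fderiv ℝ v y‖ₑ ^ (2 : ℝ) ≤ 9 * ENNReal.ofReal u.gradNormSq := by
  obtain ⟨V, hV, hVc, hVs, -, hVu⟩ := hu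
  have hv : ContDiff ℝ ∞ fun y => V y i :=
    (EuclideanSpace.proj i : E3 →L[ℝ] ℝ).contDiff.comp hV
  have hc : HasCompactSupport fun y => V y i := hVc.comp_left (g := fun x : E3 => x i) rfl
  have hs : tsupport (fun y => V y i) ⊆ U := (tsupport_comp_subset (g := fun x : E3 => x i) rfl V).trans hVs
  refine ⟨fun y => V y i, hv.of_le (by simp), hc, hs, hVu i, ?_⟩
  have hwd : ∀ j, u.wd i j =ᵐ[volume.restrict U] pd j fun y => V y i := fun j =>
    ((u i).2 j).ae_eq_pd hU hb hv hc (hVu i)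
  have hsupp : ∫⁻ y, ‖fderiv ℝ (fun y => V y i) y‖ₑ ^ (2 : ℝ) =
      ∫⁻ y in U, ‖fderiv ℝ (fun y => V y i) y‖ₑ ^ (2 : ℝ) := by
    rw [← lintegral_indicator hU.measurableSet]
    refine lintegral_congr fun y => ?_
    by_cases hy : y ∈ U
    · rw [indicator_of_mem hy]
    · rw [indicator_of_notMem hy,
        (notMem_tsupport_iff_eventuallyEq.1 fun h => hy (hs h)).fderiv_eq]
      have h0 : ‖fderiv ℝ (0 : E3 → ℝ) y‖ₑ = 0 := by
        rw [show fderiv ℝ (0 : E3 → ℝ) y = 0 by simp, ← ofReal_norm, norm_zero, ENNReal.ofReal_zero]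
      rw [h0, ENNReal.zero_rpow_of_pos two_pos]
  rw [hsupp]
  have hm : ∀ j, Measurable fun y => ‖pd j (fun y => V y i) y‖ₑ ^ (2 : ℝ) := fun j =>
    (measurable_pd j _).enorm.pow_const _
  calc ∫⁻ y in U, ‖fderiv ℝ (fun y => V y i) y‖ₑ ^ (2 : ℝ)
      ≤ ∫⁻ y in U, (3 : ℝ≥0∞) ^ ((2 : ℝ) - 1) * ∑ j, ‖pd j (fun y => V y i) y‖ₑ ^ (2 : ℝ) := by
        refine lintegral_mono fun y => ?_
        refine (ENNReal.rpow_le_rpow (enorm_clm_le_sum _) (by norm_num)).trans ?_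
        exact sum_rpow_le _ (by norm_num)
    _ = 3 * ∑ j, ∫⁻ y in U, ‖pd j (fun y => V y i) y‖ₑ ^ (2 : ℝ) := by
        rw [lintegral_const_mul' _ _ (by finiteness), lintegral_finsetSum _ fun j _ => hm j]
        norm_num
    _ ≤ 3 * ∑ _j : Fin 3, ENNReal.ofReal u.gradNormSq := by
        gcongr with j
        refine le_trans (le_of_eq ?_) (u.lintegral_wd_le i j)
        refine lintegral_congr_ae ?_
        filter_upwards [hwd j] with y hy
        rw [hy]
    _ = _ := by
        simp only [Finset.sum_const, Finset.card_univ, Fintype.card_fin, nsmul_eq_mul]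
        rw [← mul_assoc]
        norm_num

/-! ### Passing from test fields to their closure -/

theorem lintegral_le_of_tendsto_L2 {U : Set E3} {fn : ℕ → L2 U} {f : L2 U}
    (hlim : Tendsto fn atTop (𝓝 f)) {m : E3 → ℝ} (hm : Measurable m) {p : ℝ}
    {G : ℕ → ℝ≥0∞} {G₀ : ℝ≥0∞} (hG : Tendsto G atTop (𝓝 G₀))
    (h : ∀ n, ∫⁻ y in U, ‖fn n y * m y‖ₑ ^ p ≤ G n) :
    ∫⁻ y in U, ‖f y * m y‖ₑ ^ p ≤ G₀ := by
  obtain ⟨ns, hns, hae⟩ := (tendstoInMeasure_of_tendsto_Lp hlim).exists_seq_tendsto_ae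
  have hmeas : ∀ n, Measurable fun y => ‖fn (ns n) y * m y‖ₑ ^ p := fun n =>
    ((Lp.stronglyMeasurable (fn (ns n))).measurable.mul hm).enorm.pow_const _
  calc ∫⁻ y in U, ‖f y * m y‖ₑ ^ p
      = ∫⁻ y in U, liminf (fun n => ‖fn (ns n) y * m y‖ₑ ^ p) atTop := by
        refine lintegral_congr_ae ?_
        filter_upwards [hae] with y hy
        have h1 : Tendsto (fun n => ‖fn (ns n) y * m y‖ₑ ^ p) atTop (𝓝 (‖f y * m y‖ₑ ^ p)) :=
          (ENNReal.continuous_rpow_const.tendsto _).comp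
            ((continuous_enorm.tendsto _).comp (hy.mul_const (m y)))
        exact h1.liminf_eq.symm
    _ ≤ liminf (fun n => ∫⁻ y in U, ‖fn (ns n) y * m y‖ₑ ^ p) atTop := lintegral_liminf_le hmeas
    _ ≤ liminf (fun n => G (ns n)) atTop := liminf_le_liminf (Eventually.of_forall fun n => h _)
    _ = G₀ := (hG.comp hns.tendsto_atTop).liminf_eq

theorem H10σ_lintegral_le {U : Set E3} {m : E3 → ℝ} (hm : Measurable m) {p q : ℝ}
    {C : ℝ≥0∞} (hC : C ≠ ⊤) (i : Fin 3)
    (h : ∀ u ∈ testSolenoidal U,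
      ∫⁻ y in U, ‖u.val i y * m y‖ₑ ^ p ≤ C * ENNReal.ofReal u.gradNormSq ^ q)
    {u : VH1 U} (hu : u ∈ H10σ U) :
    ∫⁻ y in U, ‖u.val i y * m y‖ₑ ^ p ≤ C * ENNReal.ofReal u.gradNormSq ^ q := by
  obtain ⟨un, hun, hlim⟩ := mem_closure_iff_seq_limit.1 hu
  have h1 : Tendsto (fun n => (un n i).1.1) atTop (𝓝 (u i).1.1) := by
    have : Continuous fun u : VH1 U => (u i).1.1 :=
      continuous_fst.comp (continuous_subtype_val.comp (continuous_apply i))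
    exact (this.tendsto u).comp hlim
  have h2 : Tendsto (fun n => C * ENNReal.ofReal (un n).gradNormSq ^ q) atTop
      (𝓝 (C * ENNReal.ofReal u.gradNormSq ^ q)) := by
    refine ENNReal.Tendsto.const_mul ?_ (Or.inr hC)
    refine (ENNReal.continuous_rpow_const.tendsto _).comp ?_
    exact (ENNReal.continuous_ofReal.tendsto _).comp ((VH1.continuous_gradNormSq.tendsto u).comp hlim)
  exact lintegral_le_of_tendsto_L2 h1 hm h2 fun n => h _ (hun n)

/-- Each inequality holds for test fields. Along an almost everywhere convergent subsequence, Fatou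
handles the left side, while the gradient norm on the right is continuous in H¹. -/
theorem exists_H10σ_bounds {U : Set E3} (hU : IsOpen U) (hb : Bornology.IsBounded U)
    (hfr : (frontier U).Nonempty) (hP : ∀ y ∈ frontier U, Nonempty (LocalDefining U y)) :
    ∃ C : ℝ≥0∞, C ≠ ⊤ ∧ ∀ u ∈ H10σ U, ∀ i,
      ∫⁻ y in U, ‖u.val i y / infDist y (frontier U)‖ₑ ^ (2 : ℝ) ≤
        C * ENNReal.ofReal u.gradNormSq ∧
      ∫⁻ y in U, ‖u.val i y‖ₑ ^ (6 : ℝ) ≤ C * ENNReal.ofReal u.gradNormSq ^ (3 : ℝ) ∧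
      ∫⁻ y in U, ‖u.val i y‖ₑ ^ (2 : ℝ) ≤ C * ENNReal.ofReal u.gradNormSq := by
  obtain ⟨C₁, hC₁, h₁⟩ := exists_hardy hU hb hfr hP
  obtain ⟨C₂, hC₂, h₂⟩ := exists_sobolev_six
  obtain ⟨C₃, hC₃, h₃⟩ := exists_poincare hb
  refine ⟨C₁ * 9 + C₂ * 9 ^ (3 : ℝ) + C₃ * 9, by finiteness, fun u hu i => ⟨?_, ?_, ?_⟩⟩
  · have hm : Measurable fun y => (infDist y (frontier U))⁻¹ :=
      (continuous_infDist_pt _).measurable.inv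
    have := H10σ_lintegral_le (C := C₁ * 9) (q := 1) hm (p := 2) (by finiteness) i
      (fun u hu => ?_) hu
    · simp only [div_eq_mul_inv]
      refine this.trans ?_
      rw [ENNReal.rpow_one]
      gcongr
      rw [add_assoc]
      exact le_self_add
    · obtain ⟨v, hv, hvc, hvs, huv, hg⟩ := testSolenoidal_component hU hb hu i
      rw [ENNReal.rpow_one, mul_assoc]
      refine le_trans ?_ ((h₁ v hv hvc hvs).trans (by gcongr))
      refine le_of_eq (lintegral_congr_ae ?_)
      filter_upwards [huv] with y hy
      rw [hy, div_eq_mul_inv]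
  · have := H10σ_lintegral_le (C := C₂ * 9 ^ (3 : ℝ)) (q := 3) (measurable_const (a := (1 : ℝ)))
      (p := 6) (by finiteness) i (fun u hu => ?_) hu
    · simp only [mul_one] at this
      refine this.trans ?_
      gcongr
      rw [add_right_comm]
      exact le_add_self
    · obtain ⟨v, hv, hvc, hvs, huv, hg⟩ := testSolenoidal_component hU hb hu i
      rw [mul_assoc, ← ENNReal.mul_rpow_of_nonneg _ _ (by norm_num)]
      refine le_trans ?_ ((h₂ v hv hvc).trans (by gcongr))
      refine le_trans (le_of_eq (lintegral_congr_ae ?_)) (setLIntegral_le_lintegral U _)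
      filter_upwards [huv] with y hy
      rw [hy, mul_one]
  · have := H10σ_lintegral_le (C := C₃ * 9) (q := 1) (measurable_const (a := (1 : ℝ)))
      (p := 2) (by finiteness) i (fun u hu => ?_) hu
    · simp only [mul_one] at this
      refine this.trans ?_
      rw [ENNReal.rpow_one]
      gcongr
      exact le_add_self
    · obtain ⟨v, hv, hvc, hvs, huv, hg⟩ := testSolenoidal_component hU hb hu i
      rw [ENNReal.rpow_one, mul_assoc]
      refine le_trans ?_ ((h₃ v hv hvs).trans (by gcongr))
      refine le_trans (le_of_eq (lintegral_congr_ae ?_)) (setLIntegral_le_lintegral U _)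
      filter_upwards [huv] with y hy
      rw [hy, mul_one]

/-- By the Poincaré bound a vanishing gradient forces u = 0; this is what makes the final inequality
strict. -/
theorem H10σ_gradNormSq_pos {U : Set E3} {C : ℝ≥0∞} {u : VH1 U}
    (h : ∀ i, ∫⁻ y in U, ‖u.val i y‖ₑ ^ (2 : ℝ) ≤ C * ENNReal.ofReal u.gradNormSq) (hne : u ≠ 0) :
    0 < u.gradNormSq := by
  refine lt_of_le_of_ne u.gradNormSq_nonneg fun h0 => hne ?_
  have hg : ∀ i j, (u i).1.2 j = 0 := by
    intro i j
    have h1 := (Finset.sum_eq_zero_iff_of_nonneg fun i _ => Finset.sum_nonneg fun j _ => by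
      positivity).1 h0.symm i (Finset.mem_univ i)
    have h2 := (Finset.sum_eq_zero_iff_of_nonneg fun j _ => by positivity).1 h1 j (Finset.mem_univ j)
    simpa using h2
  have hf : ∀ i, (u i).1.1 = 0 := by
    intro i
    have h1 := h i
    rw [← h0, ENNReal.ofReal_zero, mul_zero] at h1
    have h2 := enorm_Lp_sq (u i).1.1
    rw [show ∫⁻ y in U, ‖(u i).1.1 y‖ₑ ^ (2 : ℝ) = ∫⁻ y in U, ‖u.val i y‖ₑ ^ (2 : ℝ) from rfl,
      le_antisymm h1 bot_le] at h2
    simpa using h2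
  funext i
  refine Subtype.ext (Prod.ext (hf i) ?_)
  funext j
  exact hg i j

/-! ### Fields of class `H²` -/

theorem lintegral_sum_rpow_le {α : Type*} [MeasurableSpace α] {μ : Measure α}
    {f : Fin 3 → α → ℝ≥0∞} (hf : ∀ i, Measurable (f i)) {p : ℝ} (hp : 1 ≤ p) {B : ℝ≥0∞}
    (h : ∀ i, ∫⁻ y, f i y ^ p ∂μ ≤ B) :
    ∫⁻ y, (∑ i, f i y) ^ p ∂μ ≤ (3 : ℝ≥0∞) ^ p * B := by
  calc ∫⁻ y, (∑ i, f i y) ^ p ∂μ ≤ ∫⁻ y, (3 : ℝ≥0∞) ^ (p - 1) * ∑ i, f i y ^ p ∂μ :=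
        lintegral_mono fun y => sum_rpow_le (fun i => f i y) hp
    _ = (3 : ℝ≥0∞) ^ (p - 1) * ∑ i, ∫⁻ y, f i y ^ p ∂μ := by
        have : (3 : ℝ≥0∞) ^ (p - 1) ≠ ⊤ := ENNReal.rpow_ne_top_of_nonneg (by linarith) (by simp)
        rw [lintegral_const_mul' _ _ this, lintegral_finsetSum _ fun i _ => (hf i).pow_const p]
    _ ≤ (3 : ℝ≥0∞) ^ (p - 1) * ∑ _i : Fin 3, B := by
        gcongr with i
        exact h i
    _ = (3 : ℝ≥0∞) ^ (p - 1) * 3 ^ (1 : ℝ) * B := by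
        simp only [Finset.sum_const, Finset.card_univ, Fintype.card_fin, nsmul_eq_mul,
          ENNReal.rpow_one]
        rw [mul_assoc]
        norm_num
    _ = _ := by
        rw [← ENNReal.rpow_add _ _ (by norm_num) (by norm_num), sub_add_cancel]

theorem lintegral_add_rpow_le {α : Type*} [MeasurableSpace α] {μ : Measure α}
    {f g : α → ℝ≥0∞} (hf : Measurable f) {p : ℝ} (hp : 1 ≤ p) {A B : ℝ≥0∞}
    (h : ∫⁻ y, f y ^ p ∂μ ≤ A) (h' : ∫⁻ y, g y ^ p ∂μ ≤ B) :
    ∫⁻ y, (f y + g y) ^ p ∂μ ≤ (2 : ℝ≥0∞) ^ (p - 1) * (A + B) := by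
  calc ∫⁻ y, (f y + g y) ^ p ∂μ ≤ ∫⁻ y, (2 : ℝ≥0∞) ^ (p - 1) * (f y ^ p + g y ^ p) ∂μ :=
        lintegral_mono fun y => ENNReal.rpow_add_le_mul_rpow_add_rpow _ _ hp
    _ = (2 : ℝ≥0∞) ^ (p - 1) * (∫⁻ y, f y ^ p ∂μ + ∫⁻ y, g y ^ p ∂μ) := by
        have : (2 : ℝ≥0∞) ^ (p - 1) ≠ ⊤ := ENNReal.rpow_ne_top_of_nonneg (by linarith) (by simp)
        rw [lintegral_const_mul' _ _ this, lintegral_add_left (hf.pow_const p)]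
    _ ≤ _ := by gcongr

theorem lintegral_h1Density_rpow_le {U : Set E3} (hU : IsOpen U) (f : L2 U) (g : Fin 3 → L2 U)
    {p : ℝ} (hp : 1 ≤ p) {B : ℝ≥0∞} (hf : ∫⁻ y in U, ‖f y‖ₑ ^ p ≤ B)
    (hg : ∀ j, ∫⁻ y in U, ‖g j y‖ₑ ^ p ≤ B) :
    ∫⁻ y, h1Density U f g y ^ p ≤ (2 : ℝ≥0∞) ^ (p - 1) * (B + 3 ^ p * B) := by
  have e : ∫⁻ y, h1Density U f g y ^ p = ∫⁻ y in U, (‖f y‖ₑ + ∑ j, ‖g j y‖ₑ) ^ p := by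
    rw [← lintegral_indicator hU.measurableSet]
    refine lintegral_congr fun y => ?_
    by_cases hy : y ∈ U
    · simp [h1Density, hy]
    · simp only [h1Density, indicator_of_notMem hy]
      exact ENNReal.zero_rpow_of_pos (by linarith)
  rw [e]
  exact lintegral_add_rpow_le (Lp.stronglyMeasurable f).enorm hp hf
    (lintegral_sum_rpow_le (fun j => (Lp.stronglyMeasurable (g j)).enorm) hp hg)

/-- The L⁴ embedding is applied to the function and to its first derivatives, using the second
derivatives; then the embedding of W^{1,4} bounds the function itself. -/
theorem HasCone.exists_bound_of_norm_le {U : Set E3} (hU : IsOpen U) (hb : Bornology.IsBounded U)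
    (hc : HasCone U) (R : ℝ) :
    ∃ M : ℝ≥0∞, M ≠ ⊤ ∧ ∀ F : H2 U, ‖F‖ ≤ R →
      (∀ j, ∫⁻ y in U, ‖F.1.2.1 j y‖ₑ ^ (4 : ℝ) ≤ M) ∧
        ∀ᵐ y ∂volume.restrict U, ‖F.1.1 y‖ₑ ≤ M := by
  obtain ⟨C, hC, hfour⟩ := hc.lintegral_four_le hU hb
  obtain ⟨C', hC', hsup⟩ := hc.enorm_le hU hb
  set B₂ := ENNReal.ofReal (R ^ 2) with hB₂
  set B₄ := C * ((2 : ℝ≥0∞) ^ ((2 : ℝ) - 1) * (B₂ + 3 ^ (2 : ℝ) * B₂)) ^ (2 : ℝ) with hB₄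
  set B := C' * ((2 : ℝ≥0∞) ^ ((4 : ℝ) - 1) * (B₄ + 3 ^ (4 : ℝ) * B₄)) ^ (1 / 4 : ℝ) with hB
  have hB₂t : B₂ ≠ ⊤ := ENNReal.ofReal_ne_top
  have hB₄t : B₄ ≠ ⊤ := by finiteness
  refine ⟨B₄ + B, by finiteness, fun F hF => ?_⟩
  have hF' : ‖F.1‖ ≤ R := hF
  have n1 : ‖F.1.1‖ ≤ R := (norm_fst_le F.1).trans hF'
  have n2 : ∀ j, ‖F.1.2.1 j‖ ≤ R := fun j =>
    (norm_le_pi_norm F.1.2.1 j).trans ((norm_fst_le F.1.2).trans ((norm_snd_le F.1).trans hF'))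
  have n3 : ∀ j k, ‖F.1.2.2 j k‖ ≤ R := fun j k =>
    (norm_le_pi_norm (F.1.2.2 j) k).trans ((norm_le_pi_norm F.1.2.2 j).trans
      ((norm_snd_le F.1.2).trans ((norm_snd_le F.1).trans hF')))
  have two : ∀ f : L2 U, ‖f‖ ≤ R → ∫⁻ y in U, ‖f y‖ₑ ^ (2 : ℝ) ≤ B₂ := fun f hf => by
    rw [← enorm_Lp_sq]
    exact ENNReal.ofReal_le_ofReal (by gcongr)
  have four : ∀ (f : L2 U) (g : Fin 3 → L2 U), (∀ j, IsWeakPartial U j f (g j)) → ‖f‖ ≤ R →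
      (∀ j, ‖g j‖ ≤ R) → ∫⁻ y in U, ‖f y‖ₑ ^ (4 : ℝ) ≤ B₄ := fun f g h hf hg => by
    refine (hfour f g h).trans ?_
    rw [hB₄]
    gcongr
    exact lintegral_h1Density_rpow_le hU f g (by norm_num) (two f hf) fun j => two _ (hg j)
  have g4 : ∀ j, ∫⁻ y in U, ‖F.1.2.1 j y‖ₑ ^ (4 : ℝ) ≤ B₄ := fun j =>
    four _ _ (F.2.2 j) (n2 j) (n3 j)
  refine ⟨fun j => (g4 j).trans le_self_add, ?_⟩
  rw [ae_restrict_iff' hU.measurableSet]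
  filter_upwards [hsup F.1.1 F.1.2.1 F.2.1] with y hy hyU
  refine (hy hyU).trans (le_trans ?_ le_add_self)
  rw [hB]
  gcongr
  exact lintegral_h1Density_rpow_le hU _ _ (by norm_num) (four _ _ F.2.1 n1 n2) g4

/-! ### The trilinear estimate -/

theorem lintegral_mul_le_sqrt {α : Type*} [MeasurableSpace α] {μ : Measure α} {f g : α → ℝ≥0∞}
    (hf : Measurable f) (hg : Measurable g) :
    ∫⁻ y, f y * g y ∂μ ≤
      (∫⁻ y, f y ^ (2 : ℝ) ∂μ) ^ (1 / 2 : ℝ) * (∫⁻ y, g y ^ (2 : ℝ) ∂μ) ^ (1 / 2 : ℝ) :=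
  ENNReal.lintegral_mul_le_Lp_mul_Lq μ (by rw [Real.holderConjugate_iff]; norm_num)
    hf.aemeasurable hg.aemeasurable

/-- Hölder's inequality for a product of a square integrable function with a sum of a small
multiple of a square integrable function and a product localized to a thin set. -/
theorem lintegral_trilinear_le {α : Type*} [MeasurableSpace α] {μ : Measure α}
    {P A V D θ : α → ℝ≥0∞} (hP : Measurable P) (hA : Measurable A) (hV : Measurable V)
    (hD : Measurable D) (hθ : Measurable θ) {τ δ c N : ℝ≥0∞} (hτ : τ ≠ ⊤) (hδ : δ ≠ ⊤)
    (hθ1 : ∀ᵐ y ∂μ, θ y ≤ 1) (hθA : ∀ᵐ y ∂μ, θ y * V y ≤ δ * A y)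
    (iP : ∫⁻ y, P y ^ (2 : ℝ) ∂μ ≤ c * N) (iA : ∫⁻ y, A y ^ (2 : ℝ) ∂μ ≤ c * N)
    (iV : ∫⁻ y, V y ^ (6 : ℝ) ∂μ ≤ c * N ^ (3 : ℝ)) (iD : ∫⁻ y, D y ^ (4 : ℝ) ∂μ ≤ c) :
    ∫⁻ y, P y * (τ * A y + θ y * V y * D y) ∂μ ≤ c * (τ + δ ^ (1 / 4 : ℝ)) * N := by
  have hsq : ∀ {f : α → ℝ≥0∞} {p : ℝ}, ∀ y, (f y ^ p) ^ (2 : ℝ) = f y ^ (p * 2) := fun y => by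
    rw [ENNReal.rpow_mul]
  -- Only one of the four factors is exchanged for δA; the other three keep V³, whose square is the
  -- controlled sixth power.
  have j1 : ∫⁻ y, (θ y * V y) ^ (4 : ℝ) ∂μ ≤
      δ * ((c * N) ^ (1 / 2 : ℝ) * (c * N ^ (3 : ℝ)) ^ (1 / 2 : ℝ)) := by
    calc ∫⁻ y, (θ y * V y) ^ (4 : ℝ) ∂μ ≤ ∫⁻ y, δ * (A y * V y ^ (3 : ℝ)) ∂μ := by
          refine lintegral_mono_ae ?_
          filter_upwards [hθ1, hθA] with y h1 h2
          calc (θ y * V y) ^ (4 : ℝ) = (θ y * V y) * (θ y * V y) ^ (3 : ℝ) := by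
                nth_rw 2 [← ENNReal.rpow_one (θ y * V y)]
                rw [← ENNReal.rpow_add_of_nonneg _ _ (by norm_num) (by norm_num)]
                norm_num
            _ ≤ (δ * A y) * (1 * V y) ^ (3 : ℝ) := by gcongr
            _ = _ := by rw [one_mul, mul_assoc]
      _ ≤ _ := by
          rw [lintegral_const_mul' _ _ hδ]
          gcongr
          refine (lintegral_mul_le_sqrt hA (hV.pow_const _)).trans ?_
          simp only [hsq]
          norm_num
          norm_num at iA iV
          gcongr
  have j2 : ∫⁻ y, (θ y * V y * D y) ^ (2 : ℝ) ∂μ ≤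
      (δ * ((c * N) ^ (1 / 2 : ℝ) * (c * N ^ (3 : ℝ)) ^ (1 / 2 : ℝ))) ^ (1 / 2 : ℝ) *
        c ^ (1 / 2 : ℝ) := by
    have h1 := lintegral_mul_le_sqrt (μ := μ) (f := fun y => (θ y * V y) ^ (2 : ℝ))
      (g := fun y => D y ^ (2 : ℝ)) ((hθ.mul hV).pow_const _) (hD.pow_const _)
    simp only [← ENNReal.mul_rpow_of_nonneg _ _ (show (0 : ℝ) ≤ 2 by norm_num),
      ← ENNReal.rpow_mul] at h1
    rw [show (2 : ℝ) * 2 = 4 by norm_num] at h1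
    exact h1.trans (by gcongr)
  -- The exponents of c are 1/2 + 1/8 + 1/8 + 1/4 and those of N are 1/2 + 1/8 + 3/8, both summing
  -- to 1: the estimate is quadratic in u.
  have e : (c * N) ^ (1 / 2 : ℝ) * ((δ * ((c * N) ^ (1 / 2 : ℝ) *
      (c * N ^ (3 : ℝ)) ^ (1 / 2 : ℝ))) ^ (1 / 2 : ℝ) * c ^ (1 / 2 : ℝ)) ^ (1 / 2 : ℝ) =
      c * δ ^ (1 / 4 : ℝ) * N := by
    have n0 : (0 : ℝ) ≤ 1 / 2 := by norm_num
    simp only [ENNReal.mul_rpow_of_nonneg _ _ n0, ← ENNReal.rpow_mul]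
    have ec : c ^ (1 / 2 : ℝ) * c ^ (1 / 2 * (1 / 2) * (1 / 2) : ℝ) *
        c ^ (1 / 2 * (1 / 2) * (1 / 2) : ℝ) * c ^ (1 / 2 * (1 / 2) : ℝ) = c := by
      rw [← ENNReal.rpow_add_of_nonneg _ _ (by norm_num) (by norm_num),
        ← ENNReal.rpow_add_of_nonneg _ _ (by norm_num) (by norm_num),
        ← ENNReal.rpow_add_of_nonneg _ _ (by norm_num) (by norm_num)]
      norm_num
    have eN : N ^ (1 / 2 : ℝ) * N ^ (1 / 2 * (1 / 2) * (1 / 2) : ℝ) *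
        N ^ (3 * (1 / 2) * (1 / 2) * (1 / 2) : ℝ) = N := by
      rw [← ENNReal.rpow_add_of_nonneg _ _ (by norm_num) (by norm_num),
        ← ENNReal.rpow_add_of_nonneg _ _ (by norm_num) (by norm_num)]
      norm_num
    rw [show (1 / 4 : ℝ) = 1 / 2 * (1 / 2) by norm_num]
    calc _ = (c ^ (1 / 2 : ℝ) * c ^ (1 / 2 * (1 / 2) * (1 / 2) : ℝ) *
        c ^ (1 / 2 * (1 / 2) * (1 / 2) : ℝ) * c ^ (1 / 2 * (1 / 2) : ℝ)) *
        δ ^ (1 / 2 * (1 / 2) : ℝ) * (N ^ (1 / 2 : ℝ) * N ^ (1 / 2 * (1 / 2) * (1 / 2) : ℝ) *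
        N ^ (3 * (1 / 2) * (1 / 2) * (1 / 2) : ℝ)) := by ring
      _ = _ := by rw [ec, eN]
  calc ∫⁻ y, P y * (τ * A y + θ y * V y * D y) ∂μ
      = τ * ∫⁻ y, P y * A y ∂μ + ∫⁻ y, P y * (θ y * V y * D y) ∂μ := by
        have hm : Measurable fun y => τ * (P y * A y) := (hP.mul hA).const_mul _
        rw [← lintegral_const_mul' _ _ hτ, ← lintegral_add_left hm]
        refine lintegral_congr fun y => ?_
        ring
    _ ≤ τ * ((c * N) ^ (1 / 2 : ℝ) * (c * N) ^ (1 / 2 : ℝ)) + (c * N) ^ (1 / 2 : ℝ) *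
        ((δ * ((c * N) ^ (1 / 2 : ℝ) * (c * N ^ (3 : ℝ)) ^ (1 / 2 : ℝ))) ^ (1 / 2 : ℝ) *
          c ^ (1 / 2 : ℝ)) ^ (1 / 2 : ℝ) := by
        gcongr
        · exact (lintegral_mul_le_sqrt hP hA).trans (by gcongr)
        · have hm : Measurable fun y => θ y * V y * D y := (hθ.mul hV).mul hD
          exact (lintegral_mul_le_sqrt hP hm).trans (by gcongr)
    _ = τ * (c * N) + c * δ ^ (1 / 4 : ℝ) * N := by
        rw [e, ← ENNReal.rpow_add_of_nonneg _ _ (by norm_num) (by norm_num)]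
        norm_num
    _ = _ := by ring

/-! ### Pointwise bound for the integrand -/

theorem enorm_sum_fin_three_le {f : Fin 3 → ℝ} {B : ℝ≥0∞} (h : ∀ i, ‖f i‖ₑ ≤ B) :
    ‖∑ i, f i‖ₑ ≤ 3 * B := by
  refine (enorm_sum_le _ _).trans ((Finset.sum_le_sum fun i _ => h i).trans ?_)
  simp

theorem enorm_pd_le (k : Fin 3) (f : E3 → ℝ) (y : E3) : ‖pd k f y‖ₑ ≤ ‖fderiv ℝ f y‖ₑ := by
  rw [enorm_le_iff_norm_le]
  refine ((fderiv ℝ f y).le_opNorm _).trans ?_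
  simp

theorem le_sum_fin {n : ℕ} (f : Fin n → ℝ≥0∞) (i : Fin n) : f i ≤ ∑ j, f j :=
  Finset.single_le_sum (fun _ _ => bot_le) (Finset.mem_univ i)

/-- The sum of the moduli of the components of a field. -/
noncomputable def VH1.absSum {U : Set E3} (u : VH1 U) (y : E3) : ℝ≥0∞ := ∑ i, ‖u.val i y‖ₑ

/-- The sum of the moduli of the weak partial derivatives of a field. -/
noncomputable def VH1.absGrad {U : Set E3} (u : VH1 U) (y : E3) : ℝ≥0∞ :=
  ∑ i, ∑ j, ‖u.wd i j y‖ₑ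

theorem VH1.measurable_val {U : Set E3} (u : VH1 U) (i : Fin 3) : Measurable (u.val i) :=
  (Lp.stronglyMeasurable (u i).1.1).measurable

theorem VH1.measurable_wd {U : Set E3} (u : VH1 U) (i j : Fin 3) : Measurable (u.wd i j) :=
  (Lp.stronglyMeasurable ((u i).1.2 j)).measurable

theorem VH1.measurable_absSum {U : Set E3} (u : VH1 U) : Measurable u.absSum :=
  Finset.measurable_fun_sum _ fun i _ => (u.measurable_val i).enorm

theorem VH1.measurable_absGrad {U : Set E3} (u : VH1 U) : Measurable u.absGrad :=
  Finset.measurable_fun_sum _ fun i _ => Finset.measurable_fun_sum _ fun j _ =>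
    (u.measurable_wd i j).enorm

theorem VH1.enorm_wd_le {U : Set E3} (u : VH1 U) (i j : Fin 3) (y : E3) :
    ‖u.wd i j y‖ₑ ≤ u.absGrad y :=
  (le_sum_fin (fun j => ‖u.wd i j y‖ₑ) j).trans (le_sum_fin (fun i => ∑ j, ‖u.wd i j y‖ₑ) i)

theorem VH1.enorm_val_le {U : Set E3} (u : VH1 U) (i : Fin 3) (y : E3) :
    ‖u.val i y‖ₑ ≤ u.absSum y :=
  le_sum_fin (fun i => ‖u.val i y‖ₑ) i

namespace Family

variable (D : Family)

theorem enorm_N_le {t : ℝ} {y : E3} {m : ℝ≥0∞} (hΓ : ∀ k i j, ‖D.Γ t k i j y‖ₑ ≤ m)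
    (u : VH1 D.Ωref) (i : Fin 3) :
    ‖D.N t u u y i‖ₑ ≤ u.absSum y * ((1 + m) * (u.absGrad y + u.absSum y)) := by
  have hc : ∀ j, ‖D.cov t u j i y‖ₑ ≤ (1 + m) * (u.absGrad y + u.absSum y) := fun j => by
    calc ‖D.cov t u j i y‖ₑ ≤ ‖u.wd i j y‖ₑ + ∑ k, ‖D.Γ t i j k y‖ₑ * ‖u.val k y‖ₑ := by
          refine (enorm_add_le _ _).trans ?_
          gcongr
          refine (enorm_sum_le _ _).trans (le_of_eq (Finset.sum_congr rfl fun k _ => enorm_mul _ _))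
      _ ≤ u.absGrad y + ∑ k, m * ‖u.val k y‖ₑ := by
          gcongr with k
          · exact u.enorm_wd_le i j y
          · exact hΓ _ _ _
      _ = u.absGrad y + m * u.absSum y := by rw [← Finset.mul_sum]; rfl
      _ ≤ u.absGrad y + m * u.absSum y + (m * u.absGrad y + u.absSum y) := le_self_add
      _ = _ := by ring
  calc ‖D.N t u u y i‖ₑ ≤ ∑ j, ‖u.val j y‖ₑ * ‖D.cov t u j i y‖ₑ :=
        (enorm_sum_le _ _).trans (le_of_eq (Finset.sum_congr rfl fun k _ => enorm_mul _ _))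
    _ ≤ ∑ j, ‖u.val j y‖ₑ * ((1 + m) * (u.absGrad y + u.absSum y)) := by
        gcongr with j
        exact hc j
    _ = _ := by rw [← Finset.sum_mul]; rfl

theorem enorm_Rot_le {t : ℝ} {y : E3} {m : ℝ≥0∞} (h1 : ∀ i j k l, ‖D.R1 t i j k l y‖ₑ ≤ m)
    (h2 : ∀ i j k l, ‖D.R2 t i j k l y‖ₑ ≤ m) (θ : E3 → ℝ) (w : VH1 D.Ωref) (i : Fin 3) :
    ‖D.Rot t θ w y i‖ₑ ≤
      27 * m * ((‖θ y‖ₑ + ‖fderiv ℝ θ y‖ₑ) * w.absSum y + ‖θ y‖ₑ * w.absGrad y) := by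
  calc ‖D.Rot t θ w y i‖ₑ ≤ 3 * (3 * (3 * (m * (‖θ y‖ₑ * w.absSum y)))) +
        3 * (3 * (3 * (m * (‖fderiv ℝ θ y‖ₑ * w.absSum y + ‖θ y‖ₑ * w.absGrad y)))) := by
        refine (enorm_add_le _ _).trans ?_
        gcongr <;> refine enorm_sum_fin_three_le fun j => enorm_sum_fin_three_le fun k =>
          enorm_sum_fin_three_le fun l => ?_
        · rw [enorm_mul, enorm_mul]
          gcongr
          · exact h1 _ _ _ _
          · exact w.enorm_val_le l y
        · rw [enorm_mul]
          gcongr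
          · exact h2 _ _ _ _
          · refine (enorm_add_le _ _).trans ?_
            rw [enorm_mul, enorm_mul]
            gcongr
            · exact enorm_pd_le _ _ _
            · exact w.enorm_val_le l y
            · exact w.enorm_wd_le l k y
    _ = _ := by ring

theorem enorm_pairingDensity_le {t : ℝ} {y : E3} {m A B : ℝ≥0∞} (hJ : ‖D.J t‖ₑ ≤ m)
    (hg : ∀ i j, ‖D.gLow t i j y‖ₑ ≤ m) {a b : E3 → Fin 3 → ℝ} (ha : ∀ i, ‖a y i‖ₑ ≤ A)
    (hb : ∀ i, ‖b y i‖ₑ ≤ B) : ‖D.pairingDensity t a b y‖ₑ ≤ 9 * m * m * (A * B) := by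
  calc ‖D.pairingDensity t a b y‖ₑ ≤ 3 * (3 * (m * A * B)) * m := by
        rw [pairingDensity, enorm_mul]
        gcongr
        refine enorm_sum_fin_three_le fun i => enorm_sum_fin_three_le fun j => ?_
        rw [enorm_mul, enorm_mul]
        gcongr
        · exact hg i j
        · exact ha i
        · exact hb j
    _ = _ := by ring

theorem aemeasurable_pairingDensity (t : ℝ) (u w : VH1 D.Ωref) {θ : E3 → ℝ} (hθ : Measurable θ) :
    AEMeasurable (D.pairingDensity t (D.N t u u) (D.Rot t θ w)) (volume.restrict D.Ωref) := by
  have hN : ∀ i, AEMeasurable (fun y => D.N t u u y i) (volume.restrict D.Ωref) := fun i =>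
    Finset.aemeasurable_fun_sum _ fun j _ => (u.measurable_val j).aemeasurable.mul
      ((u.measurable_wd i j).aemeasurable.add (Finset.aemeasurable_fun_sum _ fun k _ =>
        (D.aemeasurable_Γ t i j k).mul (u.measurable_val k).aemeasurable))
  have hR : ∀ i, AEMeasurable (fun y => D.Rot t θ w y i) (volume.restrict D.Ωref) := fun i =>
    (Finset.aemeasurable_fun_sum _ fun j _ => Finset.aemeasurable_fun_sum _ fun k _ =>
      Finset.aemeasurable_fun_sum _ fun l _ => (D.aemeasurable_R1 t i j k l).mul
        (hθ.mul (w.measurable_val l)).aemeasurable).add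
    (Finset.aemeasurable_fun_sum _ fun j _ => Finset.aemeasurable_fun_sum _ fun k _ =>
      Finset.aemeasurable_fun_sum _ fun l _ => (D.aemeasurable_R2 t i j k l).mul
        (((measurable_pd k θ).mul (w.measurable_val l)).add
          (hθ.mul (w.measurable_wd l k))).aemeasurable)
  exact (Finset.aemeasurable_fun_sum _ fun i _ => Finset.aemeasurable_fun_sum _ fun j _ =>
    ((D.measurable_gLow t i j).aemeasurable.mul (hN i)).mul (hR j)).mul_const _

end Family

/-! ### Consequences of the cut-off bounds -/

theorem exp_neg_one_div_le {ρ : ℝ} (hρ : 0 < ρ) : Real.exp (-1 / ρ) ≤ ρ := by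
  have h := Real.add_one_le_exp (1 / ρ)
  have h' : 1 / ρ ≤ Real.exp (1 / ρ) := by linarith
  rw [neg_div, Real.exp_neg]
  rw [div_le_iff₀ hρ] at h'
  rw [inv_le_iff_one_le_mul₀ (Real.exp_pos _)]
  linarith

/-- The support lies where the distance is at most 2e^{-1/ρ}, and e^{-1/ρ} ≤ ρ. -/
theorem IsBoundaryCutoff.enorm_mul_infDist_le {U : Set E3} {ρ : ℝ} {θ : E3 → ℝ}
    (h : IsBoundaryCutoff U ρ θ) (hρ : 0 < ρ) {y : E3} (hy : y ∈ U) :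
    ‖θ y‖ₑ * ENNReal.ofReal (infDist y (frontier U)) ≤ ENNReal.ofReal (2 * ρ) := by
  by_cases hd : 2 * Real.exp (-1 / ρ) < infDist y (frontier U)
  · simp [h.eq_zero y (subset_closure hy) hd]
  · have h1 : ‖θ y‖ₑ ≤ 1 := by
      rw [Real.enorm_eq_ofReal (h.mem_Icc y).1]
      exact ENNReal.ofReal_le_one.2 (h.mem_Icc y).2
    calc ‖θ y‖ₑ * ENNReal.ofReal (infDist y (frontier U)) ≤ 1 * ENNReal.ofReal (2 * ρ) := by
          gcongr
          linarith [exp_neg_one_div_le hρ]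
      _ = _ := one_mul _

theorem IsBoundaryCutoff.enorm_fderiv_mul_infDist_le {U : Set E3} {ρ : ℝ} {θ : E3 → ℝ}
    (h : IsBoundaryCutoff U ρ θ) (hρ : 0 < ρ) {y : E3} (hy : y ∈ U)
    (hd : 0 < infDist y (frontier U)) :
    ‖fderiv ℝ θ y‖ₑ * ENNReal.ofReal (infDist y (frontier U)) ≤ ENNReal.ofReal (4 * ρ) := by
  rw [← ofReal_norm, ← ENNReal.ofReal_mul (norm_nonneg _)]
  refine ENNReal.ofReal_le_ofReal ?_
  have h1 := h.grad_le y hy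
  rw [le_div_iff₀ hd] at h1
  have h2 : Real.sqrt 3 ≤ 2 := Real.sqrt_le_iff.2 (by norm_num)
  nlinarith

/-- Sum of the moduli of the components divided by the distance to the boundary. -/
noncomputable def VH1.hardySum {U : Set E3} (u : VH1 U) (y : E3) : ℝ≥0∞ :=
  ∑ i, ‖u.val i y / infDist y (frontier U)‖ₑ

theorem VH1.measurable_hardySum {U : Set E3} (u : VH1 U) :
    Measurable u.hardySum :=
  Finset.measurable_fun_sum _ fun i _ =>
    ((u.measurable_val i).div (continuous_infDist_pt _).measurable).enorm

theorem VH1.absSum_eq {U : Set E3} (u : VH1 U) {y : E3}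
    (hd : 0 < infDist y (frontier U)) :
    u.absSum y = ENNReal.ofReal (infDist y (frontier U)) * u.hardySum y := by
  rw [VH1.hardySum, Finset.mul_sum]
  refine Finset.sum_congr rfl fun i _ => ?_
  rw [← Real.enorm_eq_ofReal hd.le, ← enorm_mul, mul_div_cancel₀ _ hd.ne']

namespace Family

variable (D : Family)

/-- The undifferentiated factor u coming from N is written as distance times |u|/d. The distance is
spent on θ and ∇θ, but the term with ∇w keeps θ|u| intact for the L⁴ estimate. -/
theorem enorm_pairingDensity_cutoff_le {t M ρ : ℝ} {y : E3} (hρ : 0 < ρ) (hJ : |D.J t| ≤ M)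
    (hy : y ∈ D.Ωref) (hg : ∀ i j, |D.gLow t i j y| ≤ M) (hΓ : ∀ k i j, |D.Γ t k i j y| ≤ M)
    (h1 : ∀ i j k l, |D.R1 t i j k l y| ≤ M) (h2 : ∀ i j k l, |D.R2 t i j k l y| ≤ M)
    {θ : E3 → ℝ} (hθ : IsBoundaryCutoff D.Ωref ρ θ) (u w : VH1 D.Ωref) {B : ℝ≥0∞}
    (hw : ∀ i, ‖w.val i y‖ₑ ≤ B) :
    ‖D.pairingDensity t (D.N t u u) (D.Rot t θ w) y‖ₑ ≤
      243 * ENNReal.ofReal M ^ 3 * (1 + ENNReal.ofReal M) *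
        ((u.absGrad y + u.absSum y) * (ENNReal.ofReal (6 * ρ) * (3 * B) * u.hardySum y +
          ‖θ y‖ₑ * u.absSum y * w.absGrad y)) := by
  have hd := infDist_frontier_pos D.isOpen_ref D.frontier_ref_nonempty hy
  have conv : ∀ {x : ℝ}, |x| ≤ M → ‖x‖ₑ ≤ ENNReal.ofReal M := fun h => by
    rw [Real.enorm_eq_ofReal_abs]
    exact ENNReal.ofReal_le_ofReal h
  set m := ENNReal.ofReal M
  have hW : w.absSum y ≤ 3 * B := (Finset.sum_le_sum fun i _ => hw i).trans (by simp)
  have hθd := hθ.enorm_mul_infDist_le hρ hy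
  have hθd' := hθ.enorm_fderiv_mul_infDist_le hρ hy hd
  refine (D.enorm_pairingDensity_le (conv hJ) (fun i j => conv (hg i j))
    (fun i => D.enorm_N_le (fun k i j => conv (hΓ k i j)) u i)
    (fun i => D.enorm_Rot_le (fun i j k l => conv (h1 i j k l)) (fun i j k l => conv (h2 i j k l))
      θ w i)).trans ?_
  have key : u.absSum y * ((‖θ y‖ₑ + ‖fderiv ℝ θ y‖ₑ) * w.absSum y + ‖θ y‖ₑ * w.absGrad y) ≤
      ENNReal.ofReal (6 * ρ) * (3 * B) * u.hardySum y + ‖θ y‖ₑ * u.absSum y * w.absGrad y := by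
    calc _ = (‖θ y‖ₑ * ENNReal.ofReal (infDist y (frontier D.Ωref)) +
          ‖fderiv ℝ θ y‖ₑ * ENNReal.ofReal (infDist y (frontier D.Ωref))) * w.absSum y *
            u.hardySum y + ‖θ y‖ₑ * u.absSum y * w.absGrad y := by
          rw [u.absSum_eq hd]
          ring
      _ ≤ (ENNReal.ofReal (2 * ρ) + ENNReal.ofReal (4 * ρ)) * (3 * B) * u.hardySum y +
          ‖θ y‖ₑ * u.absSum y * w.absGrad y := by gcongr
      _ = _ := by
          rw [← ENNReal.ofReal_add (by positivity) (by positivity)]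
          ring_nf
  calc _ = 243 * m ^ 3 * (1 + m) * ((u.absGrad y + u.absSum y) * (u.absSum y *
        ((‖θ y‖ₑ + ‖fderiv ℝ θ y‖ₑ) * w.absSum y + ‖θ y‖ₑ * w.absGrad y))) := by ring
    _ ≤ _ := by gcongr

/-- The constants precede ρ, θ, t, w and u in the quantifier order, which allows ρ to be chosen once
for all times and fields. -/
theorem exists_lintegral_pairingDensity_le {T : ℝ} (R : ℝ) : ∃ K B c : ℝ≥0∞, K ≠ ⊤ ∧ B ≠ ⊤ ∧
    c ≠ ⊤ ∧ ∀ ρ : ℝ, 0 < ρ → ∀ θ, IsBoundaryCutoff D.Ωref ρ θ → ∀ t ∈ Icc (0 : ℝ) T,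
      ∀ w : VH2 D.Ωref, ‖w‖ ≤ R → ∀ u ∈ H10σ D.Ωref,
        ∫⁻ y in D.Ωref, ‖D.pairingDensity t (D.N t u u) (D.Rot t θ w.toVH1) y‖ₑ ≤
          K * (c * (ENNReal.ofReal (6 * ρ) * B + ENNReal.ofReal (2 * ρ) ^ (1 / 4 : ℝ)) *
            ENNReal.ofReal u.gradNormSq) := by
  obtain ⟨M, hM, hcoef⟩ := D.exists_coeff_bound T
  obtain ⟨B, hB, hw⟩ := D.hasCone_ref.exists_bound_of_norm_le D.isOpen_ref D.isBounded_ref R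
  obtain ⟨C, hC, hu⟩ := exists_H10σ_bounds D.isOpen_ref D.isBounded_ref D.frontier_ref_nonempty
    fun y hy => D.nonempty_localDefining hy
  set m := ENNReal.ofReal M
  have hmt : m ≠ ⊤ := ENNReal.ofReal_ne_top
  -- These bound, up to powers of the gradient norm for the first three, the integrals of (|∇u| +
  -- |u|)², (|u|/d)², |u|⁶ and |∇w|⁴. Their sum is the single constant of the trilinear estimate.
  set c₁ : ℝ≥0∞ := 2 ^ ((2 : ℝ) - 1) * (3 ^ (2 : ℝ) * 3 ^ (2 : ℝ) + 3 ^ (2 : ℝ) * C) with hc₁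
  set c₂ : ℝ≥0∞ := 3 ^ (2 : ℝ) * C with hc₂
  set c₃ : ℝ≥0∞ := 3 ^ (6 : ℝ) * C with hc₃
  set c₄ : ℝ≥0∞ := 3 ^ (4 : ℝ) * (3 ^ (4 : ℝ) * B) with hc₄
  refine ⟨243 * m ^ 3 * (1 + m), 3 * B, c₁ + c₂ + c₃ + c₄, by finiteness, by finiteness,
    by finiteness, fun ρ hρ θ hθ t ht w hwR u hu' => ?_⟩
  have hwi : ∀ i, ‖w i‖ ≤ R := fun i => (norm_le_pi_norm w i).trans hwR
  have hKt : 243 * m ^ 3 * (1 + m) ≠ ⊤ := by finiteness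
  have hpt : ∀ᵐ y ∂volume.restrict D.Ωref,
      ‖D.pairingDensity t (D.N t u u) (D.Rot t θ w.toVH1) y‖ₑ ≤ 243 * m ^ 3 * (1 + m) *
        ((u.absGrad y + u.absSum y) * (ENNReal.ofReal (6 * ρ) * (3 * B) * u.hardySum y +
          ‖θ y‖ₑ * u.absSum y * w.toVH1.absGrad y)) := by
    have hwB : ∀ᵐ y ∂volume.restrict D.Ωref, ∀ i, ‖w.toVH1.val i y‖ₑ ≤ B :=
      ae_all_iff.2 fun i => (hw (w i) (hwi i)).2
    filter_upwards [hwB, ae_restrict_mem D.isOpen_ref.measurableSet] with y hyB hy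
    obtain ⟨hJ, hc⟩ := hcoef t ht
    obtain ⟨hg, hΓ, h1, h2⟩ := hc y hy
    exact D.enorm_pairingDensity_cutoff_le hρ hJ hy hg hΓ h1 h2 hθ u w.toVH1 hyB
  refine (lintegral_mono_ae hpt).trans ?_
  rw [lintegral_const_mul' _ _ hKt]
  gcongr
  -- Here A is |u|/d and V is |u|, with τ = 6ρ·3B from the bounded field and δ = 2ρ from the thin
  -- support.
  refine lintegral_trilinear_le (u.measurable_absGrad.add u.measurable_absSum)
    u.measurable_hardySum u.measurable_absSum w.toVH1.measurable_absGrad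
    hθ.smooth.continuous.measurable.enorm (by finiteness) (by finiteness) ?_ ?_ ?_ ?_ ?_ ?_
  · refine Eventually.of_forall fun y => ?_
    rw [Real.enorm_eq_ofReal (hθ.mem_Icc y).1]
    exact ENNReal.ofReal_le_one.2 (hθ.mem_Icc y).2
  · filter_upwards [ae_restrict_mem D.isOpen_ref.measurableSet] with y hy
    rw [u.absSum_eq (infDist_frontier_pos D.isOpen_ref D.frontier_ref_nonempty hy), ← mul_assoc]
    gcongr
    exact hθ.enorm_mul_infDist_le hρ hy
  · calc _ ≤ 2 ^ ((2 : ℝ) - 1) * (3 ^ (2 : ℝ) * (3 ^ (2 : ℝ) * ENNReal.ofReal u.gradNormSq) +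
          3 ^ (2 : ℝ) * (C * ENNReal.ofReal u.gradNormSq)) := by
          refine lintegral_add_rpow_le u.measurable_absGrad (by norm_num) ?_ ?_
          · refine lintegral_sum_rpow_le (fun i => Finset.measurable_fun_sum _ fun j _ =>
              (u.measurable_wd i j).enorm) (by norm_num) fun i => ?_
            exact lintegral_sum_rpow_le (fun j => (u.measurable_wd i j).enorm) (by norm_num)
              fun j => u.lintegral_wd_le i j
          · exact lintegral_sum_rpow_le (fun i => (u.measurable_val i).enorm) (by norm_num)
              fun i => (hu u hu' i).2.2
      _ = c₁ * ENNReal.ofReal u.gradNormSq := by rw [hc₁]; ring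
      _ ≤ _ := by
          gcongr
          rw [add_assoc, add_assoc]
          exact le_self_add
  · calc _ ≤ 3 ^ (2 : ℝ) * (C * ENNReal.ofReal u.gradNormSq) :=
          lintegral_sum_rpow_le (fun i => ((u.measurable_val i).div
            (continuous_infDist_pt _).measurable).enorm) (by norm_num) fun i => (hu u hu' i).1
      _ = c₂ * ENNReal.ofReal u.gradNormSq := by rw [hc₂, mul_assoc]
      _ ≤ _ := by
          gcongr
          rw [add_assoc, add_comm c₁, add_assoc]
          exact le_self_add
  · calc _ ≤ 3 ^ (6 : ℝ) * (C * ENNReal.ofReal u.gradNormSq ^ (3 : ℝ)) :=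
          lintegral_sum_rpow_le (fun i => (u.measurable_val i).enorm) (by norm_num)
            fun i => (hu u hu' i).2.1
      _ = c₃ * ENNReal.ofReal u.gradNormSq ^ (3 : ℝ) := by rw [hc₃, mul_assoc]
      _ ≤ _ := by
          gcongr
          rw [add_right_comm]
          exact le_add_self
  · calc _ ≤ c₄ := by
          refine lintegral_sum_rpow_le (fun i => Finset.measurable_fun_sum _ fun j _ =>
            (w.toVH1.measurable_wd i j).enorm) (by norm_num) fun i => ?_
          exact lintegral_sum_rpow_le (fun j => (w.toVH1.measurable_wd i j).enorm) (by norm_num)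
            fun j => (hw (w i) (hwi i)).1 j
      _ ≤ _ := le_add_self

end Family

/-! ### Choice of the parameter and conclusion -/

theorem exists_cutoff_parameter {K B c : ℝ≥0∞} (hK : K ≠ ⊤) (hB : B ≠ ⊤) (hc : c ≠ ⊤) {ε ρ₀ : ℝ}
    (hε : 0 < ε) (hρ₀ : 0 < ρ₀) : ∃ ρ : ℝ, 0 < ρ ∧ ρ < ρ₀ ∧
      K * (c * (ENNReal.ofReal (6 * ρ) * B + ENNReal.ofReal (2 * ρ) ^ (1 / 4 : ℝ))) <
        ENNReal.ofReal ε := by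
  have ha : ∀ a : ℝ, Tendsto (fun ρ : ℝ => ENNReal.ofReal (a * ρ)) (𝓝 0) (𝓝 0) := fun a => by
    have := (ENNReal.continuous_ofReal.tendsto _).comp ((continuous_const_mul a).tendsto 0)
    rwa [mul_zero, ENNReal.ofReal_zero] at this
  have h1 : Tendsto (fun ρ : ℝ => ENNReal.ofReal (2 * ρ) ^ (1 / 4 : ℝ)) (𝓝 0) (𝓝 0) := by
    have := ((ENNReal.continuous_rpow_const (y := (1 / 4 : ℝ))).tendsto 0).comp (ha 2)
    rwa [ENNReal.zero_rpow_of_pos (by norm_num)] at this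
  have h2 := ENNReal.Tendsto.const_mul (ENNReal.Tendsto.const_mul
    ((ENNReal.Tendsto.mul_const (ha 6) (Or.inr hB)).add h1) (Or.inr hc)) (Or.inr hK)
  simp only [zero_mul, add_zero, mul_zero] at h2
  have h3 := (h2.mono_left (nhdsWithin_le_nhds (s := Ioi 0))).eventually_lt_const
    (ENNReal.ofReal_pos.2 hε)
  obtain ⟨ρ, hρ, hρ'⟩ := (h3.and (Ioo_mem_nhdsGT hρ₀)).exists
  exact ⟨ρ, hρ'.1, hρ'.2, hρ⟩

end MovingDomain

theorem mainTheorem8 (D : MovingDomain.Family) (T : ℝ) (hT : 0 < T)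
    (w : C(Set.Icc (0 : ℝ) T, MovingDomain.VH2 D.Ωref)) (ε : ℝ) (hε : 0 < ε)
    (ρ₀ : ℝ) (hρ₀ : 0 < ρ₀) :
    ∃ ρ : ℝ, 0 < ρ ∧ ρ < ρ₀ ∧ ∃ θ : EuclideanSpace ℝ (Fin 3) → ℝ,
      MovingDomain.IsBoundaryCutoff D.Ωref ρ θ ∧
      ∀ u ∈ MovingDomain.H10σ D.Ωref, ∀ t : Set.Icc (0 : ℝ) T,
        MeasureTheory.IntegrableOn
          (D.pairingDensity t (D.N t u u) (D.Rot t θ (w t).toVH1)) D.Ωref ∧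
        (u ≠ 0 →
          D.pairing t (D.N t u u) (D.Rot t θ (w t).toVH1) < ε * u.gradNormSq) := by
  -- The supremum norm of the continuous curve w bounds w(t) in H² uniformly on [0,T].
  obtain ⟨K, B, c, hK, hB, hc, h⟩ := D.exists_lintegral_pairingDensity_le (T := T) ‖w‖
  obtain ⟨ρ, hρ, hρ', hsmall⟩ :=
    -- Aiming at ε/2 leaves a strict gap once the gradient norm is known to be positive.
    MovingDomain.exists_cutoff_parameter hK hB hc (half_pos hε) hρ₀
  obtain ⟨θ, hθ⟩ := MovingDomain.exists_isBoundaryCutoff D.Ωref hρ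
  refine ⟨ρ, hρ, hρ', θ, hθ, fun u hu t => ?_⟩
  have hle : ∫⁻ y in D.Ωref, ‖D.pairingDensity t (D.N t u u) (D.Rot t θ (w t).toVH1) y‖ₑ ≤
      ENNReal.ofReal (ε / 2) * ENNReal.ofReal u.gradNormSq := by
    refine (h ρ hρ θ hθ t t.2 (w t) (w.norm_coe_le_norm t) u hu).trans ?_
    rw [← mul_assoc]
    gcongr
  have hint : IntegrableOn (D.pairingDensity t (D.N t u u) (D.Rot t θ (w t).toVH1)) D.Ωref :=
    ⟨(D.aemeasurable_pairingDensity t u _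
      hθ.smooth.continuous.measurable).aestronglyMeasurable, hle.trans_lt (by finiteness)⟩
  refine ⟨hint, fun hne => ?_⟩
  obtain ⟨C, -, hC⟩ := MovingDomain.exists_H10σ_bounds D.isOpen_ref D.isBounded_ref
    D.frontier_ref_nonempty fun y hy => D.nonempty_localDefining hy
  have hpos := MovingDomain.H10σ_gradNormSq_pos (fun i => (hC u hu i).2.2) hne
  have h1 : D.pairing t (D.N t u u) (D.Rot t θ (w t).toVH1) ≤ ε / 2 * u.gradNormSq := by
    refine (le_abs_self _).trans ?_
    rw [← ENNReal.ofReal_le_ofReal_iff (by positivity), ENNReal.ofReal_mul (by positivity),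
      ← Real.enorm_eq_ofReal_abs]
    exact (enorm_integral_le_lintegral_enorm _).trans hle
  nlinarith
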